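/- Let $V,H$ be real separable Hilbert spaces with $V$ compactly and densely embedded in $H$, let $C>0$ satisfy $\|v\|_H\le C\|v\|_V$ for all $v\in V$, and identify $V\subset H\cong H^*\subset V^*$. Let $\mathcal H=\mathrm{HS}(H,H)$ and $\mathcal V=\mathrm{HS}(V^*,H)\cap \mathrm{HS}(H,V)$ with inner product $(R,S)_{\mathcal V}=(R,S)_{\mathrm{HS}(V^*,H)}+(R,S)_{\mathrm{HS}(H,V)}$, where $\mathrm{HS}$ denotes the space of Hilbert--Schmidt operators; let $\mathcal V^*=\mathrm{HS}(V,H)+\mathrm{HS}(H,V^*)$ be the dual of $\mathcal V$ under the pairing $\langle\cdot,\cdot\rangle$ that extends the inner product of $\mathcal H$, so that $\mathcal V\subset\mathcal H\subset\mathcal V^*$. For $P\in\mathcal H$ and $\beta\in\mathbb R$, $P\ge\beta$ means that $P$ is self-adjoint and $(Px,x)_H\ge\beta\|x\|_H^2$ for all $x\in H$. Let $T>0$, and for $t\in[0,T]$ let $a(t;\cdot,\cdot)$ be a bilinear form on $V$ such that $t\mapsto a(t;u,v)$ is Lebesgue measurable for all $u,v\in V$ and, with constants $\mu,\eta>0$,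 $a(t;u,u)\ge\mu\|u\|_V^2$ and $|a(t;u,v)|\le\eta\|u\|_V\|v\|_V$ for all $t\in[0,T]$, $u,v\in V$. Let $A(t),A^*(t):V\to V^*$ be given by $\langle A(t)u,v\rangle=a(t;u,v)$ and $\langle A^*(t)u,v\rangle=a(t;v,u)$. Let $0\le\gamma<\mu/C^2$, let $Q\in L^1(0,T;\mathcal H)+L^2(0,T;\mathcal V^*)$ with $Q(t)\in\mathcal H$ and $Q(t)\ge-\gamma^2$ for almost every $t$, and let $P_0\in\mathcal H$ with $P_0\ge-\gamma$. Let $\mathcal W$ be the space of all $P\in L^2(0,T;\mathcal V)$ with weak derivative $P'\in L^1(0,T;\mathcal H)+L^2(0,T;\mathcal V^*)$; its elements are identified with their representatives in $C([0,T];\mathcal H)$. A weak solution of $$P'+A^*(t)P+PA(t)+P^2=Q\ \text{ in }(0,T),\qquad P(0)=P_0,$$ is a function $P\in\mathcal W$ with $P(0)=P_0$ and $$-\int_0^T\langle P(t),R\rangle\varphi'(t)\,dt+\int_0^T\langle A^*(t)P(t)+P(t)A(t)+P(t)^2,R\rangle\varphi(t)\,dt=\int_0^T\langle Q(t),R\rangle\varphi(t)\,dt$$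 for all $R\in\mathcal V$ and $\varphi\in C_c^\infty(0,T)$. Then there is exactly one weak solution $P$ with $P(t)\ge-\gamma$ for every $t\in[0,T]$. Moreover, let $(N_k)_{k\in\mathbb N}$ be a sequence of positive integers with $N_k\to\infty$, and let $\tau_k=T/N_k$ with $\sup_k\tau_k<\mu/(2C^2)$. For each $k$, with $N=N_k$, $\tau=\tau_k$, $t_n=n\tau$, there are $P_1,\dots,P_N\in\mathcal V$ with $P_n\ge-\gamma$ and $$\frac{P_n-P_{n-1}}{\tau}+A_n^*P_n+P_nA_n+P_n^2=Q_n\quad\text{in }\mathcal V^*,\qquad n=1,\dots,N,$$ where $A_n=\frac1\tau\int_{t_{n-1}}^{t_n}A(t)\,dt$ (that is, $\langle A_nu,v\rangle=\frac1\tau\int_{t_{n-1}}^{t_n}a(t;u,v)\,dt$) and $Q_n=\frac1\tau\int_{t_{n-1}}^{t_n}Q(t)\,dt\in\mathcal V^*$. For any choice of such solutions, the piecewise constant functions $P_{\tau_k}$, given by $P_{\tau_k}(t)=P_n$ for $t\in(t_{n-1},t_n]$, satisfy $P_{\tau_k}\to P$ strongly in $L^2(0,T;\mathcal V)$ as $k\to\infty$.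 -/

import Mathlib

open MeasureTheory Filter Topology Set
open scoped ENNReal NNReal

noncomputable section

namespace Riccati

/-! ### The dual of a real Hilbert space as a Hilbert space -/

section DualSpace

variable {V : Type*} [NormedAddCommGroup V] [InnerProductSpace ℝ V] [CompleteSpace V]

/-- The Hilbert space structure of the dual space `V*` (with the operator norm), transported by the
Riesz isomorphism. -/
instance dualInnerProductSpace : InnerProductSpace ℝ (StrongDual ℝ V) where
  inner f g := inner ℝ ((InnerProductSpace.toDual ℝ V).symm f)
    ((InnerProductSpace.toDual ℝ V).symm g)
  norm_sq_eq_re_inner f := by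
    rw [← norm_sq_eq_re_inner, LinearIsometryEquiv.norm_map]
  conj_inner_symm f g := inner_conj_symm _ _
  add_left f g h := by rw [map_add, inner_add_left]
  smul_left f g r := by
    rw [map_smulₛₗ, inner_smul_left]
    simp

end DualSpace

/-- For `j : X → Y` linear and bounded, the dual map `Y ≅ Y* → X*`, `y ↦ (x ↦ ⟪y, j x⟫)`.
For an embedding `j : V → H` this is the embedding `H ≅ H* → V*`. -/
def dualEmb {X Y : Type*} [NormedAddCommGroup X] [InnerProductSpace ℝ X]
    [NormedAddCommGroup Y] [InnerProductSpace ℝ Y] (j : X →L[ℝ] Y) :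
    Y →L[ℝ] StrongDual ℝ X :=
  LinearMap.mkContinuous
    { toFun := fun y => (innerSL ℝ y).comp j
      map_add' := fun y z => by ext x; simp
      map_smul' := fun r y => by ext x; simp }
    ‖j‖ (fun y => by
      refine (ContinuousLinearMap.opNorm_comp_le _ _).trans ?_
      rw [innerSL_apply_norm, mul_comm])

@[simp] theorem dualEmb_apply {X Y : Type*} [NormedAddCommGroup X] [InnerProductSpace ℝ X]
    [NormedAddCommGroup Y] [InnerProductSpace ℝ Y] (j : X →L[ℝ] Y) (y : Y) (x : X) :
    dualEmb j y x = inner ℝ y (j x) := rfl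

/-- The Riesz map `V → V*`, `v ↦ ⟪v, ·⟫`. -/
def riesz (V : Type*) [NormedAddCommGroup V] [InnerProductSpace ℝ V] :
    V →L[ℝ] StrongDual ℝ V :=
  dualEmb (ContinuousLinearMap.id ℝ V)

theorem inner_riesz {V : Type*} [NormedAddCommGroup V] [InnerProductSpace ℝ V] [CompleteSpace V]
    (f : StrongDual ℝ V) (v : V) : inner ℝ f (riesz V v) = f v := by
  have h : riesz V v = InnerProductSpace.toDual ℝ V v := by
    ext w; simp [riesz]
  change inner ℝ ((InnerProductSpace.toDual ℝ V).symm f)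
    ((InnerProductSpace.toDual ℝ V).symm (riesz V v)) = f v
  rw [h, LinearIsometryEquiv.symm_apply_apply, InnerProductSpace.toDual_symm_apply]

/-! ### Hilbert--Schmidt operators -/

section HilbertSchmidt

/-- The index set of a fixed orthonormal (Hilbert) basis of `X`. -/
def basisIndex (X : Type*) [NormedAddCommGroup X] [InnerProductSpace ℝ X] [CompleteSpace X] :
    Set X :=
  (exists_hilbertBasis ℝ X).choose

/-- A fixed orthonormal (Hilbert) basis of `X`. -/
def basis (X : Type*) [NormedAddCommGroup X] [InnerProductSpace ℝ X] [CompleteSpace X] :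
    HilbertBasis (basisIndex X) ℝ X :=
  (exists_hilbertBasis ℝ X).choose_spec.choose

variable {X Y Z : Type*}
  [NormedAddCommGroup X] [InnerProductSpace ℝ X] [CompleteSpace X]
  [NormedAddCommGroup Y] [InnerProductSpace ℝ Y]
  [NormedAddCommGroup Z] [InnerProductSpace ℝ Z]

theorem ext_basis {T S : X →L[ℝ] Y} (h : ∀ i, T (basis X i) = S (basis X i)) : T = S := by
  refine ContinuousLinearMap.ext_on (s := Set.range (basis X)) ?_ ?_
  · rw [Submodule.dense_iff_topologicalClosure_eq_top]
    exact (basis X).dense_span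
  · rintro _ ⟨i, rfl⟩
    exact h i

theorem summable_of_summable_sq {κ : Type*} {f g : κ → Y}
    (hf : Summable fun i => ‖f i‖ ^ 2) (hg : Summable fun i => ‖g i‖ ^ 2) :
    Summable fun i => inner ℝ (f i) (g i) := by
  refine Summable.of_norm_bounded (hf.add hg) fun i => ?_
  have h1 := norm_inner_le_norm (𝕜 := ℝ) (f i) (g i)
  nlinarith [sq_nonneg (‖f i‖ - ‖g i‖), norm_nonneg (f i), norm_nonneg (g i), h1]

variable (X Y) in
/-- The linear space of Hilbert--Schmidt operators inside the bounded operators `X → Y`. -/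
def hsSubmodule : Submodule ℝ (X →L[ℝ] Y) where
  carrier := {T | Summable fun i => ‖T (basis X i)‖ ^ 2}
  zero_mem' := by simp [summable_zero]
  add_mem' := by
    intro T S hT hS
    refine Summable.of_nonneg_of_le (fun i => by positivity) (fun i => ?_)
      ((hT.mul_left 2).add (hS.mul_left 2))
    have h1 := norm_add_le (T (basis X i)) (S (basis X i))
    have h2 : (T + S) (basis X i) = T (basis X i) + S (basis X i) := rfl
    rw [h2]
    nlinarith [sq_nonneg (‖T (basis X i)‖ - ‖S (basis X i)‖), norm_nonneg (T (basis X i)),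
      norm_nonneg (S (basis X i)), norm_nonneg (T (basis X i) + S (basis X i))]
  smul_mem' := by
    intro c T hT
    have h : (fun i => ‖(c • T) (basis X i)‖ ^ 2) = fun i => c ^ 2 * ‖T (basis X i)‖ ^ 2 := by
      funext i
      simp [norm_smul, mul_pow]
    change Summable _
    rw [h]
    exact hT.mul_left _

variable (X Y) in
/-- The space `HS(X, Y)` of Hilbert--Schmidt operators; it carries the Hilbert--Schmidt inner
product below, not the operator norm. -/
def HS : Type _ := hsSubmodule X Y

instance : AddCommGroup (HS X Y) := inferInstanceAs (AddCommGroup (hsSubmodule X Y))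
instance : Module ℝ (HS X Y) := inferInstanceAs (Module ℝ (hsSubmodule X Y))

/-- The underlying bounded operator. -/
def HS.toCLM (T : HS X Y) : X →L[ℝ] Y := Subtype.val (p := fun S => S ∈ hsSubmodule X Y) T

/-- A bounded operator with finite Hilbert--Schmidt norm. -/
def HS.mk (T : X →L[ℝ] Y) (h : Summable fun i => ‖T (basis X i)‖ ^ 2) : HS X Y :=
  (⟨T, h⟩ : hsSubmodule X Y)

@[simp] theorem HS.toCLM_mk (T : X →L[ℝ] Y) (h) : (HS.mk T h).toCLM = T := rfl
@[simp] theorem HS.toCLM_add (T S : HS X Y) : (T + S).toCLM = T.toCLM + S.toCLM := rfl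
@[simp] theorem HS.toCLM_smul (c : ℝ) (T : HS X Y) : (c • T).toCLM = c • T.toCLM := rfl
@[simp] theorem HS.toCLM_zero : (0 : HS X Y).toCLM = 0 := rfl

theorem HS.ext {T S : HS X Y} (h : T.toCLM = S.toCLM) : T = S := Subtype.ext h

theorem HS.summable (T : HS X Y) : Summable fun i => ‖T.toCLM (basis X i)‖ ^ 2 :=
  Subtype.property (p := fun S => S ∈ hsSubmodule X Y) T

theorem HS.summable_inner (T S : HS X Y) :
    Summable fun i => inner ℝ (T.toCLM (basis X i)) (S.toCLM (basis X i)) :=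
  summable_of_summable_sq T.summable S.summable

/-- The Hilbert--Schmidt inner product `∑ᵢ ⟪T eᵢ, S eᵢ⟫`. -/
@[reducible] def hsCore : InnerProductSpace.Core ℝ (HS X Y) where
  inner T S := ∑' i, inner ℝ (T.toCLM (basis X i)) (S.toCLM (basis X i))
  conj_inner_symm T S := by
    simp only [conj_trivial]
    exact tsum_congr fun i => real_inner_comm _ _
  re_inner_nonneg T := by
    simp only [RCLike.re_to_real]
    exact tsum_nonneg fun i => real_inner_self_nonneg
  add_left T S R := by
    simp only [HS.toCLM_add, add_apply, inner_add_left]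
    exact (T.summable_inner R).tsum_add (S.summable_inner R)
  smul_left T S r := by
    simp only [HS.toCLM_smul, smul_apply, inner_smul_left, conj_trivial]
    exact tsum_mul_left
  definite T hT := by
    have h := (hasSum_zero_iff_of_nonneg (f := fun i =>
      inner ℝ (T.toCLM (basis X i)) (T.toCLM (basis X i)))
      (fun i => real_inner_self_nonneg)).1 (by
        have := (T.summable_inner T).hasSum
        rwa [hT] at this)
    refine HS.ext (ext_basis fun i => ?_)
    exact inner_self_eq_zero.1 (congrFun h i)

instance : NormedAddCommGroup (HS X Y) := hsCore.toNormedAddCommGroup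
instance : InnerProductSpace ℝ (HS X Y) := InnerProductSpace.ofCore hsCore.toCore

theorem HS.inner_def (T S : HS X Y) :
    inner ℝ T S = ∑' i, inner ℝ (T.toCLM (basis X i)) (S.toCLM (basis X i)) := rfl

theorem HS.norm_sq (T : HS X Y) : ‖T‖ ^ 2 = ∑' i, ‖T.toCLM (basis X i)‖ ^ 2 := by
  rw [← real_inner_self_eq_norm_sq, HS.inner_def]
  exact tsum_congr fun i => real_inner_self_eq_norm_sq _

/-- Left composition of a Hilbert--Schmidt operator with a bounded operator. -/
def HS.compLeft (A : Y →L[ℝ] Z) (T : HS X Y) : HS X Z :=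
  HS.mk (A.comp T.toCLM) (by
    refine Summable.of_nonneg_of_le (fun i => by positivity) (fun i => ?_)
      (T.summable.mul_left (‖A‖ ^ 2))
    rw [← mul_pow]
    gcongr
    exact A.le_opNorm _)

@[simp] theorem HS.toCLM_compLeft (A : Y →L[ℝ] Z) (T : HS X Y) :
    (HS.compLeft A T).toCLM = A.comp T.toCLM := rfl

theorem HS.norm_compLeft_le (A : Y →L[ℝ] Z) (T : HS X Y) :
    ‖HS.compLeft A T‖ ≤ ‖A‖ * ‖T‖ := by
  refine le_of_sq_le_sq ?_ (by positivity)
  rw [mul_pow, HS.norm_sq, HS.norm_sq, ← tsum_mul_left]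
  refine Summable.tsum_le_tsum (fun i => ?_) (HS.compLeft A T).summable
    (T.summable.mul_left (‖A‖ ^ 2))
  rw [← mul_pow]
  gcongr
  exact A.le_opNorm _

theorem enorm_sq_eq_tsum {ρ : Type*} (d : HilbertBasis ρ ℝ Y) (x : Y) :
    ‖x‖ₑ ^ 2 = ∑' k, ENNReal.ofReal ((inner ℝ x (d k)) ^ 2) := by
  have h := d.hasSum_inner_mul_inner x x
  have h' : HasSum (fun k => (inner ℝ x (d k)) ^ 2) (‖x‖ ^ 2) := by
    rw [← real_inner_self_eq_norm_sq]
    have e : (fun k => (inner ℝ x (d k)) ^ 2) = fun k => inner ℝ x (d k) * inner ℝ (d k) x := by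
      funext k
      rw [real_inner_comm x (d k), sq]
    rw [e]
    exact h
  rw [← ENNReal.ofReal_tsum_of_nonneg (fun k => sq_nonneg _) h'.summable, h'.tsum_eq,
    ENNReal.ofReal_pow (norm_nonneg _), ofReal_norm]

theorem HS.enorm_sq (T : HS X Y) : ‖T‖ₑ ^ 2 = ∑' i, ‖T.toCLM (basis X i)‖ₑ ^ 2 := by
  rw [← ofReal_norm, ← ENNReal.ofReal_pow (norm_nonneg _), HS.norm_sq,
    ENNReal.ofReal_tsum_of_nonneg (fun i => by positivity) T.summable]
  refine tsum_congr fun i => ?_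
  rw [ENNReal.ofReal_pow (norm_nonneg _), ofReal_norm]

section RightComposition

variable [CompleteSpace Y] [CompleteSpace Z]

/-- Parseval: for orthonormal bases `b` of `X` and `c` of `Y`, `∑ ‖T bᵢ‖² = ∑ ‖T* cₖ‖²`. -/
theorem tsum_enorm_sq_adjoint {κ ν : Type*} (b : HilbertBasis κ ℝ X) (c : HilbertBasis ν ℝ Y)
    (T : X →L[ℝ] Y) :
    ∑' i, ‖T (b i)‖ₑ ^ 2 = ∑' k, ‖ContinuousLinearMap.adjoint T (c k)‖ₑ ^ 2 := by
  calc ∑' i, ‖T (b i)‖ₑ ^ 2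
      = ∑' i, ∑' k, ENNReal.ofReal ((inner ℝ (T (b i)) (c k)) ^ 2) :=
        tsum_congr fun i => enorm_sq_eq_tsum c _
    _ = ∑' k, ∑' i, ENNReal.ofReal ((inner ℝ (T (b i)) (c k)) ^ 2) := ENNReal.tsum_comm
    _ = ∑' k, ‖ContinuousLinearMap.adjoint T (c k)‖ₑ ^ 2 := by
        refine tsum_congr fun k => ?_
        rw [enorm_sq_eq_tsum b]
        refine tsum_congr fun i => ?_
        rw [ContinuousLinearMap.adjoint_inner_left, real_inner_comm]

theorem summable_sq_iff {κ E : Type*} [NormedAddCommGroup E] (f : κ → E) :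
    (Summable fun i => ‖f i‖ ^ 2) ↔ ∑' i, ‖f i‖ₑ ^ 2 ≠ ∞ := by
  have h : (fun i => ‖f i‖ₑ ^ 2) = fun i => ((‖f i‖₊ ^ 2 : ℝ≥0) : ℝ≥0∞) := by
    funext i; simp [enorm_eq_nnnorm]
  rw [h, ENNReal.tsum_coe_ne_top_iff_summable, ← NNReal.summable_coe]
  simp

/-- The Hilbert--Schmidt norm does not depend on the orthonormal basis. -/
theorem HS.enorm_sq_eq {κ : Type*} (b : HilbertBasis κ ℝ X) (T : HS X Y) :
    ‖T‖ₑ ^ 2 = ∑' i, ‖T.toCLM (b i)‖ₑ ^ 2 := by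
  rw [HS.enorm_sq, tsum_enorm_sq_adjoint _ (basis Y), tsum_enorm_sq_adjoint b (basis Y)]

theorem HS.tsum_comp_le (T : HS Y Z) (B : X →L[ℝ] Y) :
    ∑' i, ‖T.toCLM (B (basis X i))‖ₑ ^ 2 ≤ ‖B‖ₑ ^ 2 * ‖T‖ₑ ^ 2 := by
  have h := tsum_enorm_sq_adjoint (basis X) (basis Z) (T.toCLM.comp B)
  simp only [ContinuousLinearMap.comp_apply, ContinuousLinearMap.adjoint_comp] at h
  rw [h, HS.enorm_sq, tsum_enorm_sq_adjoint (basis Y) (basis Z), ← ENNReal.tsum_mul_left]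
  refine ENNReal.tsum_le_tsum fun k => ?_
  rw [← mul_pow]
  gcongr
  refine (ContinuousLinearMap.le_opENorm _ _).trans ?_
  gcongr
  rw [← ofReal_norm, LinearIsometryEquiv.norm_map, ofReal_norm]

/-- The adjoint, as a Hilbert--Schmidt operator. -/
def HS.adj (T : HS X Y) : HS Y X :=
  HS.mk (ContinuousLinearMap.adjoint T.toCLM) (by
    rw [summable_sq_iff, ← tsum_enorm_sq_adjoint (basis X), ← HS.enorm_sq]
    finiteness)

theorem HS.norm_adj (T : HS X Y) : ‖T.adj‖ = ‖T‖ := by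
  have h : ‖T.adj‖ₑ ^ 2 = ‖T‖ₑ ^ 2 := by
    rw [HS.enorm_sq, HS.enorm_sq, tsum_enorm_sq_adjoint (basis X) (basis Y)]
    rfl
  have h2 : ‖T.adj‖ₑ = ‖T‖ₑ := le_antisymm ((ENNReal.pow_le_pow_left_iff two_ne_zero).1 h.le)
    ((ENNReal.pow_le_pow_left_iff two_ne_zero).1 h.ge)
  rwa [← ofReal_norm, ← ofReal_norm,
    ENNReal.ofReal_eq_ofReal_iff (norm_nonneg _) (norm_nonneg _)] at h2

theorem HS.inner_adj (T S : HS X Y) : inner ℝ T.adj S.adj = inner ℝ T S := by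
  have h : T.adj + S.adj = (T + S).adj := HS.ext (by simp [HS.adj])
  rw [real_inner_eq_norm_add_mul_self_sub_norm_mul_self_sub_norm_mul_self_div_two, h,
    HS.norm_adj, HS.norm_adj, HS.norm_adj,
    ← real_inner_eq_norm_add_mul_self_sub_norm_mul_self_sub_norm_mul_self_div_two]

/-- Right composition of a Hilbert--Schmidt operator with a bounded operator. -/
def HS.compRight (T : HS Y Z) (B : X →L[ℝ] Y) : HS X Z :=
  HS.mk (T.toCLM.comp B) (by
    rw [summable_sq_iff]
    exact ((T.tsum_comp_le B).trans_lt (by finiteness)).ne)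

@[simp] theorem HS.toCLM_compRight (T : HS Y Z) (B : X →L[ℝ] Y) :
    (HS.compRight T B).toCLM = T.toCLM.comp B := rfl

theorem HS.norm_compRight_le (T : HS Y Z) (B : X →L[ℝ] Y) :
    ‖HS.compRight T B‖ ≤ ‖B‖ * ‖T‖ := by
  have h : ‖HS.compRight T B‖ₑ ^ 2 ≤ (‖B‖ₑ * ‖T‖ₑ) ^ 2 := by
    rw [mul_pow, HS.enorm_sq]
    exact T.tsum_comp_le B
  have h2 : ‖HS.compRight T B‖ₑ ≤ ‖B‖ₑ * ‖T‖ₑ :=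
    (ENNReal.pow_le_pow_left_iff two_ne_zero).1 h
  rw [← ofReal_norm, ← ofReal_norm, ← ofReal_norm, ← ENNReal.ofReal_mul (norm_nonneg _)] at h2
  exact (ENNReal.ofReal_le_ofReal_iff (by positivity)).1 h2

theorem HS.inner_compRight (S : HS Y Z) (B : X →L[ℝ] Y) (R : HS X Z) :
    inner ℝ (S.compRight B) R = inner ℝ S (R.compRight (ContinuousLinearMap.adjoint B)) := by
  rw [← HS.inner_adj, ← HS.inner_adj S, HS.inner_def, HS.inner_def]
  refine tsum_congr fun i => ?_
  simp [HS.adj, ContinuousLinearMap.adjoint_comp, ContinuousLinearMap.adjoint_inner_left]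

end RightComposition

/-- Left composition as a bounded linear map `HS(X, Y) → HS(X, Z)`. -/
def HS.compLeftL (A : Y →L[ℝ] Z) : HS X Y →L[ℝ] HS X Z :=
  LinearMap.mkContinuous
    { toFun := HS.compLeft A
      map_add' := fun T S => HS.ext (by ext x; simp)
      map_smul' := fun r T => HS.ext (by ext x; simp) }
    ‖A‖ (HS.norm_compLeft_le A)

/-- Right composition as a bounded linear map `HS(Y, Z) → HS(X, Z)`. -/
def HS.compRightL [CompleteSpace Y] [CompleteSpace Z] (B : X →L[ℝ] Y) : HS Y Z →L[ℝ] HS X Z :=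
  LinearMap.mkContinuous
    { toFun := fun T => HS.compRight T B
      map_add' := fun T S => HS.ext (by ext x; simp)
      map_smul' := fun r T => HS.ext (by ext x; simp) }
    ‖B‖ (fun T => HS.norm_compRight_le T B)

end HilbertSchmidt

/-! ### The Gelfand triple of operator spaces -/

section Gelfand

variable {V H : Type*}
  [NormedAddCommGroup V] [InnerProductSpace ℝ V] [CompleteSpace V]
  [NormedAddCommGroup H] [InnerProductSpace ℝ H] [CompleteSpace H]

/-- Throughout, `X*` for `X = HS(V*, H) ∩ HS(H, V)` is realised as the space of bounded linear
functionals on `X` with its norm; `HS(V, H)`, `HS(H, V*)` and `HS(H, H)` act on `X` through the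
pairings `pairVH`, `pairHV` and `hiEmb` below.

The intersection `HS(V*, H) ∩ HS(H, V)` for an embedding `j : V → H`: pairs consisting of an
operator `V* → H` and an operator `H → V` that coincide on `H` (where `H ⊆ V*` through `dualEmb j`
and `V ⊆ H` through `j`), with the sum of the two Hilbert--Schmidt inner products. -/
def opSubmodule (j : V →L[ℝ] H) : Submodule ℝ (WithLp 2 (HS (StrongDual ℝ V) H × HS H V)) where
  carrier := {S | ∀ h : H, S.fst.toCLM (dualEmb j h) = j (S.snd.toCLM h)}
  zero_mem' := by intro h; simp
  add_mem' := by
    intro S R hS hR h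
    have h1 := hS h
    have h2 := hR h
    simp [h1, h2]
  smul_mem' := by
    intro c S hS h
    have h1 := hS h
    simp [h1]

/-- The Hilbert space `HS(V*, H) ∩ HS(H, V)`. -/
abbrev OpV (j : V →L[ℝ] H) : Type _ := opSubmodule j

variable {j : V →L[ℝ] H}

/-- `P ∈ HS(V*, H) ∩ HS(H, V)` as an operator `V* → H`. -/
def OpV.onDual (j : V →L[ℝ] H) : OpV j →L[ℝ] HS (StrongDual ℝ V) H :=
  (WithLp.fstL 2 ℝ (HS (StrongDual ℝ V) H) (HS H V)).comp (opSubmodule j).subtypeL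

/-- `P ∈ HS(V*, H) ∩ HS(H, V)` as an operator `H → V`. -/
def OpV.intoV (j : V →L[ℝ] H) : OpV j →L[ℝ] HS H V :=
  (WithLp.sndL 2 ℝ (HS (StrongDual ℝ V) H) (HS H V)).comp (opSubmodule j).subtypeL

/-- The embedding of `HS(V*, H) ∩ HS(H, V)` into `HS(H, H)`. -/
def OpV.toHi (j : V →L[ℝ] H) : OpV j →L[ℝ] HS H H :=
  (HS.compLeftL j).comp (OpV.intoV j)

/-- The duality pairing of `T ∈ HS(V, H)` with `R ∈ HS(V*, H) ∩ HS(H, V)`,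
`∑ᵢ ⟪T vᵢ, R (vᵢ, ·)⟫` for an orthonormal basis `(vᵢ)` of `V`. -/
def pairVH (j : V →L[ℝ] H) (T : HS V H) : StrongDual ℝ (OpV j) :=
  (innerSL ℝ T).comp ((HS.compRightL (riesz V)).comp (OpV.onDual j))

/-- The duality pairing of `T ∈ HS(H, V*)` with `R ∈ HS(V*, H) ∩ HS(H, V)`,
`∑ᵢ ⟨T eᵢ, R eᵢ⟩` for an orthonormal basis `(eᵢ)` of `H`. -/
def pairHV (j : V →L[ℝ] H) (T : HS H (StrongDual ℝ V)) : StrongDual ℝ (OpV j) :=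
  (innerSL ℝ T).comp ((HS.compLeftL (riesz V)).comp (OpV.intoV j))

theorem pairVH_apply (T : HS V H) (R : OpV j) : pairVH j T R =
    ∑' i, inner ℝ (T.toCLM (basis V i)) ((OpV.onDual j R).toCLM (riesz V (basis V i))) := rfl

theorem pairHV_apply (T : HS H (StrongDual ℝ V)) (R : OpV j) : pairHV j T R =
    ∑' i, T.toCLM (basis H i) ((OpV.intoV j R).toCLM (basis H i)) :=
  tsum_congr fun _ => inner_riesz _ _

/-- `HS(H, H)` with its dual identified, embedded into the dual of `HS(V*, H) ∩ HS(H, V)`. -/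
def hiEmb (j : V →L[ℝ] H) : HS H H →L[ℝ] StrongDual ℝ (OpV j) := dualEmb (OpV.toHi j)

/-- The pairing on `HS(H, V*)` extends the inner product of `HS(H, H)`. -/
theorem pairHV_compLeft (Q : HS H H) : pairHV j (HS.compLeft (dualEmb j) Q) = hiEmb j Q := by
  ext R
  rw [pairHV_apply]
  rfl

/-- The pairing on `HS(V, H)` extends the inner product of `HS(H, H)`. -/
theorem pairVH_compRight (Q : HS H H) : pairVH j (HS.compRight Q j) = hiEmb j Q := by
  ext R
  change inner ℝ (HS.compRight Q j) (HS.compRight (OpV.onDual j R) (riesz V))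
    = inner ℝ Q (OpV.toHi j R)
  rw [HS.inner_compRight]
  congr 1
  refine HS.ext (ContinuousLinearMap.ext fun h => ?_)
  refine Eq.trans ?_ (R.2 h)
  change (OpV.onDual j R).toCLM (riesz V (ContinuousLinearMap.adjoint j h)) =
    (OpV.onDual j R).toCLM (dualEmb j h)
  congr 1
  ext v
  simp [riesz, ContinuousLinearMap.adjoint_inner_left]

/-- `C_{-γ}`: self-adjoint Hilbert--Schmidt operators on `H` bounded below by `-γ`. -/
def lowerCone (H : Type*) [NormedAddCommGroup H] [InnerProductSpace ℝ H] [CompleteSpace H]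
    (γ : ℝ) : Set (HS H H) :=
  {P | IsSelfAdjoint P.toCLM ∧ ∀ x : H, -γ * ‖x‖ ^ 2 ≤ inner ℝ (P.toCLM x) x}

/-- The square `P² = P ∘ P`. -/
def HS.square (P : HS H H) : HS H H := HS.compLeft P.toCLM P

/-- The Riccati operator `P ↦ A* P + P A + P²` for `A : V → V*`, as an element of the dual of
`HS(V*, H) ∩ HS(H, V)`. Here `A* P ∈ HS(H, V*)`, `P A ∈ HS(V, H)` and `P² ∈ HS(H, H)`. -/
def riccatiOp (j : V →L[ℝ] H) (A : V →L[ℝ] StrongDual ℝ V) (P : OpV j) :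
    StrongDual ℝ (OpV j) :=
  pairHV j (HS.compLeft A.flip (OpV.intoV j P)) + pairVH j (HS.compRight (OpV.onDual j P) A)
    + hiEmb j (OpV.toHi j P).square

end Gelfand

/-! ### Time-dependent forms -/

section Forms

variable {V : Type*} [NormedAddCommGroup V] [InnerProductSpace ℝ V]

/-- The family of bilinear forms `a(t; u, v)`, `t ∈ [0, T]`, is uniformly strongly positive,
uniformly bounded and Lebesgue measurable in time. The associated operator `V → V*` is
`u ↦ a(t; u, ·)`, that is, `a t` itself; its dual operator is `(a t).flip`. -/
structure IsUniformForm (T μ η : ℝ) (a : ℝ → V →L[ℝ] V →L[ℝ] ℝ) : Prop where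
  pos : ∀ t ∈ Icc 0 T, ∀ u, μ * ‖u‖ ^ 2 ≤ a t u u
  bound : ∀ t ∈ Icc 0 T, ∀ u v, |a t u v| ≤ η * ‖u‖ * ‖v‖
  aemeasurable : ∀ u v, AEMeasurable (fun t => a t u v) (volume.restrict (Icc 0 T))

open scoped Classical in
/-- The time average `(t - s)⁻¹ ∫_s^t a(r; ·, ·) dr` (see `avgForm_apply`). -/
def avgForm (a : ℝ → V →L[ℝ] V →L[ℝ] ℝ) (s t : ℝ) : V →L[ℝ] V →L[ℝ] ℝ :=
  if h : ∃ B : V →L[ℝ] V →L[ℝ] ℝ, ∀ u v, B u v = (t - s)⁻¹ * ∫ r in s..t, a r u v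
  then h.choose else 0

theorem avgForm_apply {T μ η : ℝ} {a : ℝ → V →L[ℝ] V →L[ℝ] ℝ} (ha : IsUniformForm T μ η a)
    {s t : ℝ} (hs : 0 ≤ s) (hst : s ≤ t) (ht : t ≤ T) (u v : V) :
    avgForm a s t u v = (t - s)⁻¹ * ∫ r in s..t, a r u v := by
  have hsub : uIoc s t ⊆ Icc 0 T := by
    rw [uIoc_of_le hst]
    exact fun x hx => ⟨hs.trans hx.1.le, hx.2.trans ht⟩
  have hbd : ∀ u v, ∀ r ∈ uIoc s t, ‖a r u v‖ ≤ η * ‖u‖ * ‖v‖ :=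
    fun u v r hr => ha.bound r (hsub hr) u v
  have hint : ∀ u v, IntervalIntegrable (fun r => a r u v) volume s t := by
    intro u v
    refine (intervalIntegrable_const (c := η * ‖u‖ * ‖v‖)).mono_fun
      ((ha.aemeasurable u v).aestronglyMeasurable.mono_measure
        (Measure.restrict_mono hsub le_rfl)) ?_
    refine (ae_restrict_mem measurableSet_uIoc).mono fun r hr => ?_
    exact (hbd u v r hr).trans (le_abs_self _)
  have h : ∃ B : V →L[ℝ] V →L[ℝ] ℝ, ∀ u v, B u v = (t - s)⁻¹ * ∫ r in s..t, a r u v := by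
    refine ⟨LinearMap.mkContinuous₂ (LinearMap.mk₂ ℝ
      (fun u v => (t - s)⁻¹ * ∫ r in s..t, a r u v) ?_ ?_ ?_ ?_)
      (|(t - s)⁻¹| * (η * |t - s|)) ?_, fun u v => rfl⟩
    · intro u₁ u₂ v
      simp only [map_add, add_apply]
      rw [intervalIntegral.integral_add (hint _ _) (hint _ _), mul_add]
    · intro c u v
      simp only [map_smul, smul_apply, smul_eq_mul]
      rw [intervalIntegral.integral_const_mul]
      ring
    · intro u v₁ v₂
      simp only [map_add]
      rw [intervalIntegral.integral_add (hint _ _) (hint _ _), mul_add]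
    · intro c u v
      simp only [map_smul, smul_eq_mul]
      rw [intervalIntegral.integral_const_mul]
      ring
    · intro u v
      have := intervalIntegral.norm_integral_le_of_norm_le_const (hbd u v)
      simp only [LinearMap.mk₂_apply, norm_mul, Real.norm_eq_abs] at this ⊢
      calc _ ≤ |(t - s)⁻¹| * (η * ‖u‖ * ‖v‖ * |t - s|) := by gcongr
        _ = _ := by ring
  unfold avgForm
  rw [dif_pos h]
  exact h.choose_spec u v

end Forms

/-! ### Function spaces in time and weak solutions -/

section Weak

variable {V H : Type*}
  [NormedAddCommGroup V] [InnerProductSpace ℝ V] [CompleteSpace V]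
  [NormedAddCommGroup H] [InnerProductSpace ℝ H] [CompleteSpace H]

/-- Lebesgue measure on `[0, T]`. -/
def timeMeasure (T : ℝ) : Measure ℝ := volume.restrict (Icc 0 T)

/-- Test functions: smooth with compact support in `(0, T)`. -/
def IsTestFunction (T : ℝ) (φ : ℝ → ℝ) : Prop :=
  ContDiff ℝ (⊤ : ℕ∞) φ ∧ HasCompactSupport φ ∧ tsupport φ ⊆ Ioo 0 T

/-- `Q ∈ L¹(0, T; HS(H, H)) + L²(0, T; X*)`, where `X = HS(V*, H) ∩ HS(H, V)`. -/
def MemSum (j : V →L[ℝ] H) (T : ℝ) (Q : ℝ → StrongDual ℝ (OpV j)) : Prop :=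
  ∃ (Q₁ : ℝ → HS H H) (Q₂ : ℝ → StrongDual ℝ (OpV j)),
    MemLp Q₁ 1 (timeMeasure T) ∧ MemLp Q₂ 2 (timeMeasure T) ∧
      ∀ᵐ t ∂timeMeasure T, Q t = hiEmb j (Q₁ t) + Q₂ t

/-- `P` lies in the space of functions in `L²(0, T; X)`, `X = HS(V*, H) ∩ HS(H, V)`, with weak
derivative in `L¹(0, T; HS(H, H)) + L²(0, T; X*)`. Here `u` represents `P` as an element of
`L²(0, T; X)`, and `P` itself is the representative that is continuous from `[0, T]` to
`HS(H, H)`, so that the values `P(t)` make sense for every `t ∈ [0, T]`. -/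
structure MemW (j : V →L[ℝ] H) (T : ℝ) (P : ℝ → HS H H) (u : ℝ → OpV j) : Prop where
  memLp : MemLp u 2 (timeMeasure T)
  continuousOn : ContinuousOn P (Icc 0 T)
  ae_eq : ∀ᵐ t ∂timeMeasure T, OpV.toHi j (u t) = P t
  weakDeriv : ∃ g : ℝ → StrongDual ℝ (OpV j), MemSum j T g ∧
    ∀ (R : OpV j) (φ : ℝ → ℝ), IsTestFunction T φ →
      -(∫ t in (0 : ℝ)..T, hiEmb j (P t) R * deriv φ t) = ∫ t in (0 : ℝ)..T, g t R * φ t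

/-- `P` (with `u` its representative in `L²(0, T; X)`) is a weak solution of
`P' + A*(t) P + P A(t) + P² = Q`, `P(0) = P₀`. -/
structure IsWeakSolution (j : V →L[ℝ] H) (T : ℝ) (a : ℝ → V →L[ℝ] V →L[ℝ] ℝ)
    (Q : ℝ → StrongDual ℝ (OpV j)) (P₀ : HS H H) (P : ℝ → HS H H) (u : ℝ → OpV j) : Prop where
  memW : MemW j T P u
  initial : P 0 = P₀
  equation : ∀ (R : OpV j) (φ : ℝ → ℝ), IsTestFunction T φ →
    -(∫ t in (0 : ℝ)..T, hiEmb j (P t) R * deriv φ t)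
      + (∫ t in (0 : ℝ)..T, riccatiOp j (a t) (u t) R * φ t)
      = ∫ t in (0 : ℝ)..T, Q t R * φ t

/-! ### The backward Euler scheme -/

/-- The values at the nodes `t₀ = 0 < t₁ < ⋯ < t_N` in `HS(H, H)`: `P₀`, then `p 0, p 1, …`, so that
`p n` is the approximation at `t_{n+1}`. -/
def eulerNodes (j : V →L[ℝ] H) (P₀ : HS H H) {N : ℕ} (p : Fin N → OpV j) : Fin (N + 1) → HS H H :=
  Fin.cons P₀ fun n => OpV.toHi j (p n)

/-- `p` solves the backward Euler scheme with `N` steps of size `τ = T / N`,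
`(P_n - P_{n-1}) / τ + A_n* P_n + P_n A_n + P_n² = Q_n`, with `A_n` and `Q_n` the averages over
`(t_{n-1}, t_n)`, and all `P_n` are self-adjoint and bounded below by `-γ`. -/
structure IsEulerSolution (j : V →L[ℝ] H) (T γ : ℝ) (a : ℝ → V →L[ℝ] V →L[ℝ] ℝ)
    (Q : ℝ → StrongDual ℝ (OpV j)) (P₀ : HS H H) (N : ℕ) (p : Fin N → OpV j) : Prop where
  lower : ∀ n, OpV.toHi j (p n) ∈ lowerCone H γ
  equation : ∀ n : Fin N,
    (T / N)⁻¹ • hiEmb j (eulerNodes j P₀ p n.succ - eulerNodes j P₀ p n.castSucc)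
      + riccatiOp j (avgForm a (n * (T / N)) ((n + 1) * (T / N))) (p n)
      = (T / N)⁻¹ • ∫ t in (n * (T / N))..((n + 1) * (T / N)), Q t

/-- The piecewise constant interpolation, with value `p n` on `(n τ, (n + 1) τ]`, `τ = T / N`. -/
def pwConst (j : V →L[ℝ] H) (T : ℝ) {N : ℕ} (p : Fin N → OpV j) (t : ℝ) : OpV j :=
  ∑ n : Fin N, (Ioc (n * (T / N)) ((n + 1) * (T / N))).indicator (fun _ => p n) t

end Weak
end Riccati

end

/-! The linear part `P ↦ A*P + PA` is handled as a form on 𝒱. An element `P` of 𝒱 amounts to the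
pair `(P, P*)` of operators `H → V`, and the form is the sum of two copies of `a`, one for each
component. Hence it is coercive with the same `μ` and bounded with the same `η`
(`isUniformForm_opForm`). Both components control the 𝓗-norm, so `2‖P‖²_𝓗 ≤ C²‖P‖²_𝒱`, and the form
dominates `(2μ/C²)‖P‖²_𝓗`. On the cone `P ≥ -γ` the square satisfies `(P² - S², P - S) ≥ -2γ‖P -
S‖²` (`HS.square_monotone`). As `γ < μ/C²`, the whole operator is strongly monotone on the cone, and
the main issue is to stay in the cone.

Invariance of the cone is proved for one linear implicit Euler step
(`mem_lowerCone_of_linear_step`). If the bound failed, the compact self-adjoint operator `P` would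
have an eigenvalue `l < -γ`; its eigenvector lies in `V`, and testing the step with `v ⊗ v` is
contradictory because `a(v, v) ≥ γ‖v‖_H²`.

Existence is a contraction argument (`exists_sol_neg_square`). For large `κ`, the map `v ↦ κv - v²`
has Lipschitz constant close to `κ + 2γ` on bounded parts of the cone and sends them to operators
bounded below by `-(κγ + γ²)`. Solving the linear problem with damping `κ` has Lipschitz constant
`1/(κ + 2μ/C²)` and returns to the cone. The argument runs over a one-point space for a step of the
scheme and over `[0, T]` for the evolution. The linear evolution itself is solved by Lions' method
(`exists_isSol`): a density argument in `L²(0, T; X)` gives approximate solutions, and the energy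
estimate makes them converge.

Convergence of the scheme (`euler_close`) compares the Euler values with the cell means of an exact
solution. The difference quotient of cell means is the cell mean of the backward Steklov average of
the derivative (`IsSol.cell_identity`), so the consistency error is a translation error in `L¹(𝓗) +
L²(𝒱*)`. It vanishes by density of continuous functions, without any regularity of the data. The
discrete energy estimate then yields convergence in `L²(0, T; 𝒱)` and uniformly in 𝓗. Applied to
linear problems, this transfers the cone and norm bounds from the scheme to the evolution. Applied
to the Riccati equation, it also gives uniqueness, since any two solutions in the cone are limits of
the same scheme. -/

noncomputable section

namespace Riccati

/-! ### Absolutely continuous primitives with values in a Hilbert space -/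

section Primitives

variable {Z : Type*} [NormedAddCommGroup Z] [InnerProductSpace ℝ Z]

theorem absolutelyContinuousOnInterval_of_dist_le {F g : ℝ → ℝ} {a b C : ℝ}
    (hg : AbsolutelyContinuousOnInterval g a b)
    (h : ∀ s ∈ uIcc a b, ∀ t ∈ uIcc a b, dist (F s) (F t) ≤ C * dist (g s) (g t)) :
    AbsolutelyContinuousOnInterval F a b := by
  rw [absolutelyContinuousOnInterval_iff] at hg ⊢
  intro ε hε
  obtain ⟨δ, hδ, H⟩ := hg (ε / (|C| + 1)) (by positivity)
  refine ⟨δ, hδ, fun E hE hs => ?_⟩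
  have h1 := H E hE hs
  rw [lt_div_iff₀ (by positivity)] at h1
  refine lt_of_le_of_lt ?_ h1
  rw [Finset.sum_mul]
  refine Finset.sum_le_sum fun i hi => ?_
  refine (h _ (hE.1 i hi).1 _ (hE.1 i hi).2).trans ?_
  rw [mul_comm]
  gcongr
  linarith [le_abs_self C]

theorem norm_integral_le_of_mem {Z : Type*} [NormedAddCommGroup Z] [NormedSpace ℝ Z]
    {f : ℝ → Z} {a b t : ℝ} (hf : IntervalIntegrable f volume a b)
    (ht : t ∈ Icc a b) : ‖∫ s in a..t, f s‖ ≤ ∫ s in a..b, ‖f s‖ := by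
  refine (intervalIntegral.norm_integral_le_integral_norm ht.1).trans ?_
  refine intervalIntegral.integral_mono_interval le_rfl ht.1 ht.2 ?_ hf.norm
  exact Eventually.of_forall fun x => norm_nonneg _

/-- Domination by a scalar primitive reduces absolute continuity of vector-valued primitives to the
scalar case. -/
theorem dist_primitive_le {f : ℝ → Z} {h : ℝ → ℝ} {a b : ℝ}
    (hf : IntervalIntegrable f volume a b) (hh : IntervalIntegrable h volume a b)
    (hfh : ∀ t, ‖f t‖ ≤ h t) (hab : a ≤ b) {s t : ℝ} (hs : s ∈ Icc a b) (ht : t ∈ Icc a b) :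
    ‖(∫ r in a..s, f r) - ∫ r in a..t, f r‖ ≤ dist (∫ r in a..s, h r) (∫ r in a..t, h r) := by
  wlog hst : t ≤ s generalizing s t
  · rw [norm_sub_rev, dist_comm]
    exact this ht hs (le_of_not_ge hst)
  have sub : ∀ r ∈ Icc a b, uIcc a r ⊆ uIcc a b := fun r hr => by
    rw [uIcc_of_le hr.1, uIcc_of_le hab]
    exact Icc_subset_Icc le_rfl hr.2
  rw [Real.dist_eq, intervalIntegral.integral_interval_sub_left (hf.mono_set (sub s hs))
    (hf.mono_set (sub t ht)), intervalIntegral.integral_interval_sub_left (hh.mono_set (sub s hs))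
    (hh.mono_set (sub t ht))]
  refine (intervalIntegral.norm_integral_le_of_norm_le hst ?_ ?_).trans (le_abs_self _)
  · exact Eventually.of_forall fun r _ => hfh r
  · refine hh.mono_set ?_
    rw [uIcc_of_le hst, uIcc_of_le hab]
    exact Icc_subset_Icc ht.1 hs.2

variable [CompleteSpace Z]

/-- Integration by parts for primitives of integrable functions with values in a Hilbert space. -/
theorem integral_inner_primitive {f g : ℝ → Z} {a b : ℝ} (hab : a ≤ b)
    (hf : IntervalIntegrable f volume a b) (hg : IntervalIntegrable g volume a b) :
    ∫ t in a..b, (inner ℝ (∫ s in a..t, f s) (g t) + inner ℝ (f t) (∫ s in a..t, g s))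
      = inner ℝ (∫ s in a..b, f s) (∫ s in a..b, g s) := by
  set F : ℝ → ℝ := fun t => inner ℝ (∫ s in a..t, f s) (∫ s in a..t, g s) with hF
  set h : ℝ → ℝ := fun t => ‖f t‖ + ‖g t‖
  have hh : IntervalIntegrable h volume a b := hf.norm.add hg.norm
  set M := (∫ s in a..b, ‖f s‖) + ∫ s in a..b, ‖g s‖
  -- The product rule makes increments of `F` at most `M` times increments of the primitive of `‖f‖
  -- + ‖g‖`; the fundamental theorem for absolutely continuous real functions then applies to `F`.
  have hAC : AbsolutelyContinuousOnInterval F a b := by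
    refine absolutelyContinuousOnInterval_of_dist_le (C := M)
      (hh.absolutelyContinuousOnInterval_intervalIntegral (c := a) (by simp)) ?_
    intro s hs t ht
    rw [uIcc_of_le hab] at hs ht
    have h1 := dist_primitive_le hf hh (fun t => le_add_of_nonneg_right (norm_nonneg _)) hab hs ht
    have h2 := dist_primitive_le hg hh (fun t => le_add_of_nonneg_left (norm_nonneg _)) hab hs ht
    have h3 := norm_integral_le_of_mem hf ht
    have h4 := norm_integral_le_of_mem hg hs
    have e : F s - F t = inner ℝ ((∫ r in a..s, f r) - ∫ r in a..t, f r) (∫ r in a..s, g r)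
        + inner ℝ (∫ r in a..t, f r) ((∫ r in a..s, g r) - ∫ r in a..t, g r) := by
      simp only [hF, inner_sub_left, inner_sub_right]
      ring
    rw [Real.dist_eq, e]
    refine (abs_add_le _ _).trans ?_
    have h5 := abs_real_inner_le_norm ((∫ r in a..s, f r) - ∫ r in a..t, f r) (∫ r in a..s, g r)
    have h6 := abs_real_inner_le_norm (∫ r in a..t, f r)
      ((∫ r in a..s, g r) - ∫ r in a..t, g r)
    refine (add_le_add h5 h6).trans ?_
    calc _ ≤ dist (∫ r in a..s, h r) (∫ r in a..t, h r) * (∫ s in a..b, ‖g s‖)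
          + (∫ s in a..b, ‖f s‖) * dist (∫ r in a..s, h r) (∫ r in a..t, h r) := by
            have h7 := (norm_nonneg _).trans h3
            gcongr
      _ = _ := by ring
  have hFa : F a = 0 := by simp [hF]
  have := hAC.integral_deriv_eq_sub
  rw [hFa, sub_zero] at this
  refine Eq.trans ?_ this
  refine intervalIntegral.integral_congr_ae ?_
  filter_upwards [hf.ae_hasDerivAt_integral, hg.ae_hasDerivAt_integral] with t h1 h2 ht
  have ht' := uIoc_subset_uIcc ht
  exact ((h1 ht' a (by simp)).inner ℝ (h2 ht' a (by simp))).deriv.symm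

theorem integral_inner_primitive_self {f : ℝ → Z} {a b : ℝ} (hab : a ≤ b)
    (hf : IntervalIntegrable f volume a b) :
    ∫ t in a..b, inner ℝ (∫ s in a..t, f s) (f t) = ‖∫ s in a..b, f s‖ ^ 2 / 2 := by
  have h := integral_inner_primitive hab hf hf
  rw [real_inner_self_eq_norm_sq] at h
  rw [← h, ← intervalIntegral.integral_div]
  refine intervalIntegral.integral_congr fun t _ => ?_
  simp only [real_inner_comm (f t)]
  ring

/-- A function with vanishing primitive vanishes almost everywhere. -/
theorem ae_eq_zero_of_primitive_eq_zero {f : ℝ → Z} {a b : ℝ}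
    (hf : IntervalIntegrable f volume a b) (h : ∀ t ∈ uIcc a b, ∫ s in a..t, f s = 0) :
    ∀ᵐ t, t ∈ Ioo a b → f t = 0 := by
  filter_upwards [hf.ae_hasDerivAt_integral] with t h1 ht
  have htm : t ∈ uIcc a b := Icc_subset_uIcc (Ioo_subset_Icc_self ht)
  have h2 := h1 htm a (by simp)
  have h3 : HasDerivAt (fun x => ∫ s in a..x, f s) 0 t := by
    refine (hasDerivAt_const t (0 : Z)).congr_of_eventuallyEq ?_
    filter_upwards [Ioo_mem_nhds ht.1 ht.2] with x hx
    exact h x (Icc_subset_uIcc (Ioo_subset_Icc_self hx))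
  exact h2.unique h3

end Primitives

/-! ### Cell averages and backward Steklov averages -/

section Averages

variable {Z : Type*} [NormedAddCommGroup Z] [NormedSpace ℝ Z]

/-- The mean of `g` over the `n`-th interval `(n τ, (n + 1) τ)`. -/
def cellAvg (τ : ℝ) (n : ℕ) (g : ℝ → Z) : Z := τ⁻¹ • ∫ t in (n * τ)..((n + 1) * τ), g t

/-- The mean over the `n`-th interval of the difference between the backward Steklov average of
`g` and `g`. -/
def cellShift (τ : ℝ) (n : ℕ) (g : ℝ → Z) : Z :=
  cellAvg τ n fun t => (τ⁻¹ • ∫ s in (t - τ)..t, g s) - g t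

-- Jensen's inequality for `x ↦ x ^ p` on `[0, ∞)`.
omit [NormedSpace ℝ Z] in
theorem integral_norm_pow_le {h : ℝ → Z} {p : ℕ} {a b : ℝ} (hab : a < b)
    (h1 : IntervalIntegrable h volume a b)
    (hp : IntervalIntegrable (fun t => ‖h t‖ ^ p) volume a b) :
    ((b - a)⁻¹ * ∫ t in a..b, ‖h t‖) ^ p ≤ (b - a)⁻¹ * ∫ t in a..b, ‖h t‖ ^ p := by
  have e : ∀ f : ℝ → ℝ, (b - a)⁻¹ * ∫ t in a..b, f t = ⨍ t in Ioc a b, f t := by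
    intro f
    rw [← uIoc_of_le hab.le, interval_average_eq, smul_eq_mul]
  rw [e, e]
  refine (convexOn_pow p).map_set_average_le (continuous_pow p).continuousOn isClosed_Ici ?_ ?_
    ?_ ?_ ?_
  · simp [hab]
  · simp
  · exact Eventually.of_forall fun t => norm_nonneg _
  · exact h1.norm.1
  · exact hp.1

omit [NormedSpace ℝ Z] in
theorem memLp_intervalIntegrable {h : ℝ → Z} {p : ℕ} (hp : 1 ≤ p) (hh : MemLp h p volume)
    (a b : ℝ) : IntervalIntegrable h volume a b :=
  intervalIntegrable_iff.2 (((hh.locallyIntegrable (by exact_mod_cast hp)).integrableOn_isCompact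
    isCompact_uIcc).mono_set uIoc_subset_uIcc)

/-- The offset `c` is there because Steklov averages also see the preceding cell; it is used with `c
= -τ` and `c = 0`. -/
theorem sum_integral_cells_le {f : ℝ → ℝ} (hf : Integrable f volume) (h0 : ∀ t, 0 ≤ f t)
    {τ : ℝ} (hτ : 0 ≤ τ) (c : ℝ) (N : ℕ) :
    ∑ n ∈ Finset.range N, ∫ t in (n * τ + c)..((n + 1) * τ + c), f t ≤ ∫ t, f t := by
  have := intervalIntegral.sum_integral_adjacent_intervals (μ := volume) (f := f)
    (a := fun n : ℕ => n * τ + c) (n := N) (fun k _ => hf.intervalIntegrable)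
  simp only [Nat.cast_add, Nat.cast_one] at this
  rw [this, intervalIntegral.integral_of_le]
  · exact setIntegral_le_integral hf (Eventually.of_forall h0)
  · have : (0 : ℝ) ≤ N * τ := by positivity
    simpa using this

theorem norm_cellAvg_le {g : ℝ → Z} {τ : ℝ} (hτ : 0 < τ) (n : ℕ) :
    ‖cellAvg τ n g‖ ≤ τ⁻¹ * ∫ t in (n * τ)..((n + 1) * τ), ‖g t‖ := by
  rw [cellAvg, norm_smul, Real.norm_of_nonneg (by positivity)]
  gcongr
  exact intervalIntegral.norm_integral_le_integral_norm (by nlinarith)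

theorem norm_cellAvg_le_of_le {g : ℝ → Z} {τ ω : ℝ} (hτ : 0 < τ) (n : ℕ)
    (h : ∀ t ∈ Ioc (n * τ) ((n + 1) * τ), ‖g t‖ ≤ ω) : ‖cellAvg τ n g‖ ≤ ω := by
  rw [cellAvg, norm_smul, Real.norm_of_nonneg (by positivity)]
  have h1 : (n : ℝ) * τ ≤ (n + 1) * τ := by nlinarith
  have h2 := intervalIntegral.norm_integral_le_of_norm_le_const (a := n * τ) (b := (n + 1) * τ)
    (f := g) (C := ω) (by rwa [uIoc_of_le h1])
  have e : |(n + 1) * τ - n * τ| = τ := by rw [abs_of_nonneg (by linarith)]; ring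
  rw [e] at h2
  calc _ ≤ τ⁻¹ * (ω * τ) := by gcongr
    _ = ω := by field_simp

theorem cellAvg_pow_le {g : ℝ → Z} {p : ℕ} {τ : ℝ} (hτ : 0 < τ) (n : ℕ)
    (h1 : IntervalIntegrable g volume (n * τ) ((n + 1) * τ))
    (h2 : IntervalIntegrable (fun t => ‖g t‖ ^ p) volume (n * τ) ((n + 1) * τ)) :
    τ * ‖cellAvg τ n g‖ ^ p ≤ ∫ t in (n * τ)..((n + 1) * τ), ‖g t‖ ^ p := by
  have h3 := integral_norm_pow_le (a := n * τ) (b := (n + 1) * τ) (by nlinarith) h1 h2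
  have e : (n + 1) * τ - n * τ = τ := by ring
  rw [e] at h3
  calc _ ≤ τ * (τ⁻¹ * ∫ t in (n * τ)..((n + 1) * τ), ‖g t‖ ^ p) := by
        gcongr
        exact (pow_le_pow_left₀ (norm_nonneg _) (norm_cellAvg_le hτ n) p).trans h3
    _ = _ := by field_simp

theorem continuous_steklov {g : ℝ → Z} (hg : ∀ a b, IntervalIntegrable g volume a b) (τ : ℝ) :
    Continuous fun t => τ⁻¹ • ∫ s in (t - τ)..t, g s := by
  have e : (fun t => τ⁻¹ • ∫ s in (t - τ)..t, g s) =
      fun t => τ⁻¹ • ((∫ s in (0 : ℝ)..t, g s) - ∫ s in (0 : ℝ)..(t - τ), g s) := by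
    funext t
    rw [intervalIntegral.integral_interval_sub_left (hg _ _) (hg _ _)]
  rw [e]
  have := intervalIntegral.continuous_primitive hg 0
  exact continuous_const.smul (this.sub (this.comp (continuous_id.sub continuous_const)))

theorem cellAvg_add {g h : ℝ → Z} {τ : ℝ} {n : ℕ}
    (hg : IntervalIntegrable g volume (n * τ) ((n + 1) * τ))
    (hh : IntervalIntegrable h volume (n * τ) ((n + 1) * τ)) :
    cellAvg τ n (fun t => g t + h t) = cellAvg τ n g + cellAvg τ n h := by
  rw [cellAvg, intervalIntegral.integral_add hg hh, smul_add]; rfl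

theorem cellAvg_sub {g h : ℝ → Z} {τ : ℝ} {n : ℕ}
    (hg : IntervalIntegrable g volume (n * τ) ((n + 1) * τ))
    (hh : IntervalIntegrable h volume (n * τ) ((n + 1) * τ)) :
    cellAvg τ n (fun t => g t - h t) = cellAvg τ n g - cellAvg τ n h := by
  rw [cellAvg, intervalIntegral.integral_sub hg hh, smul_sub]; rfl

theorem cellShift_add {g h : ℝ → Z} (hg : ∀ a b, IntervalIntegrable g volume a b)
    (hh : ∀ a b, IntervalIntegrable h volume a b) (τ : ℝ) (n : ℕ) :
    cellShift τ n (fun t => g t + h t) = cellShift τ n g + cellShift τ n h := by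
  rw [cellShift, cellShift, cellShift, ← cellAvg_add
    (((continuous_steklov hg τ).intervalIntegrable _ _).sub (hg _ _))
    (((continuous_steklov hh τ).intervalIntegrable _ _).sub (hh _ _))]
  congr 1
  funext t
  rw [intervalIntegral.integral_add (hg _ _) (hh _ _), smul_add]
  abel

/-- Both averages involve `g` only on the double cell, and each is at most `τ⁻¹` times the integral
of `‖g‖` there. Written with the mean over length `2τ`, the constant becomes `4`, ready for Jensen's
inequality. -/
theorem norm_cellShift_le {g : ℝ → Z} (hg : ∀ a b, IntervalIntegrable g volume a b) {τ : ℝ}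
    (hτ : 0 < τ) (n : ℕ) :
    ‖cellShift τ n g‖ ≤ 4 * ((2 * τ)⁻¹ * ∫ s in (n * τ - τ)..((n + 1) * τ), ‖g s‖) := by
  set B := ∫ s in (n * τ - τ)..((n + 1) * τ), ‖g s‖
  have h1 : ‖cellAvg τ n fun t => τ⁻¹ • ∫ s in (t - τ)..t, g s‖ ≤ τ⁻¹ * B := by
    refine norm_cellAvg_le_of_le hτ n fun t ht => ?_
    rw [norm_smul, Real.norm_of_nonneg (by positivity)]
    gcongr
    refine (intervalIntegral.norm_integral_le_integral_norm (by linarith)).trans ?_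
    exact intervalIntegral.integral_mono_interval (by linarith [ht.1]) (by linarith) ht.2
      (Eventually.of_forall fun x => norm_nonneg _) (hg _ _).norm
  have h2 : ‖cellAvg τ n g‖ ≤ τ⁻¹ * B := by
    refine (norm_cellAvg_le hτ n).trans ?_
    gcongr
    exact intervalIntegral.integral_mono_interval (by linarith) (by nlinarith) le_rfl
      (Eventually.of_forall fun x => norm_nonneg _) (hg _ _).norm
  rw [cellShift, cellAvg_sub ((continuous_steklov hg τ).intervalIntegrable _ _) (hg _ _)]
  refine (norm_sub_le _ _).trans ((add_le_add h1 h2).trans_eq ?_)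
  rw [mul_inv]
  ring

theorem norm_cellShift_le_of_modulus [CompleteSpace Z] {g : ℝ → Z} (hg : Continuous g)
    {τ ω : ℝ} (hτ : 0 < τ) (hω : ∀ s t, |s - t| ≤ τ → ‖g s - g t‖ ≤ ω) (n : ℕ) :
    ‖cellShift τ n g‖ ≤ ω := by
  refine norm_cellAvg_le_of_le hτ n fun t _ => ?_
  have e : (τ⁻¹ • ∫ s in (t - τ)..t, g s) - g t = τ⁻¹ • ∫ s in (t - τ)..t, (g s - g t) := by
    rw [intervalIntegral.integral_sub (hg.intervalIntegrable _ _) (by simp),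
      intervalIntegral.integral_const, smul_sub, sub_sub_cancel, smul_smul,
      inv_mul_cancel₀ hτ.ne', one_smul]
  have h1 := intervalIntegral.norm_integral_le_of_norm_le_const (a := t - τ) (b := t)
    (f := fun s => g s - g t) (C := ω) (fun s hs => hω s t (by
      rw [uIoc_of_le (by linarith)] at hs
      rw [abs_le]; constructor <;> linarith [hs.1, hs.2]))
  rw [sub_sub_cancel, abs_of_pos hτ] at h1
  rw [e, norm_smul, Real.norm_of_nonneg (by positivity)]
  calc _ ≤ τ⁻¹ * (ω * τ) := by gcongr
    _ = ω := by field_simp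

/-- Stability uniform in `τ`: Jensen's inequality on the double cells, which cover each point at
most twice up to null sets. -/
theorem sum_cellShift_pow_le {g : ℝ → Z} {p : ℕ} (hp : 1 ≤ p) (hg : MemLp g p volume) {τ : ℝ}
    (hτ : 0 < τ) (N : ℕ) :
    ∑ n ∈ Finset.range N, τ * ‖cellShift τ n g‖ ^ p ≤ 4 ^ p * ∫ t, ‖g t‖ ^ p := by
  have hi := memLp_intervalIntegrable hp hg
  have hip : Integrable (fun t => ‖g t‖ ^ p) volume := hg.integrable_norm_pow (by omega)
  have key : ∀ n : ℕ, τ * ‖cellShift τ n g‖ ^ p ≤ 4 ^ p / 2 *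
      ((∫ t in (n * τ + (-τ))..((n + 1) * τ + (-τ)), ‖g t‖ ^ p)
        + ∫ t in (n * τ + 0)..((n + 1) * τ + 0), ‖g t‖ ^ p) := by
    intro n
    have h1 := integral_norm_pow_le (a := n * τ - τ) (b := (n + 1) * τ) (by nlinarith) (hi _ _)
      hip.intervalIntegrable
    have e : (n + 1) * τ - (n * τ - τ) = 2 * τ := by ring
    rw [e] at h1
    have e2 : (∫ t in (n * τ + (-τ))..((n + 1) * τ + (-τ)), ‖g t‖ ^ p)
        + ∫ t in (n * τ + 0)..((n + 1) * τ + 0), ‖g t‖ ^ p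
        = ∫ s in (n * τ - τ)..((n + 1) * τ), ‖g s‖ ^ p := by
      rw [show (n + 1) * τ + (-τ) = n * τ + 0 by ring, add_zero, add_zero, ← sub_eq_add_neg,
        intervalIntegral.integral_add_adjacent_intervals hip.intervalIntegrable
          hip.intervalIntegrable]
    rw [e2]
    calc τ * ‖cellShift τ n g‖ ^ p
        ≤ τ * (4 * ((2 * τ)⁻¹ * ∫ s in (n * τ - τ)..((n + 1) * τ), ‖g s‖)) ^ p := by
          gcongr
          exact norm_cellShift_le hi hτ n
      _ = τ * 4 ^ p * ((2 * τ)⁻¹ * ∫ s in (n * τ - τ)..((n + 1) * τ), ‖g s‖) ^ p := by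
          rw [mul_pow]; ring
      _ ≤ τ * 4 ^ p * ((2 * τ)⁻¹ * ∫ s in (n * τ - τ)..((n + 1) * τ), ‖g s‖ ^ p) := by gcongr
      _ = _ := by field_simp
  refine (Finset.sum_le_sum fun n _ => key n).trans ?_
  rw [← Finset.mul_sum, Finset.sum_add_distrib]
  have h0 : ∀ t, 0 ≤ ‖g t‖ ^ p := fun t => by positivity
  have h1 := sum_integral_cells_le hip h0 hτ.le (-τ) N
  have h2 := sum_integral_cells_le hip h0 hτ.le 0 N
  calc _ ≤ 4 ^ p / 2 * ((∫ t, ‖g t‖ ^ p) + ∫ t, ‖g t‖ ^ p) := by gcongr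
    _ = _ := by ring

theorem exists_continuous_approx {g : ℝ → Z} {p : ℕ} (hp : 1 ≤ p) (hg : MemLp g p volume)
    {ε : ℝ} (hε : 0 < ε) : ∃ φ : ℝ → Z, MemLp φ p volume ∧ Continuous φ ∧ UniformContinuous φ ∧
      ∫ t, ‖g t - φ t‖ ^ p ≤ ε := by
  have hg' : MemLp g (ENNReal.ofReal p) volume := by simpa using hg
  obtain ⟨φ, h1, h2, h3, h4⟩ := hg'.exists_hasCompactSupport_integral_rpow_sub_le
    (by exact_mod_cast hp) hε
  refine ⟨φ, by simpa using h4, h3, h1.uniformContinuous_of_continuous h3, ?_⟩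
  simpa using h2

/-- The consistency error of the scheme vanishes for merely `p`-integrable data: the shift operators
are bounded uniformly in `τ` and small on uniformly continuous functions, which are dense. -/
theorem sum_cellShift_pow_lt [CompleteSpace Z] {g : ℝ → Z} {p : ℕ} (hp : 1 ≤ p)
    (hg : MemLp g p volume) {T : ℝ} (hT : 0 < T) {ε : ℝ} (hε : 0 < ε) :
    ∃ δ > 0, ∀ N : ℕ, 0 < N → T / N < δ →
      ∑ n ∈ Finset.range N, T / N * ‖cellShift (T / N) n g‖ ^ p < ε := by
  -- The factor `2 ^ p` pays for splitting `g` into `φ` and the remainder, `4 ^ p` for the stability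
  -- bound; the remainder then contributes at most `ε / 4`.
  obtain ⟨φ, hφ, hφc, hφu, hφε⟩ := exists_continuous_approx hp hg
    (ε := ε / (4 * 2 ^ p * 4 ^ p)) (by positivity)
  obtain ⟨ω, hω, hωε⟩ : ∃ ω > 0, 2 ^ p * T * ω ^ p < ε / 2 := by
    have : Tendsto (fun ω : ℝ => 2 ^ p * T * ω ^ p) (𝓝[>] 0) (𝓝 (2 ^ p * T * 0 ^ p)) :=
      ((continuous_const.mul (continuous_pow p)).tendsto 0).mono_left nhdsWithin_le_nhds
    rw [zero_pow (by omega), mul_zero] at this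
    obtain ⟨ω, h1, h2⟩ := ((this.eventually_lt_const (half_pos hε)).and
      self_mem_nhdsWithin).exists
    exact ⟨ω, h2, h1⟩
  obtain ⟨δ, hδ, hδω⟩ := Metric.uniformContinuous_iff.1 hφu ω hω
  refine ⟨δ, hδ, fun N hN hNδ => ?_⟩
  set τ := T / N with hτd
  have hN' : (0 : ℝ) < N := by exact_mod_cast hN
  have hτ : 0 < τ := by positivity
  have hNτ : N * τ = T := by rw [hτd]; field_simp
  have hi := memLp_intervalIntegrable hp hg
  have hiφ := memLp_intervalIntegrable hp hφ
  have hmem : MemLp (fun t => g t - φ t) p volume := hg.sub hφ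
  have hsplit : ∀ n : ℕ, τ * ‖cellShift τ n g‖ ^ p ≤
      2 ^ p * (τ * ω ^ p) + 2 ^ p * (τ * ‖cellShift τ n fun t => g t - φ t‖ ^ p) := by
    intro n
    have e : cellShift τ n g = cellShift τ n φ + cellShift τ n fun t => g t - φ t := by
      rw [← cellShift_add hiφ (memLp_intervalIntegrable hp hmem)]
      simp
    have h1 : ‖cellShift τ n φ‖ ≤ ω := norm_cellShift_le_of_modulus hφc hτ (fun s t hst => by
      rw [← dist_eq_norm]
      exact (hδω (by rw [Real.dist_eq]; exact hst.trans_lt hNδ)).le) n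
    have h2 : ‖cellShift τ n g‖ ^ p ≤ 2 ^ (p - 1) * (ω ^ p +
        ‖cellShift τ n fun t => g t - φ t‖ ^ p) := by
      refine le_trans ?_ (add_pow_le hω.le (norm_nonneg _) p)
      rw [e]
      gcongr
      exact (norm_add_le _ _).trans (by gcongr)
    have h3 : (2 : ℝ) ^ (p - 1) ≤ 2 ^ p := pow_le_pow_right₀ (by norm_num) (by omega)
    calc τ * ‖cellShift τ n g‖ ^ p ≤ τ * (2 ^ p * (ω ^ p +
        ‖cellShift τ n fun t => g t - φ t‖ ^ p)) := by
          gcongr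
          exact h2.trans (by gcongr)
      _ = _ := by ring
  have h4 := sum_cellShift_pow_le hp hmem hτ N
  calc _ ≤ ∑ n ∈ Finset.range N, (2 ^ p * (τ * ω ^ p) + 2 ^ p *
        (τ * ‖cellShift τ n fun t => g t - φ t‖ ^ p)) := Finset.sum_le_sum fun n _ => hsplit n
    _ = 2 ^ p * T * ω ^ p + 2 ^ p * ∑ n ∈ Finset.range N,
        τ * ‖cellShift τ n fun t => g t - φ t‖ ^ p := by
        rw [Finset.sum_add_distrib, Finset.sum_const, Finset.card_range, nsmul_eq_mul,
          Finset.mul_sum, ← hNτ]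
        ring
    _ ≤ 2 ^ p * T * ω ^ p + 2 ^ p * (4 ^ p * (ε / (4 * 2 ^ p * 4 ^ p))) := by
        gcongr
        exact h4.trans (by gcongr)
    _ = 2 ^ p * T * ω ^ p + ε / 4 := by field_simp
    _ < ε := by linarith

theorem norm_cellAvg_sub_le_of_modulus [CompleteSpace Z] {g : ℝ → Z} (hg : Continuous g)
    {τ ω : ℝ} (hτ : 0 < τ) (hω : ∀ s t, |s - t| ≤ τ → ‖g s - g t‖ ≤ ω) (n : ℕ) {t : ℝ}
    (ht : t ∈ Icc (n * τ) ((n + 1) * τ)) : ‖cellAvg τ n g - g t‖ ≤ ω := by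
  have e : cellAvg τ n g - g t = cellAvg τ n fun s => g s - g t := by
    rw [cellAvg_sub (hg.intervalIntegrable _ _) (by simp)]
    congr 1
    rw [cellAvg, intervalIntegral.integral_const, smul_smul,
      show τ⁻¹ * ((n + 1) * τ - n * τ) = 1 by field_simp; ring, one_smul]
  rw [e]
  refine norm_cellAvg_le_of_le hτ n fun s hs => hω s t ?_
  rw [abs_le]
  constructor <;> nlinarith [hs.1, hs.2, ht.1, ht.2]

/-- Another density argument: averaging is stable in `L²` on each cell by Jensen's inequality, and
close to the identity on uniformly continuous functions. -/
theorem sum_integral_cellAvg_sub_lt [CompleteSpace Z] {g : ℝ → Z} (hg : MemLp g 2 volume)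
    {T : ℝ} (hT : 0 < T) {ε : ℝ} (hε : 0 < ε) :
    ∃ δ > 0, ∀ N : ℕ, 0 < N → T / N < δ →
      ∑ n ∈ Finset.range N, ∫ t in (n * (T / N))..((n + 1) * (T / N)),
        ‖cellAvg (T / N) n g - g t‖ ^ 2 < ε := by
  have hp : 1 ≤ 2 := by norm_num
  have hg2 : MemLp g ((2 : ℕ) : ℝ≥0∞) volume := by exact_mod_cast hg
  obtain ⟨φ, hφ, hφc, hφu, hφε⟩ := exists_continuous_approx hp hg2 (ε := ε / 32) (by positivity)
  obtain ⟨ω, hω, hωε⟩ : ∃ ω > 0, 2 * T * ω ^ 2 < ε / 2 := by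
    refine ⟨√(ε / (8 * T)), by positivity, ?_⟩
    rw [Real.sq_sqrt (by positivity)]
    field_simp
    linarith
  obtain ⟨δ, hδ, hδω⟩ := Metric.uniformContinuous_iff.1 hφu ω hω
  refine ⟨δ, hδ, fun N hN hNδ => ?_⟩
  set τ := T / N with hτd
  have hN' : (0 : ℝ) < N := by exact_mod_cast hN
  have hτ : 0 < τ := by positivity
  have hNτ : N * τ = T := by rw [hτd]; field_simp
  have hmem : MemLp (fun t => g t - φ t) ((2 : ℕ) : ℝ≥0∞) volume := hg2.sub hφ
  have hi := memLp_intervalIntegrable hp hg2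
  have hiφ := memLp_intervalIntegrable hp hφ
  have him := memLp_intervalIntegrable hp hmem
  have hip : Integrable (fun t => ‖g t - φ t‖ ^ 2) volume := hmem.integrable_norm_pow (by norm_num)
  have key : ∀ n : ℕ, ∫ t in (n * τ)..((n + 1) * τ), ‖cellAvg τ n g - g t‖ ^ 2 ≤
      2 * ω ^ 2 * τ + 8 * ∫ t in (n * τ + 0)..((n + 1) * τ + 0), ‖g t - φ t‖ ^ 2 := by
    intro n
    simp only [add_zero]
    set A := cellAvg τ n fun t => g t - φ t with hA
    have e : cellAvg τ n g = cellAvg τ n φ + A := by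
      rw [hA, ← cellAvg_add (hiφ _ _) (him _ _)]; simp
    have hle : (n : ℝ) * τ ≤ (n + 1) * τ := by nlinarith
    have h1 : ∀ t ∈ Icc (n * τ) ((n + 1) * τ), ‖cellAvg τ n g - g t‖ ^ 2 ≤
        2 * ω ^ 2 + 4 * ‖A‖ ^ 2 + 4 * ‖g t - φ t‖ ^ 2 := by
      intro t ht
      have h2 := norm_cellAvg_sub_le_of_modulus hφc hτ (fun s t hst => by
        rw [← dist_eq_norm]
        exact (hδω (by rw [Real.dist_eq]; exact hst.trans_lt hNδ)).le) n ht
      have h3 : cellAvg τ n g - g t = (cellAvg τ n φ - φ t) + (A - (g t - φ t)) := by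
        rw [e]; abel
      have h4 := norm_add_le (cellAvg τ n φ - φ t) (A - (g t - φ t))
      have h5 := norm_sub_le A (g t - φ t)
      rw [← h3] at h4
      have h6 : ‖cellAvg τ n g - g t‖ ≤ ω + (‖A‖ + ‖g t - φ t‖) := by linarith
      have h7 := pow_le_pow_left₀ (norm_nonneg _) h6 2
      nlinarith [sq_nonneg (ω - (‖A‖ + ‖g t - φ t‖)), sq_nonneg (‖A‖ - ‖g t - φ t‖)]
    have hint : IntervalIntegrable (fun t => 2 * ω ^ 2 + 4 * ‖A‖ ^ 2 + 4 * ‖g t - φ t‖ ^ 2)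
        volume (n * τ) ((n + 1) * τ) :=
      intervalIntegrable_const.add (hip.intervalIntegrable.const_mul 4)
    have h8 : ∫ t in (n * τ)..((n + 1) * τ), ‖cellAvg τ n g - g t‖ ^ 2 ≤
        ∫ t in (n * τ)..((n + 1) * τ), (2 * ω ^ 2 + 4 * ‖A‖ ^ 2 + 4 * ‖g t - φ t‖ ^ 2) := by
      refine intervalIntegral.integral_mono_on hle ?_ hint h1
      refine hint.mono_fun ?_ ?_
      · exact ((aestronglyMeasurable_const.sub (hi _ _).1.aestronglyMeasurable).norm.pow
          2).mono_measure (by rw [uIoc_of_le hle])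
      · refine (ae_restrict_mem measurableSet_uIoc).mono fun t ht => ?_
        rw [uIoc_of_le hle] at ht
        simp only
        rw [Real.norm_of_nonneg (by positivity)]
        exact (h1 t (Ioc_subset_Icc_self ht)).trans (le_abs_self _)
    have h9 := cellAvg_pow_le hτ n (him _ _) hip.intervalIntegrable
    refine h8.trans ?_
    rw [intervalIntegral.integral_add (by simp) (hip.intervalIntegrable.const_mul 4),
      intervalIntegral.integral_const, intervalIntegral.integral_const_mul, smul_eq_mul]
    have e2 : (n + 1) * τ - n * τ = τ := by ring
    rw [e2]
    nlinarith
  have h4 := sum_integral_cells_le hip (fun t => by positivity) hτ.le 0 N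
  calc _ ≤ ∑ n ∈ Finset.range N, (2 * ω ^ 2 * τ + 8 *
        ∫ t in (n * τ + 0)..((n + 1) * τ + 0), ‖g t - φ t‖ ^ 2) :=
        Finset.sum_le_sum fun n _ => key n
    _ = 2 * T * ω ^ 2 + 8 * ∑ n ∈ Finset.range N,
        ∫ t in (n * τ + 0)..((n + 1) * τ + 0), ‖g t - φ t‖ ^ 2 := by
        rw [Finset.sum_add_distrib, Finset.sum_const, Finset.card_range, nsmul_eq_mul,
          Finset.mul_sum, ← hNτ]
        ring
    _ ≤ 2 * T * ω ^ 2 + 8 * (ε / 32) := by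
        gcongr
        exact h4.trans hφε
    _ < ε := by linarith

end Averages

/-! ### Weak measurability in separable Hilbert spaces -/

section Measurability

/-- Distinct basis vectors are at distance `√2`, so the balls of radius `1/2` around them form a
disjoint family of open sets, which separability forces to be countable. -/
theorem countable_basisIndex (Z : Type*) [NormedAddCommGroup Z] [InnerProductSpace ℝ Z]
    [CompleteSpace Z] [TopologicalSpace.SeparableSpace Z] : Countable (basisIndex Z) := by
  have ho : Orthonormal ℝ (basis Z) := (basis Z).orthonormal
  have hd : Pairwise fun i j => 1 ≤ dist (basis Z i) (basis Z j) := by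
    intro i j hij
    have h1 : ‖basis Z i - basis Z j‖ ^ 2 = 2 := by
      rw [norm_sub_sq_real, ho.1 i, ho.1 j, ho.2 hij]
      norm_num
    rw [dist_eq_norm]
    nlinarith [norm_nonneg (basis Z i - basis Z j)]
  have hdisj : Pairwise (Function.onFun Disjoint fun i => Metric.ball (basis Z i) (1 / 2)) := by
    intro i j hij
    refine Metric.ball_disjoint_ball ?_
    have := hd hij
    linarith
  have := Set.PairwiseDisjoint.countable_of_isOpen (a := Set.univ) (hdisj.set_pairwise Set.univ)
      (fun i _ => Metric.isOpen_ball)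
    (fun i _ => ⟨basis Z i, Metric.mem_ball_self (by norm_num)⟩)
  exact Set.countable_univ_iff.1 this

variable {α : Type*} [MeasurableSpace α] {ν : Measure α}
  {X : Type*} [NormedAddCommGroup X] [InnerProductSpace ℝ X] [CompleteSpace X]
  [TopologicalSpace.SeparableSpace X]

/-- A form of Pettis' theorem: `g` is the pointwise limit of its Fourier partial sums, taken over
the finite subsets of a countable index set. -/
theorem aestronglyMeasurable_of_inner {g : α → X}
    (h : ∀ x, AEStronglyMeasurable (fun t => inner ℝ x (g t)) ν) : AEStronglyMeasurable g ν := by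
  have := countable_basisIndex X
  refine aestronglyMeasurable_of_tendsto_ae (u := atTop)
    (f := fun (s : Finset (basisIndex X)) t => ∑ k ∈ s, inner ℝ (basis X k) (g t) • basis X k)
    (fun s => ?_) (Eventually.of_forall fun t => ?_)
  · refine Finset.aestronglyMeasurable_fun_sum s fun k _ => ?_
    exact (h _).smul_const _
  · have := (basis X).hasSum_repr (g t)
    simpa [HilbertBasis.repr_apply_apply, HasSum] using this

theorem aestronglyMeasurable_of_apply {g : α → StrongDual ℝ X}
    (h : ∀ x, AEStronglyMeasurable (fun t => g t x) ν) : AEStronglyMeasurable g ν := by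
  have h1 : AEStronglyMeasurable (fun t => (InnerProductSpace.toDual ℝ X).symm (g t)) ν := by
    refine aestronglyMeasurable_of_inner fun x => ?_
    refine (h x).congr (Eventually.of_forall fun t => ?_)
    simp only
    rw [real_inner_comm, InnerProductSpace.toDual_symm_apply]
  have h2 := (InnerProductSpace.toDual ℝ X).continuous.comp_aestronglyMeasurable h1
  refine h2.congr (Eventually.of_forall fun t => ?_)
  simp

/-- Only the scalar functions `t ↦ L t x y` are known to be measurable, so `u t` is expanded in a
countable basis before `L t` is applied. -/
theorem aestronglyMeasurable_form_apply {L : α → X →L[ℝ] X →L[ℝ] ℝ}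
    (hL : ∀ x y, AEMeasurable (fun t => L t x y) ν) {u : α → X} (hu : AEStronglyMeasurable u ν) :
    AEStronglyMeasurable (fun t => L t (u t)) ν := by
  have := countable_basisIndex X
  refine aestronglyMeasurable_of_apply fun y => ?_
  refine aestronglyMeasurable_of_tendsto_ae (u := atTop)
    (f := fun (s : Finset (basisIndex X)) t =>
      ∑ k ∈ s, inner ℝ (basis X k) (u t) * L t (basis X k) y)
    (fun s => ?_) (Eventually.of_forall fun t => ?_)
  · refine Finset.aestronglyMeasurable_fun_sum s fun k _ => ?_
    exact (aestronglyMeasurable_const.inner hu).mul (hL _ _).aestronglyMeasurable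
  · have h1 := ((basis X).hasSum_repr (u t)).mapL ((L t).flip y)
    simpa [HilbertBasis.repr_apply_apply, HasSum] using h1

end Measurability

/-! ### The density argument behind Lions' theorem -/

section DenseRange

variable {E : Type*} [NormedAddCommGroup E] [InnerProductSpace ℝ E] [CompleteSpace E]

/-- Lax–Milgram: accretivity of `J` makes `h + J` coercive with constant `h`. -/
theorem exists_smul_add_eq {J : E →L[ℝ] E} (hJ : ∀ g, 0 ≤ inner ℝ (J g) g) {h : ℝ} (hh : 0 < h)
    (φ : E) : ∃ g, h • g + J g = φ := by
  set A : E →L[ℝ] E := h • ContinuousLinearMap.id ℝ E + J with hA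
  set B : E →L[ℝ] E →L[ℝ] ℝ := (innerSL ℝ).comp A with hB
  have hB' : ∀ v w, B v w = inner ℝ (A v) w := fun v w => rfl
  have hc : IsCoercive B := by
    refine ⟨h, hh, fun u => ?_⟩
    rw [hB']
    simp only [hA, add_apply, smul_apply, ContinuousLinearMap.id_apply,
      inner_add_left, inner_smul_left, real_inner_self_eq_norm_sq, conj_trivial]
    nlinarith [hJ u]
  refine ⟨hc.continuousLinearEquivOfBilin.symm φ, ?_⟩
  refine ext_inner_right ℝ fun w => ?_
  have h1 := hc.continuousLinearEquivOfBilin_apply (hc.continuousLinearEquivOfBilin.symm φ) w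
  rw [ContinuousLinearEquiv.apply_symm_apply] at h1
  rw [h1, hB']
  rfl

omit [CompleteSpace E] in
theorem norm_smul_le_of_accretive {J : E →L[ℝ] E} (hJ : ∀ g, 0 ≤ inner ℝ (J g) g) {h : ℝ}
    (hh : 0 < h) (x : E) : ‖h • x‖ ≤ ‖h • x + J x‖ := by
  refine le_of_sq_le_sq ?_ (norm_nonneg _)
  rw [norm_add_sq_real, inner_smul_left, real_inner_comm]
  simp only [conj_trivial]
  have := mul_nonneg hh.le (hJ x)
  nlinarith [sq_nonneg ‖J x‖]

/-- Abstract form of Lions' theorem: `K` stands for the duality of the pivot space, `J` for the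
integration operator and `B` for the coercive operator of the evolution equation. -/
theorem denseRange_add_comp {K B J : E →L[ℝ] E} (hJ : ∀ g, 0 ≤ inner ℝ (J g) g)
    (hK : ∀ g, 0 ≤ inner ℝ (K g) g) (hKJ : ∀ g, 0 ≤ inner ℝ (K g) (J g)) (hJd : DenseRange J)
    {μ : ℝ} (hμ : 0 < μ) (hB : ∀ u, μ * ‖u‖ ^ 2 ≤ inner ℝ (B u) u) :
    DenseRange (K + B.comp J) := by
  set S := K + B.comp J with hS
  have hbot : S.rangeᗮ = ⊥ := by
    rw [Submodule.eq_bot_iff]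
    intro φ hφ
    have hφ' : ∀ g, inner ℝ (K g) φ + inner ℝ (B (J g)) φ = 0 := by
      intro g
      have := (Submodule.mem_orthogonal _ _).1 hφ (S g) ⟨g, rfl⟩
      rwa [hS, add_apply, inner_add_left] at this
    -- The element `φ` need not lie in the range of `J`, so it cannot be tested as `J g` directly.
    -- The regularization `h g + J g = φ` replaces this, and `h g` turns out to be small.
    have key : ∀ ε > 0, μ * ‖φ‖ ^ 2 ≤ ‖B‖ * (2 * ε) * ‖φ‖ := by
      intro ε hε
      obtain ⟨ψ, hψ⟩ := hJd.exists_dist_lt φ hε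
      -- Chosen so that `2 h ‖ψ‖ ≤ ε`: accretivity applied to `g - ψ` gives `‖h g‖ ≤ ‖φ - J ψ‖ + 2 h
      -- ‖ψ‖`.
      set h := ε / (1 + 2 * ‖ψ‖) with hh
      have hpos : 0 < h := by positivity
      obtain ⟨g, hg⟩ := exists_smul_add_eq hJ hpos φ
      have h1 := norm_smul_le_of_accretive hJ hpos (g - ψ)
      have e1 : h • (g - ψ) + J (g - ψ) = (φ - J ψ) - h • ψ := by
        rw [← hg, map_sub, smul_sub]; abel
      rw [e1] at h1
      have h2 : ‖h • g‖ ≤ 2 * ε := by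
        have e2 : h • g = h • (g - ψ) + h • ψ := by rw [smul_sub]; abel
        have h3 : h * (1 + 2 * ‖ψ‖) = ε := by rw [hh]; field_simp
        have h4 : ‖h • ψ‖ = h * ‖ψ‖ := by rw [norm_smul, Real.norm_of_nonneg hpos.le]
        have h5 := norm_sub_le (φ - J ψ) (h • ψ)
        rw [dist_eq_norm] at hψ
        rw [e2]
        refine (norm_add_le _ _).trans ?_
        nlinarith [norm_nonneg ψ]
      -- Orthogonality of `φ` to the range trades this term for `-⟪K g, φ⟫`, and `⟪K g, h g + J g⟫`
      -- is nonnegative term by term.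
      have h6 : inner ℝ (B (J g)) φ ≤ 0 := by
        have h7 : 0 ≤ inner ℝ (K g) φ := by
          rw [← hg, inner_add_right, inner_smul_right]
          exact add_nonneg (mul_nonneg hpos.le (hK g)) (hKJ g)
        linarith [hφ' g]
      have e3 : B φ = B (J g) + B (h • g) := by
        rw [← map_add, add_comm, hg]
      calc μ * ‖φ‖ ^ 2 ≤ inner ℝ (B φ) φ := hB φ
        _ = inner ℝ (B (J g)) φ + inner ℝ (B (h • g)) φ := by rw [e3, inner_add_left]
        _ ≤ 0 + ‖B (h • g)‖ * ‖φ‖ := add_le_add h6 (real_inner_le_norm _ _)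
        _ ≤ ‖B‖ * (2 * ε) * ‖φ‖ := by
          rw [zero_add]
          gcongr
          exact (B.le_opNorm _).trans (by gcongr)
    by_contra hne
    have hpos : 0 < ‖φ‖ := norm_pos_iff.2 hne
    have h1 := key (μ * ‖φ‖ / (4 * (‖B‖ + 1))) (by positivity)
    have h2 : ‖B‖ * (2 * (μ * ‖φ‖ / (4 * (‖B‖ + 1)))) * ‖φ‖ < μ * ‖φ‖ ^ 2 := by
      have h3 : ‖B‖ / (‖B‖ + 1) ≤ 1 := div_le_one_of_le₀ (by linarith) (by positivity)
      have e : ‖B‖ * (2 * (μ * ‖φ‖ / (4 * (‖B‖ + 1)))) * ‖φ‖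
          = (‖B‖ / (‖B‖ + 1)) * (μ * ‖φ‖ ^ 2 / 2) := by field_simp; ring
      rw [e]
      have : 0 < μ * ‖φ‖ ^ 2 := by positivity
      nlinarith
    linarith
  rw [← Submodule.topologicalClosure_eq_top_iff] at hbot
  have := Submodule.dense_iff_topologicalClosure_eq_top.2 hbot
  rw [LinearMap.coe_range] at this
  exact this

end DenseRange

/-! ### Square-integrable functions on the time interval -/

section TimeL2

instance (T : ℝ) : IsFiniteMeasure (timeMeasure T) :=
  ⟨by simp [timeMeasure]⟩

theorem ae_timeMeasure_mem (T : ℝ) : ∀ᵐ t ∂timeMeasure T, t ∈ Icc 0 T :=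
  ae_restrict_mem measurableSet_Icc

theorem integral_timeMeasure {Z : Type*} [NormedAddCommGroup Z] [NormedSpace ℝ Z] {T : ℝ}
    (hT : 0 ≤ T) (f : ℝ → Z) : ∫ t, f t ∂timeMeasure T = ∫ t in (0 : ℝ)..T, f t := by
  rw [timeMeasure, intervalIntegral.integral_of_le hT, integral_Icc_eq_integral_Ioc]

variable {Z : Type*} [NormedAddCommGroup Z]

theorem integrable_timeMeasure_iff {T : ℝ} (hT : 0 ≤ T) {f : ℝ → Z} :
    Integrable f (timeMeasure T) ↔ IntervalIntegrable f volume 0 T :=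
  (intervalIntegrable_iff_integrableOn_Icc_of_le hT).symm

theorem integrable_intervalIntegrable {T : ℝ} {f : ℝ → Z}
    (hf : Integrable f (timeMeasure T)) {a b : ℝ} (ha : a ∈ Icc 0 T) (hb : b ∈ Icc 0 T) :
    IntervalIntegrable f volume a b := by
  refine ((integrable_timeMeasure_iff (ha.1.trans ha.2)).1 hf).mono_set ?_
  rw [uIcc_of_le (ha.1.trans ha.2)]
  exact uIcc_subset_Icc ha hb

theorem memLp_two_integrable {T : ℝ} {f : ℝ → Z} (hf : MemLp f 2 (timeMeasure T)) :
    Integrable f (timeMeasure T) :=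
  hf.integrable (by norm_num)

theorem memLp_two_integrable_sq {T : ℝ} {f : ℝ → Z} (hf : MemLp f 2 (timeMeasure T)) :
    Integrable (fun t => ‖f t‖ ^ 2) (timeMeasure T) := by
  have : MemLp f ((2 : ℕ) : ℝ≥0∞) (timeMeasure T) := by exact_mod_cast hf
  exact this.integrable_norm_pow (by norm_num)

theorem memLp_timeMeasure_of_continuousOn {T : ℝ} {f : ℝ → Z} (hf : ContinuousOn f (Icc 0 T))
    (p : ℝ≥0∞) : MemLp f p (timeMeasure T) := by
  obtain ⟨M, hM⟩ := isCompact_Icc.exists_bound_of_continuousOn hf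
  exact MemLp.of_bound (hf.aestronglyMeasurable_of_isCompact isCompact_Icc measurableSet_Icc) M
    ((ae_timeMeasure_mem T).mono fun t ht => hM t ht)

theorem memLp_continuousLinearMap_apply {α : Type*} [MeasurableSpace α] {ν : Measure α}
    {p : ℝ≥0∞} [NormedSpace ℝ Z]
    {W : Type*} [NormedAddCommGroup W] [NormedSpace ℝ W] (A : Z →L[ℝ] W) {f : α → Z}
    (hf : MemLp f p ν) : MemLp (fun t => A (f t)) p ν :=
  A.comp_memLp' hf

theorem integrable_inner_of_memLp_two [InnerProductSpace ℝ Z] {α : Type*} [MeasurableSpace α]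
    {ν : Measure α} {f g : α → Z} (hf : MemLp f 2 ν) (hg : MemLp g 2 ν) :
    Integrable (fun t => inner ℝ (f t) (g t)) ν := by
  refine Integrable.mono' (hf.norm.integrable_mul hg.norm)
    (hf.aestronglyMeasurable.inner hg.aestronglyMeasurable) ?_
  exact Eventually.of_forall fun t => norm_inner_le_norm _ _

theorem norm_toLp_sq {T : ℝ} (hT : 0 ≤ T) [InnerProductSpace ℝ Z] {f : ℝ → Z}
    (hf : MemLp f 2 (timeMeasure T)) : ‖hf.toLp f‖ ^ 2 = ∫ t in (0 : ℝ)..T, ‖f t‖ ^ 2 := by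
  rw [← real_inner_self_eq_norm_sq, L2.inner_def, ← integral_timeMeasure hT]
  refine integral_congr_ae ?_
  filter_upwards [hf.coeFn_toLp] with t ht
  rw [ht, real_inner_self_eq_norm_sq]

theorem norm_Lp_sq {T : ℝ} (hT : 0 ≤ T) [InnerProductSpace ℝ Z] (f : Lp Z 2 (timeMeasure T)) :
    ‖f‖ ^ 2 = ∫ t in (0 : ℝ)..T, ‖f t‖ ^ 2 := by
  have := norm_toLp_sq hT (Lp.memLp f)
  rwa [Lp.toLp_coeFn] at this

theorem sq_integral_norm_le {T : ℝ} (hT : 0 < T) [NormedSpace ℝ Z] {f : ℝ → Z}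
    (hf : MemLp f 2 (timeMeasure T)) :
    (∫ t in (0 : ℝ)..T, ‖f t‖) ^ 2 ≤ T * ∫ t in (0 : ℝ)..T, ‖f t‖ ^ 2 := by
  have h := integral_norm_pow_le (p := 2) hT
    ((integrable_timeMeasure_iff hT.le).1 (memLp_two_integrable hf))
    ((integrable_timeMeasure_iff hT.le).1 (memLp_two_integrable_sq hf))
  rw [sub_zero, mul_pow] at h
  have h2 : (∫ t in (0 : ℝ)..T, ‖f t‖) ^ 2 =
      T ^ 2 * (T⁻¹ ^ 2 * (∫ t in (0 : ℝ)..T, ‖f t‖) ^ 2) := by field_simp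
  rw [h2]
  calc _ ≤ T ^ 2 * (T⁻¹ * ∫ t in (0 : ℝ)..T, ‖f t‖ ^ 2) := by gcongr
    _ = _ := by field_simp

theorem continuousOn_primitive_timeMeasure [NormedSpace ℝ Z] {T : ℝ} {f : ℝ → Z}
    (hf : Integrable f (timeMeasure T)) :
    ContinuousOn (fun t => ∫ s in (0 : ℝ)..t, f s) (Icc 0 T) := by
  rcases lt_or_ge T 0 with h | h
  · simp [Icc_eq_empty h.not_ge]
  · have := intervalIntegral.continuousOn_primitive_interval' (a := 0)
      ((integrable_timeMeasure_iff h).1 hf) (by simp)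
    rwa [uIcc_of_le h] at this

theorem integral_congr_of_ae_timeMeasure [NormedSpace ℝ Z] {T : ℝ} {f g : ℝ → Z}
    (h : ∀ᵐ t ∂timeMeasure T, f t = g t) {a b : ℝ} (ha : a ∈ Icc 0 T) (hb : b ∈ Icc 0 T) :
    ∫ t in a..b, f t = ∫ t in a..b, g t := by
  refine intervalIntegral.integral_congr_ae ?_
  have := (ae_restrict_iff' measurableSet_Icc).1 h
  filter_upwards [this] with t ht hm
  exact ht (uIcc_subset_Icc ha hb (uIoc_subset_uIcc hm))

end TimeL2

/-! ### Linear evolution equations and the energy estimate -/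

section Evolution

variable {X Y : Type*} [NormedAddCommGroup X] [InnerProductSpace ℝ X] [CompleteSpace X]
  [NormedAddCommGroup Y] [InnerProductSpace ℝ Y] [CompleteSpace Y]

/-- `(P, u)` solves `P' + L P = f₁ + f₂`, `P(0) = y₀` in integrated form, with `u` the
representative of `P` with values in `X`. -/
structure IsSol (i : X →L[ℝ] Y) (T : ℝ) (L : ℝ → X →L[ℝ] X →L[ℝ] ℝ) (f₁ : ℝ → Y)
    (f₂ : ℝ → StrongDual ℝ X) (y₀ : Y) (P : ℝ → Y) (u : ℝ → X) : Prop where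
  memLp : MemLp u 2 (timeMeasure T)
  continuousOn : ContinuousOn P (Icc 0 T)
  ae_eq : ∀ᵐ t ∂timeMeasure T, i (u t) = P t
  initial : P 0 = y₀
  equation : ∀ t ∈ Icc 0 T, dualEmb i (P t) =
    dualEmb i y₀ + ∫ s in (0 : ℝ)..t, (dualEmb i (f₁ s) + f₂ s - L s (u s))

variable {i : X →L[ℝ] Y} {T μ η : ℝ}
  {L : ℝ → X →L[ℝ] X →L[ℝ] ℝ}

omit [CompleteSpace X] in
theorem IsUniformForm.norm_le (hL : IsUniformForm T μ η L) {t : ℝ} (ht : t ∈ Icc 0 T) (x : X) :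
    ‖L t x‖ ≤ |η| * ‖x‖ := by
  refine ContinuousLinearMap.opNorm_le_bound _ (by positivity) fun y => ?_
  refine (hL.bound t ht x y).trans ?_
  gcongr
  exact le_abs_self _

theorem IsUniformForm.memLp [TopologicalSpace.SeparableSpace X] (hL : IsUniformForm T μ η L) {u : ℝ
    → X} {p : ℝ≥0∞}
    (hu : MemLp u p (timeMeasure T)) : MemLp (fun t => L t (u t)) p (timeMeasure T) :=
  hu.of_le_mul (aestronglyMeasurable_form_apply hL.aemeasurable hu.aestronglyMeasurable)
    ((ae_timeMeasure_mem T).mono fun _ ht => hL.norm_le ht _)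

/-- The equation is tested with its solution. The part `f₂` is absorbed by half of the coercivity;
`f₁` is only integrable in time and is paired with the maximum of `‖i v‖`. The estimate serves for
differences of approximate solutions. -/
theorem energy_bound (hT : 0 ≤ T) (hμ : 0 < μ) (hL : IsUniformForm T μ η L) {x : X}
    {g : ℝ → X} (hg : MemLp g 2 (timeMeasure T)) {f₁ : ℝ → Y} {f₂ : ℝ → StrongDual ℝ X}
    (h₁ : MemLp f₁ 1 (timeMeasure T)) (h₂ : MemLp f₂ 2 (timeMeasure T))
    (heq : ∀ᵐ t ∂timeMeasure T, dualEmb i (i (g t)) + L t (x + ∫ s in (0 : ℝ)..t, g s)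
      = dualEmb i (f₁ t) + f₂ t) {t : ℝ} (ht : t ∈ Icc 0 T) :
    ‖i (x + ∫ s in (0 : ℝ)..t, g s)‖ ^ 2
      + μ * ∫ s in (0 : ℝ)..t, ‖x + ∫ r in (0 : ℝ)..s, g r‖ ^ 2
      ≤ 2 * ‖i x‖ ^ 2 + 4 * (∫ s in (0 : ℝ)..T, ‖f₁ s‖) ^ 2
        + 2 / μ * ∫ s in (0 : ℝ)..T, ‖f₂ s‖ ^ 2 := by
  set v : ℝ → X := fun t => x + ∫ s in (0 : ℝ)..t, g s with hv
  have h0T : (0 : ℝ) ∈ Icc 0 T := ⟨le_rfl, hT⟩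
  have hTT : T ∈ Icc 0 T := ⟨hT, le_rfl⟩
  have hgi := memLp_two_integrable hg
  have hvc : ContinuousOn v (Icc 0 T) :=
    continuousOn_const.add (continuousOn_primitive_timeMeasure hgi)
  have hv2 := memLp_two_integrable_sq (memLp_timeMeasure_of_continuousOn hvc 2)
  have hf1 : Integrable f₁ (timeMeasure T) := memLp_one_iff_integrable.1 h₁
  have hf2 := memLp_two_integrable_sq h₂
  have hvg : Integrable (fun s => inner ℝ (i (v s)) (i (g s))) (timeMeasure T) :=
    integrable_inner_of_memLp_two
      (memLp_continuousLinearMap_apply i (memLp_timeMeasure_of_continuousOn hvc 2))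
      (memLp_continuousLinearMap_apply i hg)
  obtain ⟨t₀, ht₀, hmax⟩ := isCompact_Icc.exists_isMaxOn ⟨0, h0T⟩
    (i.continuous.comp_continuousOn hvc).norm
  set M := ‖i (v t₀)‖ with hM
  have hM' : ∀ s ∈ Icc 0 T, ‖i (v s)‖ ≤ M := fun s hs => hmax hs
  set A := ∫ s in (0 : ℝ)..T, ‖f₁ s‖ with hA
  set D := ∫ s in (0 : ℝ)..T, ‖f₂ s‖ ^ 2 with hD
  have hpt : ∀ᵐ s ∂timeMeasure T, inner ℝ (i (v s)) (i (g s)) + μ / 2 * ‖v s‖ ^ 2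
      ≤ M * ‖f₁ s‖ + (2 * μ)⁻¹ * ‖f₂ s‖ ^ 2 := by
    filter_upwards [heq, ae_timeMeasure_mem T] with s hs hsm
    have h1 := congrArg (fun F : StrongDual ℝ X => F (v s)) hs
    simp only [add_apply, dualEmb_apply] at h1
    have h2 := hL.pos s hsm (v s)
    have h3 : inner ℝ (f₁ s) (i (v s)) ≤ M * ‖f₁ s‖ := by
      refine (real_inner_le_norm _ _).trans ?_
      rw [mul_comm]
      gcongr
      exact hM' s hsm
    have h4 : f₂ s (v s) ≤ ‖f₂ s‖ * ‖v s‖ := (le_abs_self _).trans ((f₂ s).le_opNorm _)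
    have h5 : ‖f₂ s‖ * ‖v s‖ ≤ (2 * μ)⁻¹ * ‖f₂ s‖ ^ 2 + μ / 2 * ‖v s‖ ^ 2 := by
      have h6 : 0 ≤ (2 * μ)⁻¹ * (‖f₂ s‖ - μ * ‖v s‖) ^ 2 := by positivity
      have h7 : (2 * μ)⁻¹ * (‖f₂ s‖ - μ * ‖v s‖) ^ 2 =
          (2 * μ)⁻¹ * ‖f₂ s‖ ^ 2 + μ / 2 * ‖v s‖ ^ 2 - ‖f₂ s‖ * ‖v s‖ := by
        field_simp; ring
      linarith
    rw [real_inner_comm]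
    linarith
  have key : ∀ t ∈ Icc 0 T, ‖i (v t)‖ ^ 2 + μ * ∫ s in (0 : ℝ)..t, ‖v s‖ ^ 2
      ≤ ‖i x‖ ^ 2 + 2 * M * A + D / μ := by
    intro t ht
    have hsub : Icc 0 t ⊆ Icc 0 T := Icc_subset_Icc le_rfl ht.2
    have hii : ∀ {f : ℝ → ℝ}, Integrable f (timeMeasure T) → IntervalIntegrable f volume 0 t :=
      fun hf => integrable_intervalIntegrable hf h0T ht
    have hgt := integrable_intervalIntegrable hgi h0T ht
    have higt : IntervalIntegrable (fun s => i (g s)) volume 0 t :=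
      integrable_intervalIntegrable (i.integrable_comp hgi) h0T ht
    have hprim : ∀ s ∈ Icc 0 T, i (v s) = i x + ∫ r in (0 : ℝ)..s, i (g r) := by
      intro s hs
      simp only [hv]
      rw [map_add, i.intervalIntegral_comp_comm (integrable_intervalIntegrable hgi h0T hs)]
    -- The integrand is the derivative of `‖i v‖² / 2`; the constant `i x` is split off because the
    -- integration by parts formula concerns primitives that vanish at `0`.
    have hprod : ∫ s in (0 : ℝ)..t, inner ℝ (i (v s)) (i (g s)) =
        ‖i (v t)‖ ^ 2 / 2 - ‖i x‖ ^ 2 / 2 := by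
      have e1 : ∫ s in (0 : ℝ)..t, inner ℝ (i x) (i (g s)) =
          inner ℝ (i x) (∫ s in (0 : ℝ)..t, i (g s)) :=
        (innerSL ℝ (i x)).intervalIntegral_comp_comm higt
      have e2 := integral_inner_primitive_self ht.1 higt
      have hii1 : IntervalIntegrable (fun s => inner ℝ (i x) (i (g s))) volume 0 t :=
        hii ((innerSL ℝ (i x)).integrable_comp (i.integrable_comp hgi))
      have e3 : ∫ s in (0 : ℝ)..t, inner ℝ (∫ r in (0 : ℝ)..s, i (g r)) (i (g s)) =
          (∫ s in (0 : ℝ)..t, inner ℝ (i (v s)) (i (g s)))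
            - ∫ s in (0 : ℝ)..t, inner ℝ (i x) (i (g s)) := by
        rw [← intervalIntegral.integral_sub (hii hvg) hii1]
        refine intervalIntegral.integral_congr fun s hs => ?_
        rw [uIcc_of_le ht.1] at hs
        rw [hprim s (hsub hs), inner_add_left]
        ring
      rw [hprim t ht, norm_add_sq_real]
      linarith
    have hle : ∫ s in (0 : ℝ)..t, (inner ℝ (i (v s)) (i (g s)) + μ / 2 * ‖v s‖ ^ 2) ≤
        ∫ s in (0 : ℝ)..t, (M * ‖f₁ s‖ + (2 * μ)⁻¹ * ‖f₂ s‖ ^ 2) := by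
      refine intervalIntegral.integral_mono_ae_restrict ht.1
        ((hii hvg).add ((hii hv2).const_mul _))
        (((hii hf1.norm).const_mul _).add ((hii hf2).const_mul _)) ?_
      exact ae_restrict_of_ae_restrict_of_subset hsub hpt
    rw [intervalIntegral.integral_add (hii hvg) ((hii hv2).const_mul _),
      intervalIntegral.integral_add ((hii hf1.norm).const_mul _) ((hii hf2).const_mul _),
      intervalIntegral.integral_const_mul, intervalIntegral.integral_const_mul,
      intervalIntegral.integral_const_mul, hprod] at hle
    have h1 : ∫ s in (0 : ℝ)..t, ‖f₁ s‖ ≤ A :=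
      intervalIntegral.integral_mono_interval le_rfl ht.1 ht.2
        (Eventually.of_forall fun _ => norm_nonneg _)
        (integrable_intervalIntegrable hf1.norm h0T hTT)
    have h2 : ∫ s in (0 : ℝ)..t, ‖f₂ s‖ ^ 2 ≤ D :=
      intervalIntegral.integral_mono_interval le_rfl ht.1 ht.2
        (Eventually.of_forall fun _ => by positivity)
        (integrable_intervalIntegrable hf2 h0T hTT)
    have h3 : M * ∫ s in (0 : ℝ)..t, ‖f₁ s‖ ≤ M * A :=
      mul_le_mul_of_nonneg_left h1 (norm_nonneg _)
    have h4 : (2 * μ)⁻¹ * ∫ s in (0 : ℝ)..t, ‖f₂ s‖ ^ 2 ≤ (2 * μ)⁻¹ * D :=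
      mul_le_mul_of_nonneg_left h2 (by positivity)
    have h5 : D / μ = 2 * ((2 * μ)⁻¹ * D) := by field_simp
    rw [h5]
    linarith
  have h0 : 0 ≤ ∫ s in (0 : ℝ)..t₀, ‖v s‖ ^ 2 :=
    intervalIntegral.integral_nonneg ht₀.1 fun _ _ => by positivity
  -- At the maximum point the estimate bounds `M² ` itself. Combined with `4 M A ≤ M² + 4 A²` it
  -- gives `2 M A ≤ ‖i x‖² + 4 A² + D / μ`, which is then inserted into the estimate at `t`.
  have h1 := key t₀ ht₀
  have h2 := key t ht
  have h3 := mul_nonneg hμ.le h0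
  rw [← hM] at h1
  have h4 : 2 / μ * D = 2 * (D / μ) := by ring
  rw [h4]
  nlinarith [sq_nonneg (M - 2 * A)]

end Evolution

/-! ### Integration and multiplication operators on `L²(0, T; X)` -/

section EvolutionExistence

variable {X Y : Type*} [NormedAddCommGroup X] [InnerProductSpace ℝ X] [CompleteSpace X]
  [NormedAddCommGroup Y] [InnerProductSpace ℝ Y] [CompleteSpace Y]
  {i : X →L[ℝ] Y} {T μ η : ℝ} {L : ℝ → X →L[ℝ] X →L[ℝ] ℝ}

omit [CompleteSpace X] in
theorem memLp_primitive {g : ℝ → X} (hg : MemLp g 2 (timeMeasure T)) :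
    MemLp (fun t => ∫ s in (0 : ℝ)..t, g s) 2 (timeMeasure T) :=
  memLp_timeMeasure_of_continuousOn
    (continuousOn_primitive_timeMeasure (memLp_two_integrable hg)) 2

variable (X) in
/-- Integration from `0` as an operator in `L²(0, T; X)`. -/
def primitiveL (hT : 0 < T) : Lp X 2 (timeMeasure T) →L[ℝ] Lp X 2 (timeMeasure T) :=
  LinearMap.mkContinuous
    { toFun := fun g => (memLp_primitive (Lp.memLp g)).toLp _
      map_add' := fun g h => by
        rw [← MemLp.toLp_add]
        refine MemLp.toLp_congr _ _ ?_
        filter_upwards [ae_timeMeasure_mem T] with t ht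
        have h0 : (0 : ℝ) ∈ Icc 0 T := ⟨le_rfl, hT.le⟩
        simp only [Pi.add_apply]
        rw [← intervalIntegral.integral_add
          (integrable_intervalIntegrable (memLp_two_integrable (Lp.memLp g)) h0 ht)
          (integrable_intervalIntegrable (memLp_two_integrable (Lp.memLp h)) h0 ht)]
        exact integral_congr_of_ae_timeMeasure (Lp.coeFn_add g h) h0 ht
      map_smul' := fun c g => by
        rw [RingHom.id_apply, ← MemLp.toLp_const_smul]
        refine MemLp.toLp_congr _ _ ?_
        filter_upwards [ae_timeMeasure_mem T] with t ht
        have h0 : (0 : ℝ) ∈ Icc 0 T := ⟨le_rfl, hT.le⟩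
        simp only [Pi.smul_apply]
        rw [← intervalIntegral.integral_smul]
        exact integral_congr_of_ae_timeMeasure (Lp.coeFn_smul c g) h0 ht }
    T (fun g => by
      refine le_of_sq_le_sq ?_ (by positivity)
      simp only [LinearMap.coe_mk, AddHom.coe_mk]
      have hg := Lp.memLp g
      rw [norm_toLp_sq hT.le, mul_pow, norm_Lp_sq hT.le]
      have h1 := sq_integral_norm_le hT hg
      have h2 : ∫ t in (0 : ℝ)..T, ‖∫ s in (0 : ℝ)..t, g s‖ ^ 2 ≤
          ∫ t in (0 : ℝ)..T, T * ∫ t in (0 : ℝ)..T, ‖g t‖ ^ 2 := by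
        refine intervalIntegral.integral_mono_on hT.le ?_ intervalIntegrable_const ?_
        · exact (integrable_timeMeasure_iff hT.le).1
            (memLp_two_integrable_sq (memLp_primitive hg))
        · intro t ht
          refine le_trans ?_ h1
          gcongr
          exact norm_integral_le_of_mem
            ((integrable_timeMeasure_iff hT.le).1 (memLp_two_integrable hg)) ht
      refine h2.trans_eq ?_
      rw [intervalIntegral.integral_const, smul_eq_mul]
      ring)

omit [CompleteSpace X] in
theorem coeFn_primitiveL (hT : 0 < T) (g : Lp X 2 (timeMeasure T)) :
    primitiveL X hT g =ᵐ[timeMeasure T] fun t => ∫ s in (0 : ℝ)..t, g s :=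
  (memLp_primitive (Lp.memLp g)).coeFn_toLp

omit [CompleteSpace X] in
theorem inner_Lp_eq (hT : 0 < T) {f g : Lp X 2 (timeMeasure T)} {f' g' : ℝ → X}
    (hf : f =ᵐ[timeMeasure T] f') (hg : g =ᵐ[timeMeasure T] g') :
    inner ℝ f g = ∫ t in (0 : ℝ)..T, inner ℝ (f' t) (g' t) := by
  rw [L2.inner_def, ← integral_timeMeasure hT.le]
  refine integral_congr_ae ?_
  filter_upwards [hf, hg] with t h1 h2
  rw [h1, h2]

omit [InnerProductSpace ℝ X] [CompleteSpace X] in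
theorem intervalIntegrable_Lp (hT : 0 < T) (g : Lp X 2 (timeMeasure T)) :
    IntervalIntegrable g volume 0 T :=
  (integrable_timeMeasure_iff hT.le).1 (memLp_two_integrable (Lp.memLp g))

theorem inner_primitiveL_self_nonneg (hT : 0 < T) (g : Lp X 2 (timeMeasure T)) :
    0 ≤ inner ℝ (primitiveL X hT g) g := by
  rw [inner_Lp_eq hT (coeFn_primitiveL hT g) (EventuallyEq.refl _ _),
    integral_inner_primitive_self hT.le (intervalIntegrable_Lp hT g)]
  positivity

/-- Integration by parts: the adjoint of integration from `0` is integration up to `T`. -/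
theorem inner_primitiveL (hT : 0 < T) (g h : Lp X 2 (timeMeasure T)) :
    inner ℝ (primitiveL X hT g) h = ∫ t in (0 : ℝ)..T,
      inner ℝ (g t) ((∫ s in (0 : ℝ)..T, h s) - ∫ s in (0 : ℝ)..t, h s) := by
  have hg := Lp.memLp g
  have hh := Lp.memLp h
  have h1 := integral_inner_primitive hT.le (intervalIntegrable_Lp hT g)
    (intervalIntegrable_Lp hT h)
  have i1 := (integrable_timeMeasure_iff hT.le).1
    (integrable_inner_of_memLp_two (memLp_primitive hg) hh)
  have i2 := (integrable_timeMeasure_iff hT.le).1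
    (integrable_inner_of_memLp_two hg (memLp_primitive hh))
  have i3 := (integrable_timeMeasure_iff hT.le).1
    (integrable_inner_of_memLp_two hg (memLp_const (∫ s in (0 : ℝ)..T, h s)))
  rw [intervalIntegral.integral_add i1 i2] at h1
  rw [inner_Lp_eq hT (coeFn_primitiveL hT g) (EventuallyEq.refl _ _)]
  simp only [inner_sub_right]
  rw [intervalIntegral.integral_sub i3 i2]
  have e : ∫ t in (0 : ℝ)..T, inner ℝ (g t) (∫ s in (0 : ℝ)..T, h s) =
      inner ℝ (∫ s in (0 : ℝ)..T, g s) (∫ s in (0 : ℝ)..T, h s) := by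
    rw [real_inner_comm]
    have := (innerSL ℝ (∫ s in (0 : ℝ)..T, h s)).intervalIntegral_comp_comm
      (intervalIntegrable_Lp hT g)
    simp only [innerSL_apply_apply] at this
    rw [← this]
    simp only [real_inner_comm]
  linarith

/-- The adjoint is injective: its value at `ψ` is `t ↦ ∫ₜᵀ ψ`, and if this vanishes, then `ψ = 0` by
Lebesgue differentiation. -/
theorem denseRange_primitiveL (hT : 0 < T) : DenseRange (primitiveL X hT) := by
  have hbot : (primitiveL X hT).rangeᗮ = ⊥ := by
    rw [Submodule.eq_bot_iff]
    intro ψ hψ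
    have h1 : ∀ g, inner ℝ (primitiveL X hT g) ψ = 0 := fun g =>
      (Submodule.mem_orthogonal _ _).1 hψ _ ⟨g, rfl⟩
    set c := ∫ s in (0 : ℝ)..T, ψ s with hc
    set F : ℝ → X := fun t => c - ∫ s in (0 : ℝ)..t, ψ s with hF
    have hFc : ContinuousOn F (Icc 0 T) := continuousOn_const.sub
      (continuousOn_primitive_timeMeasure (memLp_two_integrable (Lp.memLp ψ)))
    have hFm := memLp_timeMeasure_of_continuousOn hFc 2
    -- As `F` is the adjoint applied to `ψ`, the orthogonality relation with `g = F` says that `F`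
    -- is orthogonal to itself.
    have h2 : hFm.toLp F = 0 := by
      have h3 := h1 (hFm.toLp F)
      rw [inner_primitiveL] at h3
      have h4 : inner ℝ (hFm.toLp F) (hFm.toLp F) = (0 : ℝ) := by
        rw [inner_Lp_eq hT (EventuallyEq.refl _ _) hFm.coeFn_toLp]
        exact h3
      exact inner_self_eq_zero.1 h4
    have h5 : F =ᵐ[timeMeasure T] fun _ => 0 := by
      have := hFm.coeFn_toLp
      rw [h2] at this
      exact this.symm.trans (Lp.coeFn_zero _ _ _)
    have h6 : EqOn F (fun _ => 0) (Icc 0 T) :=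
      Measure.eqOn_Icc_of_ae_eq volume hT.ne h5 hFc continuousOn_const
    have hc0 : c = 0 := by simpa [hF] using h6 ⟨le_rfl, hT.le⟩
    have h7 : ∀ t ∈ uIcc 0 T, ∫ s in (0 : ℝ)..t, ψ s = 0 := by
      intro t ht
      rw [uIcc_of_le hT.le] at ht
      simpa [hF, hc0] using h6 ht
    have h8 := ae_eq_zero_of_primitive_eq_zero (intervalIntegrable_Lp hT ψ) h7
    refine Lp.ext ?_
    refine EventuallyEq.trans ?_ (Lp.coeFn_zero _ _ _).symm
    have h9 : ∀ᵐ t ∂timeMeasure T, t ∈ Ioo 0 T := by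
      rw [timeMeasure, restrict_Ioo_eq_restrict_Icc.symm]
      exact ae_restrict_mem measurableSet_Ioo
    filter_upwards [h9, ae_restrict_of_ae h8] with t h10 h11
    exact h11 h10
  rw [← Submodule.topologicalClosure_eq_top_iff] at hbot
  have := Submodule.dense_iff_topologicalClosure_eq_top.2 hbot
  rw [LinearMap.coe_range] at this
  exact this

variable [TopologicalSpace.SeparableSpace X]

theorem IsUniformForm.memLp_toDual_symm (hL : IsUniformForm T μ η L) {u : ℝ → X}
    (hu : MemLp u 2 (timeMeasure T)) :
    MemLp (fun t => (InnerProductSpace.toDual ℝ X).symm (L t (u t))) 2 (timeMeasure T) :=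
  (hL.memLp hu).of_le
    ((InnerProductSpace.toDual ℝ X).symm.continuous.comp_aestronglyMeasurable
      (hL.memLp hu).aestronglyMeasurable)
    (Eventually.of_forall fun t => by rw [LinearIsometryEquiv.norm_map])

/-- The multiplication operator `u ↦ L(·) u(·)` in `L²(0, T; X)`, after Riesz identification. -/
def IsUniformForm.mulL (hL : IsUniformForm T μ η L) :
    Lp X 2 (timeMeasure T) →L[ℝ] Lp X 2 (timeMeasure T) :=
  LinearMap.mkContinuous
    { toFun := fun u => (hL.memLp_toDual_symm (Lp.memLp u)).toLp _
      map_add' := fun u v => by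
        rw [← MemLp.toLp_add]
        refine MemLp.toLp_congr _ _ ?_
        filter_upwards [Lp.coeFn_add u v] with t ht
        rw [Pi.add_apply, ht, Pi.add_apply, map_add, map_add]
      map_smul' := fun c u => by
        rw [RingHom.id_apply, ← MemLp.toLp_const_smul]
        refine MemLp.toLp_congr _ _ ?_
        filter_upwards [Lp.coeFn_smul c u] with t ht
        rw [Pi.smul_apply, ht, Pi.smul_apply, map_smul, map_smul] }
    |η| (fun u => by
      refine Lp.norm_le_mul_norm_of_ae_le_mul ?_
      simp only [LinearMap.coe_mk, AddHom.coe_mk]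
      filter_upwards [(hL.memLp_toDual_symm (Lp.memLp u)).coeFn_toLp, ae_timeMeasure_mem T]
        with t h1 h2
      rw [h1, LinearIsometryEquiv.norm_map]
      exact hL.norm_le h2 _)

theorem IsUniformForm.coeFn_mulL (hL : IsUniformForm T μ η L) (u : Lp X 2 (timeMeasure T)) :
    hL.mulL u =ᵐ[timeMeasure T] fun t => (InnerProductSpace.toDual ℝ X).symm (L t (u t)) :=
  (hL.memLp_toDual_symm (Lp.memLp u)).coeFn_toLp

/-- An instance of `denseRange_add_comp` with `K = i* i`, integration as `J` and multiplication by
`L` as `B`. The condition on `K` and `J` holds since `⟪K g, J g⟫` equals `‖∫₀ᵀ i g‖² / 2`. -/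
theorem exists_integral_residual_lt (hT : 0 < T) (hμ : 0 < μ) (hL : IsUniformForm T μ η L)
    {f : ℝ → StrongDual ℝ X} (hf : MemLp f 2 (timeMeasure T)) {ε : ℝ} (hε : 0 < ε) :
    ∃ g : ℝ → X, MemLp g 2 (timeMeasure T) ∧
      ∫ t in (0 : ℝ)..T, ‖dualEmb i (i (g t)) + L t (∫ s in (0 : ℝ)..t, g s) - f t‖ ^ 2 < ε := by
  set R := (InnerProductSpace.toDual ℝ X).symm
  set K₀ : X →L[ℝ] X := (ContinuousLinearMap.adjoint i).comp i with hK₀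
  set K : Lp X 2 (timeMeasure T) →L[ℝ] Lp X 2 (timeMeasure T) :=
    ContinuousLinearMap.compLpL 2 (timeMeasure T) K₀ with hK
  have hKc : ∀ g, K g =ᵐ[timeMeasure T] fun t => K₀ (g t) := fun g =>
    ContinuousLinearMap.coeFn_compLpL K₀ g
  have hd : DenseRange (K + hL.mulL.comp (primitiveL X hT)) := by
    refine denseRange_add_comp (inner_primitiveL_self_nonneg hT) ?_ ?_
      (denseRange_primitiveL hT) hμ ?_
    · intro g
      rw [inner_Lp_eq hT (hKc g) (EventuallyEq.refl _ _)]
      refine intervalIntegral.integral_nonneg hT.le fun t _ => ?_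
      rw [hK₀, ContinuousLinearMap.comp_apply, ContinuousLinearMap.adjoint_inner_left]
      exact real_inner_self_nonneg
    · intro g
      have hig : IntervalIntegrable (fun s => i (g s)) volume 0 T :=
        (integrable_timeMeasure_iff hT.le).1
          (i.integrable_comp (memLp_two_integrable (Lp.memLp g)))
      rw [inner_Lp_eq hT (hKc g) (coeFn_primitiveL hT g)]
      have e : ∫ t in (0 : ℝ)..T, inner ℝ (K₀ (g t)) (∫ s in (0 : ℝ)..t, g s) =
          ∫ t in (0 : ℝ)..T, inner ℝ (∫ s in (0 : ℝ)..t, i (g s)) (i (g t)) := by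
        refine intervalIntegral.integral_congr fun t ht => ?_
        rw [uIcc_of_le hT.le] at ht
        rw [hK₀, ContinuousLinearMap.comp_apply, ContinuousLinearMap.adjoint_inner_left,
          ← i.intervalIntegral_comp_comm (integrable_intervalIntegrable
            (memLp_two_integrable (Lp.memLp g)) ⟨le_rfl, hT.le⟩ ht), real_inner_comm]
      rw [e, integral_inner_primitive_self hT.le hig]
      positivity
    · intro u
      rw [inner_Lp_eq hT (hL.coeFn_mulL u) (EventuallyEq.refl _ _), norm_Lp_sq hT.le,
        ← intervalIntegral.integral_const_mul]
      have hu := Lp.memLp u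
      refine intervalIntegral.integral_mono_on hT.le ?_ ?_ fun t ht => ?_
      · exact ((integrable_timeMeasure_iff hT.le).1 (memLp_two_integrable_sq hu)).const_mul μ
      · exact (integrable_timeMeasure_iff hT.le).1
          (integrable_inner_of_memLp_two (hL.memLp_toDual_symm hu) hu)
      · rw [InnerProductSpace.toDual_symm_apply]
        exact hL.pos t ht _
  have hRf : MemLp (fun t => R (f t)) 2 (timeMeasure T) :=
    hf.of_le (R.continuous.comp_aestronglyMeasurable hf.aestronglyMeasurable)
      (Eventually.of_forall fun t => by rw [LinearIsometryEquiv.norm_map])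
  obtain ⟨g, hg⟩ := hd.exists_dist_lt (hRf.toLp _) (Real.sqrt_pos.2 hε)
  refine ⟨g, Lp.memLp g, ?_⟩
  rw [dist_comm, dist_eq_norm] at hg
  have h1 := pow_lt_pow_left₀ hg (norm_nonneg _) two_ne_zero
  rw [Real.sq_sqrt hε.le, norm_Lp_sq hT.le] at h1
  refine lt_of_eq_of_lt ?_ h1
  refine integral_congr_of_ae_timeMeasure ?_ ⟨le_rfl, hT.le⟩ ⟨hT.le, le_rfl⟩
  filter_upwards [Lp.coeFn_sub ((K + hL.mulL.comp (primitiveL X hT)) g) (hRf.toLp _),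
    Lp.coeFn_add (K g) (hL.mulL (primitiveL X hT g)), hKc g, hRf.coeFn_toLp,
    hL.coeFn_mulL (primitiveL X hT g), coeFn_primitiveL hT g] with t e1 e2 e3 e4 e5 e6
  have e7 : ((K + hL.mulL.comp (primitiveL X hT)) g : ℝ → X) t =
      K₀ (g t) + R (L t (∫ s in (0 : ℝ)..t, g s)) := by
    rw [← e6, ← e5, ← e3]
    exact e2
  have e8 : K₀ (g t) = R (dualEmb i (i (g t))) := by
    refine ext_inner_right ℝ fun w => ?_
    rw [InnerProductSpace.toDual_symm_apply, dualEmb_apply, hK₀,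
      ContinuousLinearMap.comp_apply, ContinuousLinearMap.adjoint_inner_left]
  rw [e1, Pi.sub_apply, e7, e4, e8, ← map_add, ← map_sub, LinearIsometryEquiv.norm_map]

end EvolutionExistence

/-! ### Existence for linear evolution equations by approximation -/

section EvolutionLimit

variable {X Y : Type*} [NormedAddCommGroup X] [InnerProductSpace ℝ X] [CompleteSpace X]
  [NormedAddCommGroup Y] [InnerProductSpace ℝ Y] [CompleteSpace Y]
  [TopologicalSpace.SeparableSpace X]
  {i : X →L[ℝ] Y} {T μ η : ℝ} {L : ℝ → X →L[ℝ] X →L[ℝ] ℝ}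

/-- The residual of `t ↦ x + ∫₀ᵗ g` in the evolution equation with right-hand side `q + f₂`. -/
def evolutionResidual (i : X →L[ℝ] Y) (L : ℝ → X →L[ℝ] X →L[ℝ] ℝ) (f₂ : ℝ → StrongDual ℝ X) (x : X)
    (q : ℝ → Y) (g : ℝ → X) (t : ℝ) : StrongDual ℝ X :=
  dualEmb i (i (g t)) + L t (x + ∫ s in (0 : ℝ)..t, g s) - (dualEmb i (q t) + f₂ t)

/-- The density result lives in `L²` with zero initial value. Therefore `f₁` is first replaced by a
continuous function, `y₀` by some `i x`, and the contribution `L t x` of the new initial value goes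
to the right-hand side. -/
theorem exists_approximate_solution (hi : DenseRange i) (hT : 0 < T) (hμ : 0 < μ)
    (hL : IsUniformForm T μ η L) {f₁ : ℝ → Y} {f₂ : ℝ → StrongDual ℝ X}
    (h₁ : MemLp f₁ 1 (timeMeasure T)) (h₂ : MemLp f₂ 2 (timeMeasure T)) (y₀ : Y) {ε : ℝ}
    (hε : 0 < ε) : ∃ (x : X) (q : ℝ → Y) (g : ℝ → X), ‖i x - y₀‖ ≤ ε ∧
      MemLp q 2 (timeMeasure T) ∧ ∫ t in (0 : ℝ)..T, ‖q t - f₁ t‖ ≤ ε ∧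
      MemLp g 2 (timeMeasure T) ∧ MemLp (evolutionResidual i L f₂ x q g) 2 (timeMeasure T) ∧
      ∫ t in (0 : ℝ)..T, ‖evolutionResidual i L f₂ x q g t‖ ^ 2 ≤ ε ^ 2 := by
  obtain ⟨x, hx⟩ := hi.exists_dist_lt y₀ hε
  obtain ⟨q, -, hq, hqc, -⟩ :=
    (memLp_one_iff_integrable.1 h₁).exists_hasCompactSupport_integral_sub_le hε
  have hq2 : MemLp q 2 (timeMeasure T) := memLp_timeMeasure_of_continuousOn hqc.continuousOn 2
  have hqf : MemLp (fun t => dualEmb i (q t)) 2 (timeMeasure T) :=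
    memLp_continuousLinearMap_apply (dualEmb i) hq2
  have hLx : MemLp (fun t => L t x) 2 (timeMeasure T) :=
    hL.memLp (u := fun _ => x) (memLp_const x)
  have hf : MemLp (fun t => f₂ t + dualEmb i (q t) - L t x) 2 (timeMeasure T) :=
    MemLp.sub (MemLp.add h₂ hqf) hLx
  obtain ⟨g, hg, hgε⟩ := exists_integral_residual_lt (i := i) hT hμ hL hf
    (by positivity : 0 < ε ^ 2)
  have hgi := memLp_two_integrable hg
  have hres : evolutionResidual i L f₂ x q g = fun t => dualEmb i (i (g t)) +
      L t (∫ s in (0 : ℝ)..t, g s) - (f₂ t + dualEmb i (q t) - L t x) := by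
    funext t
    simp only [evolutionResidual, map_add]
    abel
  refine ⟨x, q, g, ?_, hq2, ?_, hg, ?_, ?_⟩
  · rw [dist_comm, dist_eq_norm] at hx
    exact hx.le
  · rw [← integral_timeMeasure hT.le]
    simpa only [norm_sub_rev] using hq
  · rw [hres]
    have h3 : MemLp (fun t => dualEmb i (i (g t))) 2 (timeMeasure T) :=
      memLp_continuousLinearMap_apply (dualEmb i) (memLp_continuousLinearMap_apply i hg)
    have h4 : MemLp (fun t => L t (∫ s in (0 : ℝ)..t, g s)) 2 (timeMeasure T) :=
      hL.memLp (memLp_primitive hg)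
    exact MemLp.sub (MemLp.add h3 h4) hf
  · rw [hres]
    exact hgε.le

theorem norm_integral_le_timeMeasure {Z : Type*} [NormedAddCommGroup Z] [NormedSpace ℝ Z]
    (hT : 0 ≤ T) {f : ℝ → Z} (hf : Integrable f (timeMeasure T)) {t : ℝ} (ht : t ∈ Icc 0 T) :
    ‖∫ s in (0 : ℝ)..t, f s‖ ≤ ∫ s in (0 : ℝ)..T, ‖f s‖ :=
  norm_integral_le_of_mem ((integrable_timeMeasure_iff hT).1 hf) ht

theorem tendsto_integral_norm_of_sq {Z : Type*} [NormedAddCommGroup Z] [NormedSpace ℝ Z]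
    (hT : 0 < T) {f : ℕ → ℝ → Z} (hf : ∀ k, MemLp (f k) 2 (timeMeasure T))
    (h : Tendsto (fun k => ∫ t in (0 : ℝ)..T, ‖f k t‖ ^ 2) atTop (𝓝 0)) :
    Tendsto (fun k => ∫ t in (0 : ℝ)..T, ‖f k t‖) atTop (𝓝 0) := by
  have h1 : Tendsto (fun k => √(T * ∫ t in (0 : ℝ)..T, ‖f k t‖ ^ 2)) atTop (𝓝 0) := by
    have := (h.const_mul T).sqrt
    simpa using this
  refine squeeze_zero (fun k => intervalIntegral.integral_nonneg hT.le fun _ _ => norm_nonneg _)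
    (fun k => ?_) h1
  exact Real.le_sqrt_of_sq_le (sq_integral_norm_le hT (hf k))

/-- Lions' existence theorem for linear evolution equations. -/
theorem exists_isSol (hi : DenseRange i) (hT : 0 < T) (hμ : 0 < μ)
    (hL : IsUniformForm T μ η L) {f₁ : ℝ → Y} {f₂ : ℝ → StrongDual ℝ X}
    (h₁ : MemLp f₁ 1 (timeMeasure T)) (h₂ : MemLp f₂ 2 (timeMeasure T)) (y₀ : Y) :
    ∃ P u, IsSol i T L f₁ f₂ y₀ P u := by
  set δ : ℕ → ℝ := fun k => 1 / ((k : ℝ) + 1) with hδ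
  have hδ0 : ∀ k, 0 < δ k := fun k => by positivity
  have hδt : Tendsto δ atTop (𝓝 0) := tendsto_one_div_add_atTop_nhds_zero_nat
  have hδm : ∀ {n m}, n ≤ m → δ m ≤ δ n := fun {n m} h => by
    simp only [hδ]
    gcongr
  have H := fun k => exists_approximate_solution hi hT hμ hL h₁ h₂ y₀ (hδ0 k)
  choose x q g hx hq hqf hg hr hrb using H
  set r := fun k => evolutionResidual i L f₂ (x k) (q k) (g k) with hr'
  set v : ℕ → ℝ → X := fun k t => x k + ∫ s in (0 : ℝ)..t, g k s with hv
  have h0T : (0 : ℝ) ∈ Icc 0 T := ⟨le_rfl, hT.le⟩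
  have hTT : T ∈ Icc 0 T := ⟨hT.le, le_rfl⟩
  have hvm : ∀ k, MemLp (v k) 2 (timeMeasure T) := fun k =>
    (memLp_const (x k)).add (memLp_primitive (hg k))
  have hf₁i := memLp_one_iff_integrable.1 h₁
  -- In the energy estimate the initial values and the integrable data, each bounded by `2 δ`,
  -- contribute `2·4 + 4·4 = 24`; the remaining `16 / μ` more than covers the residuals.
  set c : ℝ := 4 * (6 + 4 / μ) with hc
  have hc0 : 0 ≤ c := by positivity
  -- By linearity a difference of two approximations solves the equation with small data, so the
  -- energy estimate gives the Cauchy property in both norms at once.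
  have key : ∀ n m N : ℕ, N ≤ n → N ≤ m → ∀ t ∈ Icc 0 T,
      ‖i (v n t - v m t)‖ ^ 2 + μ * ∫ s in (0 : ℝ)..t, ‖v n s - v m s‖ ^ 2 ≤ c * δ N ^ 2 := by
    intro n m N hn hm t ht
    have hvd : ∀ s ∈ Icc 0 T, v n s - v m s =
        (x n - x m) + ∫ r in (0 : ℝ)..s, (g n r - g m r) := by
      intro s hs
      simp only [hv]
      rw [intervalIntegral.integral_sub
        (integrable_intervalIntegrable (memLp_two_integrable (hg n)) h0T hs)
        (integrable_intervalIntegrable (memLp_two_integrable (hg m)) h0T hs)]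
      abel
    have hE := energy_bound (i := i) (x := x n - x m) hT.le hμ hL ((hg n).sub (hg m))
      (f₁ := fun t => q n t - q m t) (f₂ := fun t => r n t - r m t)
      (((hq n).sub (hq m)).mono_exponent (by norm_num)) ((hr n).sub (hr m)) (by
        filter_upwards [ae_timeMeasure_mem T] with s hs
        have e := hvd s hs
        simp only [Pi.sub_apply]
        rw [← e]
        simp only [hr', evolutionResidual, hv, map_sub, map_add]
        abel) ht
    simp only [Pi.sub_apply] at hE
    rw [← hvd t ht] at hE
    have e1 : ∫ s in (0 : ℝ)..t, ‖x n - x m + ∫ r in (0 : ℝ)..s, (g n r - g m r)‖ ^ 2 =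
        ∫ s in (0 : ℝ)..t, ‖v n s - v m s‖ ^ 2 := by
      refine intervalIntegral.integral_congr fun s hs => ?_
      rw [uIcc_of_le ht.1] at hs
      rw [hvd s ⟨hs.1, hs.2.trans ht.2⟩]
    rw [e1] at hE
    have hn' := hδm hn
    have hm' := hδm hm
    have b1 : ‖i (x n - x m)‖ ≤ 2 * δ N := by
      have e : i (x n - x m) = (i (x n) - y₀) - (i (x m) - y₀) := by rw [map_sub]; abel
      rw [e]
      refine (norm_sub_le _ _).trans ?_
      linarith [hx n, hx m]
    have b2 : ∫ s in (0 : ℝ)..T, ‖q n s - q m s‖ ≤ 2 * δ N := by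
      have iq : ∀ k, IntervalIntegrable (fun s => ‖q k s - f₁ s‖) volume 0 T := fun k =>
        (integrable_timeMeasure_iff hT.le).1 ((memLp_two_integrable (hq k)).sub hf₁i).norm
      have : ∫ s in (0 : ℝ)..T, ‖q n s - q m s‖ ≤
          ∫ s in (0 : ℝ)..T, (‖q n s - f₁ s‖ + ‖q m s - f₁ s‖) := by
        refine intervalIntegral.integral_mono_on hT.le ?_ ((iq n).add (iq m)) fun s _ => ?_
        · exact (integrable_timeMeasure_iff hT.le).1
            ((memLp_two_integrable (hq n)).sub (memLp_two_integrable (hq m))).norm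
        · have e : q n s - q m s = (q n s - f₁ s) - (q m s - f₁ s) := by abel
          rw [e]
          exact norm_sub_le _ _
      rw [intervalIntegral.integral_add (iq n) (iq m)] at this
      linarith [hqf n, hqf m]
    have b3 : ∫ s in (0 : ℝ)..T, ‖r n s - r m s‖ ^ 2 ≤ 4 * δ N ^ 2 := by
      have ir : ∀ k, IntervalIntegrable (fun s => 2 * ‖r k s‖ ^ 2) volume 0 T := fun k =>
        ((integrable_timeMeasure_iff hT.le).1 (memLp_two_integrable_sq (hr k))).const_mul 2
      have : ∫ s in (0 : ℝ)..T, ‖r n s - r m s‖ ^ 2 ≤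
          ∫ s in (0 : ℝ)..T, (2 * ‖r n s‖ ^ 2 + 2 * ‖r m s‖ ^ 2) := by
        refine intervalIntegral.integral_mono_on hT.le ?_ ((ir n).add (ir m)) fun s _ => ?_
        · exact (integrable_timeMeasure_iff hT.le).1
            (memLp_two_integrable_sq ((hr n).sub (hr m)))
        · have := norm_sub_le (r n s) (r m s)
          nlinarith [sq_nonneg (‖r n s‖ - ‖r m s‖), norm_nonneg (r n s - r m s)]
      rw [intervalIntegral.integral_add (ir n) (ir m), intervalIntegral.integral_const_mul,
        intervalIntegral.integral_const_mul] at this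
      have h5 := pow_le_pow_left₀ (hδ0 n).le hn' 2
      have h6 := pow_le_pow_left₀ (hδ0 m).le hm' 2
      linarith [hrb n, hrb m]
    have b2' : 0 ≤ ∫ s in (0 : ℝ)..T, ‖q n s - q m s‖ :=
      intervalIntegral.integral_nonneg hT.le fun _ _ => norm_nonneg _
    have b1'' := pow_le_pow_left₀ (norm_nonneg _) b1 2
    have b2'' := pow_le_pow_left₀ b2' b2 2
    have b3'' : 2 / μ * ∫ s in (0 : ℝ)..T, ‖r n s - r m s‖ ^ 2 ≤ 2 / μ * (4 * δ N ^ 2) := by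
      gcongr
    refine hE.trans ?_
    have e5 : c * δ N ^ 2 = 24 * δ N ^ 2 + 2 * (2 / μ * (4 * δ N ^ 2)) := by rw [hc]; ring
    have e6 : 0 ≤ 2 / μ * (4 * δ N ^ 2) := by positivity
    rw [e5]
    nlinarith
  have hnn : ∀ n m : ℕ, ∀ t ∈ Icc 0 T, 0 ≤ ∫ s in (0 : ℝ)..t, ‖v n s - v m s‖ ^ 2 :=
    fun n m t ht => intervalIntegral.integral_nonneg ht.1 fun _ _ => by positivity
  -- the limit in `L²(0, T; X)`
  have hbt : ∀ C : ℝ, Tendsto (fun N => √(C * δ N ^ 2)) atTop (𝓝 0) := fun C => by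
    simpa using ((hδt.pow 2).const_mul C).sqrt
  have hcau : CauchySeq fun k => (hvm k).toLp (v k) := by
    refine cauchySeq_of_le_tendsto_0 (fun N => √(c / μ * δ N ^ 2)) ?_ (hbt _)
    intro n m N hn hm
    refine Real.le_sqrt_of_sq_le ?_
    rw [dist_eq_norm, ← MemLp.toLp_sub, norm_toLp_sq hT.le]
    have h1 := key n m N hn hm T hTT
    have h2 : (c / μ) * δ N ^ 2 = (c * δ N ^ 2) / μ := by ring
    simp only [Pi.sub_apply]
    rw [h2, le_div_iff₀ hμ]
    nlinarith [sq_nonneg ‖i (v n T - v m T)‖]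
  obtain ⟨u, hu⟩ := cauchySeq_tendsto_of_complete hcau
  have hum := Lp.memLp u
  have hu2 : Tendsto (fun k => ∫ t in (0 : ℝ)..T, ‖v k t - u t‖ ^ 2) atTop (𝓝 0) := by
    have h1 : Tendsto (fun k => ‖(hvm k).toLp (v k) - u‖ ^ 2) atTop (𝓝 0) := by
      have := (tendsto_iff_norm_sub_tendsto_zero.1 hu).pow 2
      simpa using this
    refine h1.congr fun k => ?_
    have e : (hvm k).toLp (v k) - u = ((hvm k).sub hum).toLp _ := by
      rw [MemLp.toLp_sub (hvm k) hum, Lp.toLp_coeFn]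
    rw [e, norm_toLp_sq hT.le]
    rfl
  -- the limit in `C([0, T]; Y)`
  have hunif : UniformCauchySeqOn (fun k t => i (v k t)) atTop (Icc 0 T) := by
    rw [Metric.uniformCauchySeqOn_iff]
    intro ε hε
    obtain ⟨N, hN⟩ := ((hbt c).eventually_lt_const hε).exists
    refine ⟨N, fun m hm n hn t ht => lt_of_le_of_lt ?_ hN⟩
    refine Real.le_sqrt_of_sq_le ?_
    rw [dist_eq_norm, ← map_sub]
    have h1 := key m n N hm hn t ht
    have h2 := mul_nonneg hμ.le (hnn m n t ht)
    linarith
  have hpt : ∀ t, ∃ y, t ∈ Icc 0 T → Tendsto (fun k => i (v k t)) atTop (𝓝 y) := by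
    intro t
    by_cases ht : t ∈ Icc 0 T
    · obtain ⟨y, hy⟩ := cauchySeq_tendsto_of_complete (hunif.cauchySeq ht)
      exact ⟨y, fun _ => hy⟩
    · exact ⟨0, fun h => absurd h ht⟩
  choose P hP using hpt
  have hPu := hunif.tendstoUniformlyOn_of_tendsto fun t ht => hP t ht
  have hvc : ∀ k, ContinuousOn (v k) (Icc 0 T) := fun k =>
    continuousOn_const.add (continuousOn_primitive_timeMeasure (memLp_two_integrable (hg k)))
  refine ⟨P, u, hum, ?_, ?_, ?_, ?_⟩
  · exact hPu.continuousOn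
      (Eventually.of_forall fun k => i.continuous.comp_continuousOn (hvc k)).frequently
  -- The `L²` limit and the uniform limit are identified along a subsequence converging almost
  -- everywhere.
  · obtain ⟨ns, hns, hae⟩ := (tendstoInMeasure_of_tendsto_Lp hu).exists_seq_tendsto_ae
    have hae' := ae_all_iff.2 fun k => (hvm k).coeFn_toLp
    filter_upwards [hae, hae', ae_timeMeasure_mem T] with t h1 h2 h3
    have h4 : Tendsto (fun k => i (v (ns k) t)) atTop (𝓝 (i (u t))) := by
      refine (i.continuous.tendsto _).comp ?_
      refine h1.congr fun k => h2 _
    exact tendsto_nhds_unique h4 ((hP t h3).comp hns.tendsto_atTop)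
  · refine tendsto_nhds_unique (hP 0 h0T) ?_
    have : ∀ k, i (v k 0) = i (x k) := fun k => by simp [hv]
    simp only [this]
    exact tendsto_iff_norm_sub_tendsto_zero.2 (squeeze_zero (fun _ => norm_nonneg _) hx hδt)
  · intro t ht
    set F : ℝ → StrongDual ℝ X := fun s => dualEmb i (f₁ s) + f₂ s - L s (u s) with hF
    have hxk : Tendsto (fun k => dualEmb i (i (x k))) atTop (𝓝 (dualEmb i y₀)) :=
      ((dualEmb i).continuous.tendsto _).comp
        (tendsto_iff_norm_sub_tendsto_zero.2 (squeeze_zero (fun _ => norm_nonneg _) hx hδt))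
    have hFi : Integrable F (timeMeasure T) :=
      (((dualEmb i).integrable_comp hf₁i).add (memLp_two_integrable h₂)).sub
        (memLp_two_integrable (hL.memLp hum))
    have hgk : ∀ k, Integrable (fun s => dualEmb i (i (g k s))) (timeMeasure T) := fun k =>
      (dualEmb i).integrable_comp (i.integrable_comp (memLp_two_integrable (hg k)))
    -- The derivative `i g_k` differs from `F` by the error in `f₁`, the residual, and `L` applied
    -- to `v_k - u`; all three tend to zero in `L¹`.
    have hlim : Tendsto (fun k => ∫ s in (0 : ℝ)..t, dualEmb i (i (g k s))) atTop
        (𝓝 (∫ s in (0 : ℝ)..t, F s)) := by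
      rw [tendsto_iff_norm_sub_tendsto_zero]
      have t1 := tendsto_integral_norm_of_sq hT (fun k => (hvm k).sub hum) hu2
      have t2 : Tendsto (fun k => ∫ t in (0 : ℝ)..T, ‖r k t‖) atTop (𝓝 0) :=
        tendsto_integral_norm_of_sq hT hr (squeeze_zero
          (fun k => intervalIntegral.integral_nonneg hT.le fun _ _ => by positivity) hrb
          (by simpa using hδt.pow 2))
      have t3 : Tendsto (fun k => ‖dualEmb i‖ * δ k + (∫ t in (0 : ℝ)..T, ‖r k t‖)
          + |η| * ∫ t in (0 : ℝ)..T, ‖v k t - u t‖) atTop (𝓝 0) := by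
        have := ((hδt.const_mul ‖dualEmb i‖).add t2).add (t1.const_mul |η|)
        simpa using this
      refine squeeze_zero (fun _ => norm_nonneg _) (fun k => ?_) t3
      rw [← intervalIntegral.integral_sub (integrable_intervalIntegrable (hgk k) h0T ht)
        (integrable_intervalIntegrable hFi h0T ht)]
      refine (norm_integral_le_timeMeasure hT.le ((hgk k).sub hFi) ht).trans ?_
      have j1 : IntervalIntegrable (fun s => ‖dualEmb i‖ * ‖q k s - f₁ s‖) volume 0 T :=
        ((integrable_timeMeasure_iff hT.le).1
          ((memLp_two_integrable (hq k)).sub hf₁i).norm).const_mul _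
      have j2 : IntervalIntegrable (fun s => ‖r k s‖) volume 0 T :=
        (integrable_timeMeasure_iff hT.le).1 (memLp_two_integrable (hr k)).norm
      have j3 : IntervalIntegrable (fun s => |η| * ‖v k s - u s‖) volume 0 T :=
        ((integrable_timeMeasure_iff hT.le).1
          (memLp_two_integrable ((hvm k).sub hum)).norm).const_mul _
      have hle : ∫ s in (0 : ℝ)..T, ‖dualEmb i (i (g k s)) - F s‖ ≤
          ∫ s in (0 : ℝ)..T, (‖dualEmb i‖ * ‖q k s - f₁ s‖ + ‖r k s‖
            + |η| * ‖v k s - u s‖) := by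
        refine intervalIntegral.integral_mono_on hT.le
          ((integrable_timeMeasure_iff hT.le).1 ((hgk k).sub hFi).norm) ((j1.add j2).add j3)
          fun s hs => ?_
        have e : dualEmb i (i (g k s)) - F s =
            dualEmb i (q k s - f₁ s) + r k s - L s (v k s - u s) := by
          simp only [hF, hr', evolutionResidual, hv, map_sub]
          abel
        rw [e]
        refine (norm_sub_le _ _).trans (add_le_add ((norm_add_le _ _).trans ?_) ?_)
        · gcongr
          exact (dualEmb i).le_opNorm _
        · exact hL.norm_le hs _
      refine hle.trans ?_
      rw [intervalIntegral.integral_add (j1.add j2) j3, intervalIntegral.integral_add j1 j2,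
        intervalIntegral.integral_const_mul, intervalIntegral.integral_const_mul]
      gcongr
      exact hqf k
    have hlhs : Tendsto (fun k => dualEmb i (i (v k t))) atTop (𝓝 (dualEmb i (P t))) :=
      ((dualEmb i).continuous.tendsto _).comp (hP t ht)
    refine tendsto_nhds_unique hlhs ((hxk.add hlim).congr fun k => ?_)
    simp only [hv]
    rw [map_add, map_add, ← i.intervalIntegral_comp_comm
        (integrable_intervalIntegrable (memLp_two_integrable (hg k)) h0T ht),
      ← (dualEmb i).intervalIntegral_comp_comm (integrable_intervalIntegrable
        (i.integrable_comp (memLp_two_integrable (hg k))) h0T ht)]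

end EvolutionLimit

/-! ### The backward Euler scheme and the cell means of an exact solution -/

section EulerEstimate

variable {X Y : Type*} [NormedAddCommGroup X] [InnerProductSpace ℝ X] [CompleteSpace X]
  [NormedAddCommGroup Y] [InnerProductSpace ℝ Y] [CompleteSpace Y]

-- Discrete counterpart of `energy_bound`: `r₁` is paired with the largest `‖d k‖`, and `r₂` is
-- absorbed by half of the coercive term. In the application `d (n + 1) = i (e n)`, whence the shift
-- of indices.
omit [InnerProductSpace ℝ X] [CompleteSpace X] [CompleteSpace Y] in
theorem discrete_energy_bound {N : ℕ} {τ c : ℝ} (hτ : 0 < τ) (hc : 0 < c) {d : ℕ → Y} {e : ℕ → X}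
    {r₁ r₂ : ℕ → ℝ} (h0 : d 0 = 0) (hr₁ : ∀ n, 0 ≤ r₁ n)
    (h : ∀ n < N, inner ℝ (d (n + 1) - d n) (d (n + 1)) + c * τ * ‖e n‖ ^ 2
      ≤ τ * r₁ n * ‖d (n + 1)‖ + τ * r₂ n * ‖e n‖) {n : ℕ} (hn : n ≤ N) :
    ‖d n‖ ^ 2 + c * (τ * ∑ k ∈ Finset.range n, ‖e k‖ ^ 2) ≤
      4 * (∑ k ∈ Finset.range N, τ * r₁ k) ^ 2
        + 2 / c * ∑ k ∈ Finset.range N, τ * r₂ k ^ 2 := by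
  obtain ⟨m, hm, hmax⟩ := Finset.exists_max_image (Finset.range (N + 1)) (fun k => ‖d k‖)
    ⟨0, by simp⟩
  set M := ‖d m‖ with hM
  set S₁ := ∑ k ∈ Finset.range N, τ * r₁ k with hS₁
  set S₂ := ∑ k ∈ Finset.range N, τ * r₂ k ^ 2 with hS₂
  have hM' : ∀ k ≤ N, ‖d k‖ ≤ M := fun k hk => hmax k (by simp; omega)
  have step : ∀ k < N, ‖d (k + 1)‖ ^ 2 - ‖d k‖ ^ 2 + c * (τ * ‖e k‖ ^ 2) ≤
      2 * M * (τ * r₁ k) + c⁻¹ * (τ * r₂ k ^ 2) := by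
    intro k hk
    have h1 := h k hk
    -- Here implicitness matters: with the difference tested by the new value, the defect `‖d (k +
    -- 1) - d k‖² / 2` has the favourable sign.
    have h2 : ‖d (k + 1)‖ ^ 2 / 2 - ‖d k‖ ^ 2 / 2 ≤ inner ℝ (d (k + 1) - d k) (d (k + 1)) := by
      rw [inner_sub_left, real_inner_self_eq_norm_sq]
      have := real_inner_le_norm (d k) (d (k + 1))
      nlinarith [sq_nonneg (‖d k‖ - ‖d (k + 1)‖)]
    have h3 : τ * r₁ k * ‖d (k + 1)‖ ≤ τ * r₁ k * M :=
      mul_le_mul_of_nonneg_left (hM' _ hk) (mul_nonneg hτ.le (hr₁ k))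
    have h4 : τ * r₂ k * ‖e k‖ ≤ c⁻¹ * (τ * r₂ k ^ 2) / 2 + c * (τ * ‖e k‖ ^ 2) / 2 := by
      have h5 : 0 ≤ c⁻¹ * τ * (r₂ k - c * ‖e k‖) ^ 2 := by positivity
      have h6 : c⁻¹ * τ * (r₂ k - c * ‖e k‖) ^ 2 =
          c⁻¹ * (τ * r₂ k ^ 2) + c * (τ * ‖e k‖ ^ 2) - 2 * (τ * r₂ k * ‖e k‖) := by
        field_simp
        ring
      linarith
    linarith
  have key : ∀ k ≤ N, ‖d k‖ ^ 2 + c * (τ * ∑ l ∈ Finset.range k, ‖e l‖ ^ 2) ≤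
      2 * M * S₁ + c⁻¹ * S₂ := by
    intro k hk
    have h1 : ‖d k‖ ^ 2 + c * (τ * ∑ l ∈ Finset.range k, ‖e l‖ ^ 2) ≤
        2 * M * (∑ l ∈ Finset.range k, τ * r₁ l)
          + c⁻¹ * ∑ l ∈ Finset.range k, τ * r₂ l ^ 2 := by
      induction k with
      | zero => simp [h0]
      | succ k ih =>
        have := ih (by omega)
        have := step k (by omega)
        rw [Finset.sum_range_succ, Finset.sum_range_succ, Finset.sum_range_succ]
        linarith
    have hsub : Finset.range k ⊆ Finset.range N := Finset.range_subset_range.2 hk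
    have h2 : ∑ l ∈ Finset.range k, τ * r₁ l ≤ S₁ :=
      Finset.sum_le_sum_of_subset_of_nonneg hsub fun l _ _ => mul_nonneg hτ.le (hr₁ l)
    have h3 : ∑ l ∈ Finset.range k, τ * r₂ l ^ 2 ≤ S₂ :=
      Finset.sum_le_sum_of_subset_of_nonneg hsub fun l _ _ => by positivity
    refine h1.trans ?_
    have hM0 : 0 ≤ M := norm_nonneg _
    gcongr
  have hmN : m ≤ N := by simpa [Nat.lt_succ_iff] using hm
  have k1 := key m hmN
  have k2 := key n hn
  have k3 : 0 ≤ c * (τ * ∑ l ∈ Finset.range m, ‖e l‖ ^ 2) := by positivity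
  have k4 : 2 / c * S₂ = 2 * (c⁻¹ * S₂) := by ring
  rw [k4]
  rw [← hM] at k1
  nlinarith [sq_nonneg (M - 2 * S₁)]

/-- The node values `y₀, i (p 0), i (p 1), …`. -/
def nodes (i : X →L[ℝ] Y) (y₀ : Y) (p : ℕ → X) : ℕ → Y
  | 0 => y₀
  | n + 1 => i (p n)

/-- `p` solves the backward Euler scheme for `P' + L P + G(P) = f₁ + f₂`, `P(0) = y₀` with `N`
steps, and its values lie in `K`. -/
structure IsEuler (i : X →L[ℝ] Y) (T : ℝ) (L : ℝ → X →L[ℝ] X →L[ℝ] ℝ) (G : Y → Y) (f₁ : ℝ → Y)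
    (f₂ : ℝ → StrongDual ℝ X) (y₀ : Y) (K : Set Y) (N : ℕ) (p : ℕ → X) : Prop where
  mem : ∀ n < N, i (p n) ∈ K
  equation : ∀ n < N, (T / N)⁻¹ • dualEmb i (nodes i y₀ p (n + 1) - nodes i y₀ p n)
      + cellAvg (T / N) n (fun s => (L s (p n) : StrongDual ℝ X)) + dualEmb i (G (i (p n)))
      = cellAvg (T / N) n fun s => dualEmb i (f₁ s) + f₂ s

theorem cellAvg_congr {Z : Type*} [NormedAddCommGroup Z] [NormedSpace ℝ Z] {f g : ℝ → Z} {τ : ℝ}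
    {n : ℕ} (hτ : 0 ≤ τ) (h : ∀ t ∈ Ioc (n * τ) ((n + 1) * τ), f t = g t) :
    cellAvg τ n f = cellAvg τ n g := by
  rw [cellAvg, cellAvg]
  congr 1
  refine intervalIntegral.integral_congr_ae (Eventually.of_forall fun t ht => h t ?_)
  rwa [uIoc_of_le (by nlinarith)] at ht

theorem cellAvg_const {Z : Type*} [NormedAddCommGroup Z] [NormedSpace ℝ Z] [CompleteSpace Z]
    {τ : ℝ} (hτ : 0 < τ) (n : ℕ) (z : Z) : cellAvg τ n (fun _ => z) = z := by
  rw [cellAvg, intervalIntegral.integral_const, smul_smul,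
    show τ⁻¹ * ((n + 1) * τ - n * τ) = 1 by field_simp; ring, one_smul]

theorem _root_.ContinuousLinearMap.cellAvg_comp {Z W : Type*} [NormedAddCommGroup Z]
    [NormedSpace ℝ Z] [CompleteSpace Z] [NormedAddCommGroup W] [NormedSpace ℝ W] [CompleteSpace W]
    (A : Z →L[ℝ] W) {g : ℝ → Z} {τ : ℝ} {n : ℕ}
    (hg : IntervalIntegrable g volume (n * τ) ((n + 1) * τ)) :
    cellAvg τ n (fun t => A (g t)) = A (cellAvg τ n g) := by
  rw [cellAvg, cellAvg, A.intervalIntegral_comp_comm hg, map_smul]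

theorem cellAvg_shift {Z : Type*} [NormedAddCommGroup Z] [NormedSpace ℝ Z] (g : ℝ → Z) (τ : ℝ)
    (n : ℕ) : cellAvg τ (n + 1) (fun t => g (t - τ)) = cellAvg τ n g := by
  rw [cellAvg, cellAvg, intervalIntegral.integral_comp_sub_right]
  congr 2 <;> push_cast <;> ring

theorem integrable_indicator_of_timeMeasure {Z : Type*} [NormedAddCommGroup Z] {T : ℝ} {f : ℝ → Z}
    (h : Integrable f (timeMeasure T)) : Integrable ((Icc 0 T).indicator f) volume :=
  (integrable_indicator_iff measurableSet_Icc).2 h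

theorem memLp_indicator_of_timeMeasure {Z : Type*} [NormedAddCommGroup Z] {T : ℝ} {f : ℝ → Z}
    {p : ℝ≥0∞} (h : MemLp f p (timeMeasure T)) : MemLp ((Icc 0 T).indicator f) p volume :=
  (memLp_indicator_iff_restrict measurableSet_Icc).2 h

theorem cellShift_add_cellAvg {Z : Type*} [NormedAddCommGroup Z] [NormedSpace ℝ Z] {g : ℝ → Z}
    (hg : ∀ a b, IntervalIntegrable g volume a b) {τ : ℝ} {n : ℕ} :
    cellShift τ n g + cellAvg τ n g = cellAvg τ n fun t => τ⁻¹ • ∫ s in (t - τ)..t, g s := by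
  rw [cellShift, cellAvg_sub ((continuous_steklov hg τ).intervalIntegrable _ _) (hg _ _),
    sub_add_cancel]

theorem cell_mem {T : ℝ} (hT : 0 < T) {N n : ℕ} (hn : n < N) :
    (n * (T / N) : ℝ) ∈ Icc 0 T ∧ ((n + 1) * (T / N) : ℝ) ∈ Icc 0 T := by
  have hN : (0 : ℝ) < N := by exact_mod_cast (by omega : 0 < N)
  have h1 : ((n : ℝ) + 1) ≤ N := by exact_mod_cast hn
  have h2 : (N : ℝ) * (T / N) = T := by field_simp
  have hτ : 0 < T / N := by positivity
  refine ⟨⟨by positivity, ?_⟩, ⟨by positivity, ?_⟩⟩ <;> nlinarith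

theorem cell_subset {T : ℝ} (hT : 0 < T) {N n : ℕ} (hn : n < N) :
    Icc (n * (T / N)) ((n + 1) * (T / N)) ⊆ Icc 0 T :=
  Icc_subset_Icc (cell_mem hT hn).1.1 (cell_mem hT hn).2.2

/-- The mean value of the time derivative of a solution over the cells of the grid. -/
theorem IsSol.cell_identity {i : X →L[ℝ] Y} {T : ℝ} {L : ℝ → X →L[ℝ] X →L[ℝ] ℝ} {f₁ : ℝ → Y}
    {f₂ : ℝ → StrongDual ℝ X} {y₀ : Y} {P : ℝ → Y} {u : ℝ → X} (hT : 0 < T)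
    (hs : IsSol i T L f₁ f₂ y₀ P u) (h₁ : Integrable f₁ (timeMeasure T))
    (h₂ : Integrable (fun s => f₂ s - L s (u s)) (timeMeasure T)) {N n : ℕ} (hn : n < N) :
    (T / N)⁻¹ • dualEmb i (nodes i y₀ (fun k => cellAvg (T / N) k u) (n + 1)
        - nodes i y₀ (fun k => cellAvg (T / N) k u) n)
      = dualEmb i (cellShift (T / N) n ((Icc 0 T).indicator f₁) + cellAvg (T / N) n f₁)
        + (cellShift (T / N) n ((Icc 0 T).indicator fun s => f₂ s - L s (u s))
          + cellAvg (T / N) n fun s => f₂ s - L s (u s)) := by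
  have hN : (0 : ℝ) < N := by exact_mod_cast (by omega : 0 < N)
  set τ := T / N with hτd
  have hτ : 0 < τ := by positivity
  have h0T : (0 : ℝ) ∈ Icc 0 T := ⟨le_rfl, hT.le⟩
  -- The data are continued by zero and `P` by its initial value, written `P (max t 0)`. The
  -- integrated equation then persists for `t < 0`, and the first cell needs no separate treatment.
  set g₁ := (Icc 0 T).indicator f₁ with hg₁
  set g₂ := (Icc 0 T).indicator fun s => f₂ s - L s (u s) with hg₂
  have ig₁ : Integrable g₁ volume := integrable_indicator_of_timeMeasure h₁
  have ig₂ : Integrable g₂ volume := integrable_indicator_of_timeMeasure h₂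
  set D := dualEmb i with hD
  have iDg₁ : Integrable (fun s => D (g₁ s)) volume := D.integrable_comp ig₁
  have iG : Integrable (fun s => D (g₁ s) + g₂ s) volume := by
    exact Integrable.add (f := fun s => D (g₁ s)) (g := g₂) iDg₁ ig₂
  have hcs := cell_subset hT hn
  have hcm := cell_mem hT hn
  have hle : (n : ℝ) * τ ≤ (n + 1) * τ := by nlinarith
  -- the primitive of `g₁ + g₂`
  have hprim : ∀ t ≤ T, D (P (max t 0)) = D y₀ + ∫ s in (0 : ℝ)..t, (D (g₁ s) + g₂ s) := by
    intro t ht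
    rcases le_total 0 t with h | h
    · rw [max_eq_left h, hs.equation t ⟨h, ht⟩]
      congr 1
      refine intervalIntegral.integral_congr fun s hs' => ?_
      rw [uIcc_of_le h] at hs'
      have hm : s ∈ Icc 0 T := ⟨hs'.1, hs'.2.trans ht⟩
      simp only [hg₁, hg₂, indicator_of_mem hm]
      abel
    · rw [max_eq_right h, hs.initial]
      have : ∫ s in (0 : ℝ)..t, (D (g₁ s) + g₂ s) = 0 := by
        rw [intervalIntegral.integral_symm]
        have e : ∫ s in t..(0 : ℝ), (D (g₁ s) + g₂ s) = ∫ s in t..(0 : ℝ), 0 := by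
          refine intervalIntegral.integral_congr_ae ?_
          -- The indicators need not vanish at the endpoint `0` itself.
          have h0 : ∀ᵐ s : ℝ, s ≠ 0 := by simp [ae_iff, measure_singleton]
          filter_upwards [h0] with s hs0 hsm
          rw [uIoc_of_le h] at hsm
          have hm : s ∉ Icc 0 T := fun hm => hs0 (le_antisymm hsm.2 hm.1)
          simp only [hg₁, hg₂, indicator_of_notMem hm, map_zero, add_zero]
        rw [e]
        simp
      rw [this, add_zero]
  have hdiff : ∀ t ≤ T, ∫ s in (t - τ)..t, (D (g₁ s) + g₂ s) =
      D (P (max t 0)) - D (P (max (t - τ) 0)) := by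
    intro t ht
    rw [hprim t ht, hprim (t - τ) (by linarith), add_sub_add_left_eq_sub,
      intervalIntegral.integral_interval_sub_left iG.intervalIntegrable iG.intervalIntegrable]
  -- continuity of the two shifted copies of `P`
  have hPc : ContinuousOn P (Icc 0 T) := hs.continuousOn
  have c₁ : IntervalIntegrable (fun t => D (P (max t 0))) volume (n * τ) ((n + 1) * τ) := by
    refine (ContinuousOn.intervalIntegrable ?_)
    rw [uIcc_of_le hle]
    refine D.continuous.comp_continuousOn (hPc.comp (by fun_prop) fun t ht => ?_)
    exact ⟨le_max_right _ _, max_le (hcs ht).2 hT.le⟩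
  have c₂ : IntervalIntegrable (fun t => D (P (max (t - τ) 0))) volume (n * τ) ((n + 1) * τ) := by
    refine (ContinuousOn.intervalIntegrable ?_)
    rw [uIcc_of_le hle]
    refine D.continuous.comp_continuousOn (hPc.comp (by fun_prop) fun t ht => ?_)
    exact ⟨le_max_right _ _, max_le (by linarith [(hcs ht).2]) hT.le⟩
  have iu := memLp_two_integrable hs.memLp
  have hw : ∀ k < N, D (i (cellAvg τ k u)) = cellAvg τ k fun t => D (P (max t 0)) := by
    intro k hk
    have hkm := cell_mem hT hk
    have iuk := integrable_intervalIntegrable iu hkm.1 hkm.2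
    have iuk' := integrable_intervalIntegrable (i.integrable_comp iu) hkm.1 hkm.2
    rw [← i.cellAvg_comp iuk, ← D.cellAvg_comp iuk', cellAvg, cellAvg]
    congr 1
    refine integral_congr_of_ae_timeMeasure ?_ hkm.1 hkm.2
    filter_upwards [hs.ae_eq, ae_timeMeasure_mem T] with t ht htm
    rw [ht, max_eq_left htm.1]
  -- The preceding node is the mean of `P` shifted by one step. On the first cell the shifted
  -- argument is nonpositive, so this mean is exactly `y₀` and the comparison starts without initial
  -- error.
  have hW : D (nodes i y₀ (fun k => cellAvg τ k u) n) =
      cellAvg τ n fun t => D (P (max (t - τ) 0)) := by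
    cases n with
    | zero =>
      rw [nodes, ← cellAvg_const hτ 0 (D y₀)]
      refine cellAvg_congr hτ.le fun t ht => ?_
      have : t - τ ≤ 0 := by
        have := ht.2
        push_cast at this
        linarith
      rw [max_eq_right this, hs.initial]
    | succ m =>
      rw [nodes, hw m (by omega)]
      exact (cellAvg_shift (fun t => D (P (max t 0))) τ m).symm
  have hL : D (nodes i y₀ (fun k => cellAvg τ k u) (n + 1)
        - nodes i y₀ (fun k => cellAvg τ k u) n) =
      cellAvg τ n fun t => D (P (max t 0)) - D (P (max (t - τ) 0)) := by
    rw [map_sub, cellAvg_sub c₁ c₂, ← hW, nodes, hw n hn]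
  have avg₁ : cellAvg τ n f₁ = cellAvg τ n g₁ := cellAvg_congr hτ.le fun t ht => by
    rw [hg₁, indicator_of_mem (hcs (Ioc_subset_Icc_self ht))]
  have avg₂ : (cellAvg τ n fun s => f₂ s - L s (u s)) = cellAvg τ n g₂ :=
    cellAvg_congr hτ.le fun t ht => by
      rw [hg₂, indicator_of_mem (hcs (Ioc_subset_Icc_self ht))]
  rw [hL, avg₁, avg₂, cellShift_add_cellAvg (fun a b => ig₁.intervalIntegrable),
    cellShift_add_cellAvg (fun a b => ig₂.intervalIntegrable), ← D.cellAvg_comp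
    ((continuous_steklov (fun a b => ig₁.intervalIntegrable) τ).intervalIntegrable _ _), ←
        cellAvg_add]
  · rw [cellAvg, cellAvg, ← smul_assoc, smul_eq_mul, mul_smul, ← intervalIntegral.integral_smul]
    congr 1
    refine intervalIntegral.integral_congr_ae (Eventually.of_forall fun t ht => ?_)
    rw [uIoc_of_le hle] at ht
    rw [← hdiff t (hcs (Ioc_subset_Icc_self ht)).2, intervalIntegral.integral_add
        iDg₁.intervalIntegrable
      ig₂.intervalIntegrable, smul_add, map_smul, D.intervalIntegral_comp_comm
          ig₁.intervalIntegrable]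
  · exact (D.continuous.comp (continuous_steklov (fun a b => ig₁.intervalIntegrable)
      τ)).intervalIntegrable _ _
  · exact (continuous_steklov (fun a b => ig₂.intervalIntegrable) τ).intervalIntegrable _ _

end EulerEstimate

/-! ### The error equation -/

section EulerConvergence

variable {X Y : Type*} [NormedAddCommGroup X] [InnerProductSpace ℝ X] [CompleteSpace X]
  [NormedAddCommGroup Y] [InnerProductSpace ℝ Y] [CompleteSpace Y]
  [TopologicalSpace.SeparableSpace X]
  {i : X →L[ℝ] Y} {T μ η : ℝ} {L : ℝ → X →L[ℝ] X →L[ℝ] ℝ}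
  {G : Y → Y} {f₁ : ℝ → Y} {f₂ : ℝ → StrongDual ℝ X} {y₀ : Y} {K : Set Y} {P : ℝ → Y} {u : ℝ → X}

theorem le_cellAvg {f : ℝ → ℝ} {τ m : ℝ} (hτ : 0 < τ) {n : ℕ}
    (hf : IntervalIntegrable f volume (n * τ) ((n + 1) * τ))
    (h : ∀ t ∈ Icc (n * τ) ((n + 1) * τ), m ≤ f t) : m ≤ cellAvg τ n f := by
  have hle : (n : ℝ) * τ ≤ (n + 1) * τ := by nlinarith
  rw [← cellAvg_const hτ n m, cellAvg, cellAvg, smul_eq_mul, smul_eq_mul]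
  gcongr
  exact intervalIntegral.integral_mono_on hle intervalIntegrable_const hf h

theorem cellAvg_mem_of_ae {T : ℝ} (hT : 0 < T) {N n : ℕ} (hn : n < N) (hK : Convex ℝ K)
    (hKc : IsClosed K) (hP : Integrable P (timeMeasure T)) (h : ∀ᵐ t ∂timeMeasure T, P t ∈ K) :
    cellAvg (T / N) n P ∈ K := by
  have hN : (0 : ℝ) < N := by exact_mod_cast (by omega : 0 < N)
  have hτ : 0 < T / N := by positivity
  have hcm := cell_mem hT hn
  have hlt : (n : ℝ) * (T / N) < (n + 1) * (T / N) := by nlinarith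
  have e : cellAvg (T / N) n P = ⨍ t in Ioc (n * (T / N)) ((n + 1) * (T / N)), P t := by
    rw [← uIoc_of_le hlt.le, interval_average_eq, cellAvg]
    congr 2
    ring
  rw [e]
  refine hK.set_average_mem hKc ?_ ?_ ?_ (integrable_intervalIntegrable hP hcm.1 hcm.2).1
  · simp [hlt]
  · simp
  · exact ae_restrict_of_ae_restrict_of_subset
      (Ioc_subset_Icc_self.trans (cell_subset hT hn)) h

/-- Local Lipschitz continuity, uniform on balls. -/
def LipschitzOnBalls (G : Y → Y) : Prop :=
  ∀ M : ℝ, ∃ ℓ, 0 ≤ ℓ ∧ ∀ y z, ‖y‖ ≤ M → ‖z‖ ≤ M → ‖G y - G z‖ ≤ ℓ * ‖y - z‖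

omit [InnerProductSpace ℝ Y] [CompleteSpace Y] in
theorem LipschitzOnBalls.continuous (hG : LipschitzOnBalls G) : Continuous G := by
  rw [continuous_iff_continuousAt]
  intro y
  obtain ⟨ℓ, -, h⟩ := hG (‖y‖ + 1)
  rw [ContinuousAt, tendsto_iff_norm_sub_tendsto_zero]
  have h1 : Tendsto (fun z => ℓ * ‖z - y‖) (𝓝 y) (𝓝 0) := by
    have : Continuous fun z => ℓ * ‖z - y‖ := by fun_prop
    simpa using this.tendsto y
  refine squeeze_zero' (Eventually.of_forall fun _ => norm_nonneg _) ?_ h1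
  filter_upwards [Metric.ball_mem_nhds y one_pos] with z hz
  refine h z y ?_ (by linarith)
  rw [Metric.mem_ball, dist_eq_norm] at hz
  have := norm_le_insert' z y
  linarith

/-- One step of the error equation for the difference between a solution of the Euler scheme and
the cell means of an exact solution. -/
theorem euler_error_step (hT : 0 < T) (hL : IsUniformForm T μ η L)
    (hf₁ : MemLp f₁ 1 (timeMeasure T)) (hf₂ : MemLp f₂ 2 (timeMeasure T)) (hG : LipschitzOnBalls G)
    {c c' : ℝ} (hc : ∀ x, c * ‖i x‖ ^ 2 ≤ c' * ‖x‖ ^ 2)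
    (hmono : ∀ y ∈ K, ∀ z ∈ K, -c * ‖y - z‖ ^ 2 ≤ inner ℝ (G y - G z) (y - z))
    (hK : Convex ℝ K) (hKc : IsClosed K) (hPK : ∀ t ∈ Icc 0 T, P t ∈ K)
    (hs : IsSol i T L (fun s => f₁ s - G (P s)) f₂ y₀ P u) {N : ℕ} {p : ℕ → X}
    (hp : IsEuler i T L G f₁ f₂ y₀ K N p) {n : ℕ} (hn : n < N) :
    let w := fun k => cellAvg (T / N) k u
    let d := fun k => nodes i y₀ p k - nodes i y₀ w k
    inner ℝ (d (n + 1) - d n) (d (n + 1)) + (μ - c') * (T / N) * ‖p n - w n‖ ^ 2 ≤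
      T / N * (‖cellShift (T / N) n ((Icc 0 T).indicator fun s => f₁ s - G (P s))‖
        + ‖cellAvg (T / N) n fun s => G (i (w n)) - G (P s)‖) * ‖d (n + 1)‖
      + T / N * (‖cellShift (T / N) n ((Icc 0 T).indicator fun s => f₂ s - L s (u s))‖
        + ‖cellAvg (T / N) n fun s => (L s (w n - u s) : StrongDual ℝ X)‖) * ‖p n - w n‖ := by
  intro w d
  have hN : (0 : ℝ) < N := by exact_mod_cast (by omega : 0 < N)
  set τ := T / N with hτd
  have hτ : 0 < τ := by positivity
  have hcm := cell_mem hT hn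
  have hcs := cell_subset hT hn
  set e := p n - w n with he
  have hGP : ContinuousOn (fun s => G (P s)) (Icc 0 T) :=
    hG.continuous.comp_continuousOn hs.continuousOn
  have iGP : Integrable (fun s => G (P s)) (timeMeasure T) :=
    memLp_one_iff_integrable.1 (memLp_timeMeasure_of_continuousOn hGP 1)
  have if₁ : Integrable f₁ (timeMeasure T) := memLp_one_iff_integrable.1 hf₁
  have if₂ : Integrable f₂ (timeMeasure T) := memLp_two_integrable hf₂
  have iL : ∀ v : ℝ → X, MemLp v 2 (timeMeasure T) →
      Integrable (fun s => (L s (v s) : StrongDual ℝ X)) (timeMeasure T) :=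
    fun v hv => memLp_two_integrable (hL.memLp hv)
  have iLc : ∀ x : X, IntervalIntegrable (fun s => (L s x : StrongDual ℝ X)) volume
      (n * τ) ((n + 1) * τ) := fun x =>
    integrable_intervalIntegrable (iL (fun _ => x) (memLp_const x)) hcm.1 hcm.2
  have iLu : IntervalIntegrable (fun s => (L s (u s) : StrongDual ℝ X)) volume
      (n * τ) ((n + 1) * τ) :=
    integrable_intervalIntegrable (iL u hs.memLp) hcm.1 hcm.2
  have if₁c := integrable_intervalIntegrable if₁ hcm.1 hcm.2
  have if₂c := integrable_intervalIntegrable if₂ hcm.1 hcm.2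
  have iGPc := integrable_intervalIntegrable iGP hcm.1 hcm.2
  have h₂ : Integrable (fun s => f₂ s - L s (u s)) (timeMeasure T) := by
    exact Integrable.sub if₂ (iL u hs.memLp)
  have hcell := hs.cell_identity hT (if₁.sub iGP) h₂ hn
  have heul := hp.equation n hn
  set S₁ := cellShift τ n ((Icc 0 T).indicator fun s => f₁ s - G (P s)) with hS₁
  set S₂ := cellShift τ n ((Icc 0 T).indicator fun s => f₂ s - L s (u s)) with hS₂
  set A₁ := cellAvg τ n fun s => G (i (w n)) - G (P s) with hA₁
  set A₂ : StrongDual ℝ X := cellAvg τ n fun s => L s (w n - u s) with hA₂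
  -- decomposition of the averages
  have q1 : (cellAvg τ n fun s => dualEmb i (f₁ s) + f₂ s) =
      dualEmb i (cellAvg τ n f₁) + cellAvg τ n f₂ := by
    rw [cellAvg_add (integrable_intervalIntegrable ((dualEmb i).integrable_comp if₁) hcm.1 hcm.2)
      if₂c, (dualEmb i).cellAvg_comp if₁c]
  -- The nonlinearity at the cell mean `w n` replaces the mean of `G (P s)`, at the cost of the
  -- error `A₁`; in the next identities `A₂` plays this role for `L`.
  have q2 : (cellAvg τ n fun s => f₁ s - G (P s)) =
      cellAvg τ n f₁ - (G (i (w n)) - A₁) := by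
    rw [hA₁, cellAvg_sub intervalIntegrable_const iGPc, cellAvg_const hτ, sub_sub_cancel,
      cellAvg_sub if₁c iGPc]
  have q3 : (cellAvg τ n fun s => f₂ s - L s (u s)) =
      cellAvg τ n f₂ - cellAvg τ n fun s => (L s (u s) : StrongDual ℝ X) :=
    cellAvg_sub if₂c iLu
  have q4 : (cellAvg τ n fun s => (L s (p n) : StrongDual ℝ X)) =
      (cellAvg τ n fun s => (L s e : StrongDual ℝ X)) + A₂
        + cellAvg τ n fun s => (L s (u s) : StrongDual ℝ X) := by
    have iwu : IntervalIntegrable (fun s => (L s (w n - u s) : StrongDual ℝ X)) volume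
        (n * τ) ((n + 1) * τ) :=
      integrable_intervalIntegrable (iL (fun s => w n - u s)
        (MemLp.sub (memLp_const (w n)) hs.memLp)) hcm.1 hcm.2
    rw [hA₂, ← cellAvg_add (iLc e) iwu, ← cellAvg_add ((iLc e).add iwu) iLu]
    congr 1
    funext s
    rw [← map_add, ← map_add, he]
    congr 1
    abel
  have hd1 : d (n + 1) = i e := by
    change i (p n) - i (w n) = i e
    rw [he, map_sub]
  have hdd : dualEmb i (d (n + 1) - d n) =
      dualEmb i (nodes i y₀ p (n + 1) - nodes i y₀ p n)
        - dualEmb i (nodes i y₀ w (n + 1) - nodes i y₀ w n) := by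
    rw [← map_sub]
    congr 1
    simp only [d]
    abel
  -- Difference of the scheme and the cell identity: the source terms cancel, and only the shift
  -- errors `S₁`, `S₂` and the averaging errors `A₁`, `A₂` are left.
  have hmain : τ⁻¹ • dualEmb i (d (n + 1) - d n) + cellAvg τ n (fun s => (L s e : StrongDual ℝ X))
      + dualEmb i (G (i (p n)) - G (i (w n))) = -(dualEmb i (S₁ + A₁)) - (S₂ + A₂) := by
    rw [hdd, smul_sub, hcell, q2, q3]
    rw [q1, q4] at heul
    have e1 : τ⁻¹ • dualEmb i (nodes i y₀ p (n + 1) - nodes i y₀ p n) =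
        dualEmb i (cellAvg τ n f₁) + cellAvg τ n f₂ - dualEmb i (G (i (p n)))
          - ((cellAvg τ n fun s => (L s e : StrongDual ℝ X)) + A₂
        + cellAvg τ n fun s => (L s (u s) : StrongDual ℝ X)) := by
      rw [← heul]
      abel
    rw [e1]
    simp only [map_add, map_sub]
    abel
  have happ := congrArg (fun F : StrongDual ℝ X => F e) hmain
  simp only [add_apply, smul_apply, sub_apply, neg_apply, dualEmb_apply, smul_eq_mul] at happ
  have hLe : μ * ‖e‖ ^ 2 ≤ (cellAvg τ n fun s => (L s e : StrongDual ℝ X)) e := by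
    have e1 := (ContinuousLinearMap.apply ℝ ℝ e).cellAvg_comp (iLc e)
    simp only [ContinuousLinearMap.apply_apply] at e1
    rw [← e1]
    refine le_cellAvg hτ ?_ fun t ht => hL.pos t (hcs ht) e
    exact integrable_intervalIntegrable ((ContinuousLinearMap.apply ℝ ℝ e).integrable_comp
      (iL (fun _ => e) (memLp_const e))) hcm.1 hcm.2
  -- One-sided monotonicity of `G` is available only inside `K`; the cell mean stays there because
  -- `K` is closed and convex.
  have hwK : i (w n) ∈ K := by
    have iP : Integrable P (timeMeasure T) :=
      memLp_one_iff_integrable.1 (memLp_timeMeasure_of_continuousOn hs.continuousOn 1)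
    have e1 : i (w n) = cellAvg τ n P := by
      rw [← i.cellAvg_comp (integrable_intervalIntegrable (memLp_two_integrable hs.memLp)
        hcm.1 hcm.2), cellAvg, cellAvg, integral_congr_of_ae_timeMeasure hs.ae_eq hcm.1 hcm.2]
    rw [e1]
    exact cellAvg_mem_of_ae hT hn hK hKc iP ((ae_timeMeasure_mem T).mono hPK)
  have hmo := hmono _ (hp.mem n hn) _ hwK
  rw [← map_sub, ← he] at hmo
  have hce := hc e
  have b1 : -inner ℝ (S₁ + A₁) (i e) ≤ (‖S₁‖ + ‖A₁‖) * ‖i e‖ := by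
    have := abs_real_inner_le_norm (S₁ + A₁) (i e)
    refine (neg_le_abs _).trans (this.trans ?_)
    gcongr
    exact norm_add_le _ _
  have b2 : -((S₂ e) + A₂ e) ≤ (‖S₂‖ + ‖A₂‖) * ‖e‖ := by
    have h1 := (neg_le_abs _).trans (S₂.le_opNorm e)
    have h2 := (neg_le_abs _).trans (A₂.le_opNorm e)
    linarith
  rw [← hd1] at happ b1 hmo hce
  -- The loss `c ‖i e‖²` from the nonlinearity is at most `c' ‖e‖²`, which leaves the coercivity
  -- constant `μ - c'`.
  have hfin : τ⁻¹ * inner ℝ (d (n + 1) - d n) (d (n + 1)) + (μ - c') * ‖e‖ ^ 2 ≤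
      (‖S₁‖ + ‖A₁‖) * ‖d (n + 1)‖ + (‖S₂‖ + ‖A₂‖) * ‖e‖ := by linarith
  have h3 := mul_le_mul_of_nonneg_left hfin hτ.le
  have h4 : τ * (τ⁻¹ * inner ℝ (d (n + 1) - d n) (d (n + 1)) + (μ - c') * ‖e‖ ^ 2) =
      inner ℝ (d (n + 1) - d n) (d (n + 1)) + (μ - c') * τ * ‖e‖ ^ 2 := by
    field_simp
  rw [h4] at h3
  linarith

end EulerConvergence

/-! ### Convergence of the backward Euler scheme -/

section EulerClose

variable {X Y : Type*} [NormedAddCommGroup X] [InnerProductSpace ℝ X] [CompleteSpace X]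
  [NormedAddCommGroup Y] [InnerProductSpace ℝ Y] [CompleteSpace Y]
  [TopologicalSpace.SeparableSpace X]
  {i : X →L[ℝ] Y} {T μ η : ℝ} {L : ℝ → X →L[ℝ] X →L[ℝ] ℝ}
  {G : Y → Y} {f₁ : ℝ → Y} {f₂ : ℝ → StrongDual ℝ X} {y₀ : Y} {K : Set Y} {P : ℝ → Y} {u : ℝ → X}

theorem sum_cellAvg_sq_le {Z : Type*} [NormedAddCommGroup Z] [NormedSpace ℝ Z] (hT : 0 < T)
    {N : ℕ} (hN : 0 < N) {g : ℕ → ℝ → Z} {h : ℕ → ℝ → ℝ} {k : ℝ}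
    (hg : ∀ n < N, MemLp (g n) 2 (timeMeasure T)) (hh : ∀ n < N, Integrable (h n) (timeMeasure T))
    (hgh : ∀ n < N, ∀ᵐ t ∂timeMeasure T, ‖g n t‖ ^ 2 ≤ k * h n t) :
    ∑ n ∈ Finset.range N, T / N * ‖cellAvg (T / N) n (g n)‖ ^ 2 ≤
      k * ∑ n ∈ Finset.range N, ∫ t in (n * (T / N))..((n + 1) * (T / N)), h n t := by
  have hτ : 0 < T / N := by positivity
  rw [Finset.mul_sum]
  refine Finset.sum_le_sum fun n hn => ?_
  rw [Finset.mem_range] at hn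
  have hcm := cell_mem hT hn
  have i1 := integrable_intervalIntegrable (memLp_two_integrable (hg n hn)) hcm.1 hcm.2
  have i2 := integrable_intervalIntegrable (memLp_two_integrable_sq (hg n hn)) hcm.1 hcm.2
  refine (cellAvg_pow_le hτ n i1 i2).trans ?_
  rw [← intervalIntegral.integral_const_mul]
  refine intervalIntegral.integral_mono_ae_restrict (by nlinarith) i2
    ((integrable_intervalIntegrable (hh n hn) hcm.1 hcm.2).const_mul k) ?_
  exact ae_restrict_of_ae_restrict_of_subset (cell_subset hT hn) (hgh n hn)

theorem sq_sum_mul_le {T : ℝ} (hT : 0 < T) {N : ℕ} (hN : 0 < N) (a : ℕ → ℝ) :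
    (∑ n ∈ Finset.range N, T / N * a n) ^ 2 ≤ T * ∑ n ∈ Finset.range N, T / N * a n ^ 2 := by
  have h := sq_sum_le_card_mul_sum_sq (s := Finset.range N) (f := a)
  rw [Finset.card_range] at h
  rw [← Finset.mul_sum, ← Finset.mul_sum, mul_pow]
  calc (T / N) ^ 2 * (∑ n ∈ Finset.range N, a n) ^ 2
      ≤ (T / N) ^ 2 * (N * ∑ n ∈ Finset.range N, a n ^ 2) := by gcongr
    _ = _ := by field_simp

/-- Composition with the projection onto `[0, T]`, which is 1-Lipschitz, extends `P` to the line and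
keeps its modulus of continuity. -/
theorem exists_modulus {Z : Type*} [NormedAddCommGroup Z] {P : ℝ → Z} (hT : 0 ≤ T)
    (hP : ContinuousOn P (Icc 0 T)) {ε : ℝ} (hε : 0 < ε) :
    ∃ g : ℝ → Z, Continuous g ∧ EqOn g P (Icc 0 T) ∧
      ∃ δ > 0, ∀ s t, |s - t| ≤ δ → ‖g s - g t‖ ≤ ε := by
  refine ⟨IccExtend hT ((Icc 0 T).domRestrict P), ?_, fun t ht => IccExtend_of_mem hT _ ht, ?_⟩
  · exact (continuousOn_iff_continuous_domRestrict.1 hP).Icc_extend'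
  · have huc : UniformContinuous ((Icc 0 T).domRestrict P) :=
      CompactSpace.uniformContinuous_of_continuous (continuousOn_iff_continuous_domRestrict.1 hP)
    obtain ⟨δ, hδ, h⟩ := Metric.uniformContinuous_iff.1 huc ε hε
    refine ⟨δ / 2, by positivity, fun s t hst => ?_⟩
    rw [← dist_eq_norm]
    refine (h ?_).le
    have h1 := (LipschitzWith.projIcc hT).dist_le_mul s t
    rw [NNReal.coe_one, one_mul, Real.dist_eq] at h1
    linarith

set_option maxHeartbeats 1000000 in
/-- Convergence of the backward Euler scheme: in `L²(0, T; X)` and uniformly in `Y`. -/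
theorem euler_close (hT : 0 < T) (hL : IsUniformForm T μ η L)
    (hf₁ : MemLp f₁ 1 (timeMeasure T)) (hf₂ : MemLp f₂ 2 (timeMeasure T)) (hG : LipschitzOnBalls G)
    {c c' : ℝ} (hc : ∀ x, c * ‖i x‖ ^ 2 ≤ c' * ‖x‖ ^ 2) (hc' : c' < μ)
    (hmono : ∀ y ∈ K, ∀ z ∈ K, -c * ‖y - z‖ ^ 2 ≤ inner ℝ (G y - G z) (y - z))
    (hK : Convex ℝ K) (hKc : IsClosed K) (hPK : ∀ t ∈ Icc 0 T, P t ∈ K)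
    (hs : IsSol i T L (fun s => f₁ s - G (P s)) f₂ y₀ P u) {ε : ℝ} (hε : 0 < ε) :
    ∃ δ > 0, ∀ N : ℕ, 0 < N → T / N < δ → ∀ p : ℕ → X, IsEuler i T L G f₁ f₂ y₀ K N p →
      (∑ n ∈ Finset.range N, ∫ t in (n * (T / N))..((n + 1) * (T / N)), ‖p n - u t‖ ^ 2) < ε ∧
      ∀ n < N, ∀ t ∈ Icc (n * (T / N)) ((n + 1) * (T / N)), ‖i (p n) - P t‖ < ε := by
  obtain ⟨M, hM⟩ := isCompact_Icc.exists_bound_of_continuousOn hs.continuousOn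
  -- Only the exact solution and its cell means enter the Lipschitz estimate, so a ball containing
  -- the exact values suffices. The Euler values enter through monotonicity and need no a priori
  -- bound.
  obtain ⟨ℓ, hℓ, hGℓ⟩ := hG M
  set ν := μ - c' with hν
  have hν0 : 0 < ν := by linarith
  -- Sum of four times the constant in `hS₁` and `2 / ν` times the constant in `hS₂`, with the
  -- weights of `discrete_energy_bound`.
  set Λ := 8 + 8 * T * (ℓ ^ 2 * ‖i‖ ^ 2) + 4 / ν * (1 + η ^ 2) with hΛ
  have hΛ0 : 0 < Λ := by positivity
  -- The condition `ε₁ ≤ 1` bounds the square of a small sum by `ε₁`; the third condition serves the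
  -- `L²` estimate and the last one the uniform estimate.
  obtain ⟨ε₁, hε₁, hε₁1, hb1, hb2⟩ : ∃ ε₁ > 0, ε₁ ≤ 1 ∧ (2 / ν * Λ + 2) * ε₁ < ε ∧
      Λ * ε₁ < (ε / 2) ^ 2 := by
    have t1 : Tendsto (fun x : ℝ => (2 / ν * Λ + 2) * x) (𝓝[>] 0) (𝓝 ((2 / ν * Λ + 2) * 0)) :=
      ((continuous_const.mul continuous_id).tendsto 0).mono_left nhdsWithin_le_nhds
    have t2 : Tendsto (fun x : ℝ => Λ * x) (𝓝[>] 0) (𝓝 (Λ * 0)) :=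
      ((continuous_const.mul continuous_id).tendsto 0).mono_left nhdsWithin_le_nhds
    rw [mul_zero] at t1 t2
    obtain ⟨x, ⟨h1, h2⟩, h3, h4⟩ := (((t1.eventually_lt_const hε).and
      (t2.eventually_lt_const (by positivity : 0 < (ε / 2) ^ 2))).and
      (Ioc_mem_nhdsGT (zero_lt_one (α := ℝ)))).exists
    exact ⟨x, h3, h4, h1, h2⟩
  have hGP : ContinuousOn (fun s => G (P s)) (Icc 0 T) :=
    hG.continuous.comp_continuousOn hs.continuousOn
  have mGP : ∀ q, MemLp (fun s => G (P s)) q (timeMeasure T) :=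
    memLp_timeMeasure_of_continuousOn hGP
  have m₁ : MemLp (fun s => f₁ s - G (P s)) ((1 : ℕ) : ℝ≥0∞) (timeMeasure T) := by
    rw [Nat.cast_one]
    exact MemLp.sub hf₁ (mGP 1)
  have m₂ : MemLp (fun s => f₂ s - L s (u s)) ((2 : ℕ) : ℝ≥0∞) (timeMeasure T) := by
    rw [Nat.cast_ofNat]
    exact MemLp.sub hf₂ (hL.memLp hs.memLp)
  obtain ⟨δ₁, hδ₁, h₁⟩ := sum_cellShift_pow_lt le_rfl (memLp_indicator_of_timeMeasure m₁) hT hε₁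
  obtain ⟨δ₂, hδ₂, h₂⟩ := sum_cellShift_pow_lt one_le_two
    (memLp_indicator_of_timeMeasure m₂) hT hε₁
  obtain ⟨δ₃, hδ₃, h₃⟩ := sum_integral_cellAvg_sub_lt (memLp_indicator_of_timeMeasure hs.memLp)
    hT hε₁
  obtain ⟨g, hgc, hgP, δ₄, hδ₄, hgm⟩ := exists_modulus hT.le hs.continuousOn
    (by positivity : 0 < ε / 2)
  refine ⟨min (min δ₁ δ₂) (min δ₃ δ₄), by positivity, fun N hN hτδ p hp => ?_⟩
  simp only [lt_min_iff] at hτδ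
  obtain ⟨⟨hd₁, hd₂⟩, hd₃, hd₄⟩ := hτδ
  replace h₁ := h₁ N hN hd₁
  replace h₂ := h₂ N hN hd₂
  replace h₃ := h₃ N hN hd₃
  set τ := T / N with hτd
  have hτ : 0 < τ := by positivity
  have hNτ : N * τ = T := by rw [hτd]; field_simp
  have hcell : ∀ n : ℕ, (n : ℝ) * τ ≤ (n + 1) * τ := fun n => by linarith
  set w := fun k => cellAvg τ k u with hw
  have iu := memLp_two_integrable hs.memLp
  have iwP : ∀ n < N, i (w n) = cellAvg τ n P := by
    intro n hn
    have hcm := cell_mem hT hn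
    rw [hw, ← i.cellAvg_comp (integrable_intervalIntegrable iu hcm.1 hcm.2), cellAvg, cellAvg,
      integral_congr_of_ae_timeMeasure hs.ae_eq hcm.1 hcm.2]
  have iwM : ∀ n < N, ‖i (w n)‖ ≤ M := by
    intro n hn
    rw [iwP n hn]
    exact norm_cellAvg_le_of_le hτ n fun t ht => hM t (cell_subset hT hn (Ioc_subset_Icc_self ht))
  have mwu : ∀ n, MemLp (fun t => w n - u t) 2 (timeMeasure T) := fun n =>
    MemLp.sub (memLp_const (w n)) hs.memLp
  set α := ∑ n ∈ Finset.range N, ∫ t in (n * τ)..((n + 1) * τ), ‖w n - u t‖ ^ 2 with hα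
  have hαε : α < ε₁ := by
    refine lt_of_eq_of_lt (Finset.sum_congr rfl fun n hn => ?_) h₃
    rw [Finset.mem_range] at hn
    have e : w n = cellAvg τ n ((Icc 0 T).indicator u) := cellAvg_congr hτ.le fun t ht => by
      rw [indicator_of_mem (cell_subset hT hn (Ioc_subset_Icc_self ht))]
    refine intervalIntegral.integral_congr fun t ht => ?_
    rw [uIcc_of_le (hcell n)] at ht
    simp only [e, indicator_of_mem (cell_subset hT hn ht)]
  have hα0 : 0 ≤ α := Finset.sum_nonneg fun n _ =>
    intervalIntegral.integral_nonneg (hcell n) fun t _ => by positivity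
  -- the consistency errors
  set s₁ := fun n : ℕ => ‖cellShift τ n ((Icc 0 T).indicator fun s => f₁ s - G (P s))‖ with hs₁
  set s₂ := fun n : ℕ => ‖cellShift τ n ((Icc 0 T).indicator fun s => f₂ s - L s (u s))‖ with hs₂
  set a₁ := fun n : ℕ => ‖cellAvg τ n fun s => G (i (w n)) - G (P s)‖ with ha₁
  set a₂ := fun n : ℕ => ‖cellAvg τ n fun s => (L s (w n - u s) : StrongDual ℝ X)‖ with ha₂
  have hA₁ : ∑ n ∈ Finset.range N, τ * a₁ n ^ 2 ≤ ℓ ^ 2 * ‖i‖ ^ 2 * α := by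
    refine sum_cellAvg_sq_le hT hN (fun n hn => ?_)
      (fun n hn => memLp_two_integrable_sq (mwu n)) fun n hn => ?_
    · exact MemLp.sub (memLp_const (G (i (w n)))) (mGP 2)
    · filter_upwards [hs.ae_eq, ae_timeMeasure_mem T] with t ht htm
      have e1 := hGℓ _ _ (iwM n hn) (hM t htm)
      rw [← ht, ← map_sub] at e1
      have e2 := i.le_opNorm (w n - u t)
      rw [← ht, ← mul_pow, ← mul_pow]
      refine pow_le_pow_left₀ (norm_nonneg _) (e1.trans ?_) 2
      rw [mul_assoc]
      gcongr
  have hA₂ : ∑ n ∈ Finset.range N, τ * a₂ n ^ 2 ≤ η ^ 2 * α := by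
    refine sum_cellAvg_sq_le hT hN (fun n hn => hL.memLp (mwu n))
      (fun n hn => memLp_two_integrable_sq (mwu n)) fun n hn => ?_
    filter_upwards [ae_timeMeasure_mem T] with t htm
    have e1 := hL.norm_le htm (w n - u t)
    calc _ ≤ (|η| * ‖w n - u t‖) ^ 2 := pow_le_pow_left₀ (norm_nonneg _) e1 2
      _ = _ := by rw [mul_pow, sq_abs]
  have hS₁ : (∑ n ∈ Finset.range N, τ * (s₁ n + a₁ n)) ^ 2 ≤
      (2 + 2 * T * (ℓ ^ 2 * ‖i‖ ^ 2)) * ε₁ := by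
    have e1 : ∑ n ∈ Finset.range N, τ * (s₁ n + a₁ n) =
        ∑ n ∈ Finset.range N, τ * s₁ n + ∑ n ∈ Finset.range N, τ * a₁ n := by
      rw [← Finset.sum_add_distrib]
      exact Finset.sum_congr rfl fun n _ => by ring
    -- The averaging error of `G` is controlled in `ℓ²`, while the energy estimate wants it in `ℓ¹`;
    -- Cauchy–Schwarz costs the factor `T`.
    have e2 := sq_sum_mul_le hT hN a₁
    have e3 : ∑ n ∈ Finset.range N, τ * s₁ n < ε₁ := by simpa using h₁
    have e4 : 0 ≤ ∑ n ∈ Finset.range N, τ * s₁ n := Finset.sum_nonneg fun n _ => by positivity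
    have e5 : (∑ n ∈ Finset.range N, τ * s₁ n) ^ 2 ≤ ε₁ :=
      (pow_le_of_le_one e4 (e3.le.trans hε₁1) two_ne_zero).trans e3.le
    have e6 : (∑ n ∈ Finset.range N, τ * a₁ n) ^ 2 ≤ T * (ℓ ^ 2 * ‖i‖ ^ 2 * ε₁) := by
      refine e2.trans ?_
      gcongr
      exact hA₁.trans (by gcongr)
    have e7 := add_sq_le (a := ∑ n ∈ Finset.range N, τ * s₁ n)
      (b := ∑ n ∈ Finset.range N, τ * a₁ n)
    rw [e1]
    refine e7.trans ((mul_le_mul_of_nonneg_left (add_le_add e5 e6) zero_le_two).trans_eq ?_)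
    ring
  have hS₂ : ∑ n ∈ Finset.range N, τ * (s₂ n + a₂ n) ^ 2 ≤ 2 * (1 + η ^ 2) * ε₁ := by
    have e1 : ∑ n ∈ Finset.range N, τ * (s₂ n + a₂ n) ^ 2 ≤
        2 * ∑ n ∈ Finset.range N, τ * s₂ n ^ 2 + 2 * ∑ n ∈ Finset.range N, τ * a₂ n ^ 2 := by
      rw [Finset.mul_sum, Finset.mul_sum, ← Finset.sum_add_distrib]
      refine Finset.sum_le_sum fun n _ => ?_
      linarith [mul_le_mul_of_nonneg_left (add_sq_le (a := s₂ n) (b := a₂ n)) hτ.le]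
    have e2 : η ^ 2 * α ≤ η ^ 2 * ε₁ := by gcongr
    have e3 : ∑ n ∈ Finset.range N, τ * s₂ n ^ 2 < ε₁ := h₂
    linarith
  set d := fun k => nodes i y₀ p k - nodes i y₀ w k with hd
  set e := fun k => p k - w k with he
  have hbound := fun n (hn : n ≤ N) => discrete_energy_bound (N := N) (τ := τ) (c := ν) (d := d)
    (e := e) (r₁ := fun n => s₁ n + a₁ n) (r₂ := fun n => s₂ n + a₂ n) hτ hν0 (by simp [hd, nodes])
    (fun n => by positivity)
    (fun n hn => euler_error_step hT hL hf₁ hf₂ hG hc hmono hK hKc hPK hs hp hn) hn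
  have hΛε : 4 * (∑ k ∈ Finset.range N, τ * (s₁ k + a₁ k)) ^ 2 +
      2 / ν * ∑ k ∈ Finset.range N, τ * (s₂ k + a₂ k) ^ 2 ≤ Λ * ε₁ := by
    have := mul_le_mul_of_nonneg_left hS₂ (by positivity : 0 ≤ 2 / ν)
    have e1 : 2 / ν * (2 * (1 + η ^ 2) * ε₁) = 4 / ν * (1 + η ^ 2) * ε₁ := by ring
    rw [e1] at this
    rw [hΛ]
    linarith
  constructor
  · have h1 : ∑ n ∈ Finset.range N, ∫ t in (n * τ)..((n + 1) * τ), ‖p n - u t‖ ^ 2 ≤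
        2 * (τ * ∑ k ∈ Finset.range N, ‖e k‖ ^ 2) + 2 * α := by
      rw [hα, Finset.mul_sum, Finset.mul_sum, Finset.mul_sum, ← Finset.sum_add_distrib]
      refine Finset.sum_le_sum fun n hn => ?_
      rw [Finset.mem_range] at hn
      have hcm := cell_mem hT hn
      have e1 : 2 * (τ * ‖e n‖ ^ 2) = ∫ t in (n * τ)..((n + 1) * τ), 2 * ‖e n‖ ^ 2 := by
        rw [intervalIntegral.integral_const, smul_eq_mul]
        ring
      have j1 := (integrable_intervalIntegrable (memLp_two_integrable_sq (mwu n))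
        hcm.1 hcm.2).const_mul 2
      rw [e1, ← intervalIntegral.integral_const_mul,
        ← intervalIntegral.integral_add intervalIntegrable_const j1]
      refine intervalIntegral.integral_mono_on (hcell n) ?_
        (intervalIntegrable_const.add j1) fun t _ => ?_
      · exact integrable_intervalIntegrable (memLp_two_integrable_sq
          (MemLp.sub (memLp_const (p n)) hs.memLp)) hcm.1 hcm.2
      -- The discrete error is bounded by the energy estimate, the distance from `u` to its cell
      -- means by `α`.
      · have e2 : p n - u t = e n + (w n - u t) := by simp only [he]; abel
        have e3 := norm_add_le (e n) (w n - u t)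
        rw [e2]
        calc _ ≤ (‖e n‖ + ‖w n - u t‖) ^ 2 := pow_le_pow_left₀ (norm_nonneg _) e3 2
          _ ≤ _ := by linarith [add_sq_le (a := ‖e n‖) (b := ‖w n - u t‖)]
    have h2 := (hbound N le_rfl).trans hΛε
    have h3 : ν * (τ * ∑ k ∈ Finset.range N, ‖e k‖ ^ 2) ≤ Λ * ε₁ := by
      linarith [sq_nonneg ‖d N‖]
    have h4 : τ * ∑ k ∈ Finset.range N, ‖e k‖ ^ 2 ≤ Λ * ε₁ / ν := by
      rw [le_div_iff₀ hν0]
      linarith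
    have h5 : 2 * (Λ * ε₁ / ν) + 2 * ε₁ = (2 / ν * Λ + 2) * ε₁ := by ring
    linarith
  · intro n hn t ht
    -- The index is `n + 1` because `p n` sits at node `n + 1`.
    have h2 := (hbound (n + 1) hn).trans hΛε
    have h3 : ‖d (n + 1)‖ < ε / 2 := by
      refine lt_of_pow_lt_pow_left₀ 2 (by positivity) ?_
      have : 0 ≤ ν * (τ * ∑ k ∈ Finset.range (n + 1), ‖e k‖ ^ 2) := by positivity
      linarith
    have h4 : ‖cellAvg τ n g - g t‖ ≤ ε / 2 :=
      norm_cellAvg_sub_le_of_modulus hgc hτ (fun s t hst => hgm s t (hst.trans hd₄.le)) n ht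
    have h5 : cellAvg τ n g = i (w n) := by
      rw [iwP n hn]
      exact cellAvg_congr hτ.le fun t ht => hgP (cell_subset hT hn (Ioc_subset_Icc_self ht))
    rw [h5, hgP (cell_subset hT hn ht)] at h4
    have h6 : i (p n) - P t = d (n + 1) + (i (w n) - P t) := by
      change i (p n) - P t = i (p n) - i (w n) + (i (w n) - P t)
      abel
    rw [h6]
    exact (norm_add_le _ _).trans_lt (by linarith)

end EulerClose

/-! ### Hilbert–Schmidt operators: rank one operators, completeness, separability -/

section HSBasic

variable {X Y Z : Type*}
  [NormedAddCommGroup X] [InnerProductSpace ℝ X] [CompleteSpace X]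
  [NormedAddCommGroup Y] [InnerProductSpace ℝ Y]
  [NormedAddCommGroup Z] [InnerProductSpace ℝ Z]

@[simp] theorem HS.toCLM_sub (T S : HS X Y) : (T - S).toCLM = T.toCLM - S.toCLM := rfl

theorem hasSum_inner_basis (x y : X) :
    HasSum (fun k => inner ℝ x (basis X k) * inner ℝ (basis X k) y) (inner ℝ x y) :=
  (basis X).hasSum_inner_mul_inner x y

/-- The rank one operator `h ↦ ⟪x, h⟫ y`. -/
def HS.rankOne (x : X) (y : Y) : HS X Y :=
  HS.mk ((innerSL ℝ x).smulRight y) (by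
    have h := (hasSum_inner_basis x x).summable.mul_right (‖y‖ ^ 2)
    refine h.congr fun i => ?_
    simp only [ContinuousLinearMap.smulRight_apply, innerSL_apply_apply, norm_smul, mul_pow,
      Real.norm_eq_abs, sq_abs]
    rw [real_inner_comm x (basis X i)]
    ring)

@[simp] theorem HS.rankOne_apply (x : X) (y : Y) (h : X) :
    (HS.rankOne x y).toCLM h = inner ℝ x h • y := by
  simp [HS.rankOne]

theorem HS.inner_rankOne (T : HS X Y) (x : X) (y : Y) :
    inner ℝ T (HS.rankOne x y) = inner ℝ (T.toCLM x) y := by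
  have h1 := ((innerSL ℝ y).comp T.toCLM).hasSum ((basis X).hasSum_repr x)
  rw [HS.inner_def]
  have h2 := h1.tsum_eq
  simp only [map_smul, HilbertBasis.repr_apply_apply, ContinuousLinearMap.comp_apply,
    innerSL_apply_apply, smul_eq_mul] at h2
  rw [real_inner_comm, ← h2]
  refine tsum_congr fun i => ?_
  rw [HS.rankOne_apply, inner_smul_right, real_inner_comm x, real_inner_comm y]

theorem HS.norm_rankOne (x : X) (y : Y) : ‖HS.rankOne x y‖ = ‖x‖ * ‖y‖ := by
  have h : ‖HS.rankOne x y‖ ^ 2 = (‖x‖ * ‖y‖) ^ 2 := by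
    rw [← real_inner_self_eq_norm_sq, HS.inner_rankOne, HS.rankOne_apply, inner_smul_left,
      real_inner_self_eq_norm_sq, real_inner_self_eq_norm_sq]
    simp [mul_pow]
  exact (pow_left_inj₀ (norm_nonneg _) (by positivity) two_ne_zero).1 h

/-- Cauchy–Schwarz for `T` against the rank one operator built from `x` and `T x`. -/
theorem HS.norm_apply_le (T : HS X Y) (x : X) : ‖T.toCLM x‖ ≤ ‖T‖ * ‖x‖ := by
  have h := real_inner_le_norm T (HS.rankOne x (T.toCLM x))
  rw [HS.inner_rankOne, HS.norm_rankOne, real_inner_self_eq_norm_sq] at h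
  rcases (norm_nonneg (T.toCLM x)).eq_or_lt with h0 | h0
  · rw [← h0]
    positivity
  · nlinarith

theorem HS.norm_toCLM_le (T : HS X Y) : ‖T.toCLM‖ ≤ ‖T‖ :=
  ContinuousLinearMap.opNorm_le_bound _ (norm_nonneg _) T.norm_apply_le

/-- A Hilbert--Schmidt operator as a bounded operator, as a bounded linear map. -/
def HS.toCLML (X Y : Type*) [NormedAddCommGroup X] [InnerProductSpace ℝ X] [CompleteSpace X]
    [NormedAddCommGroup Y] [InnerProductSpace ℝ Y] : HS X Y →L[ℝ] X →L[ℝ] Y :=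
  LinearMap.mkContinuous { toFun := HS.toCLM, map_add' := fun _ _ => rfl, map_smul' := fun _ _ =>
      rfl }
    1 (fun T => by rw [one_mul]; exact T.norm_toCLM_le)

theorem HS.sum_norm_sq_le (T : HS X Y) (s : Finset (basisIndex X)) :
    ∑ i ∈ s, ‖T.toCLM (basis X i)‖ ^ 2 ≤ ‖T‖ ^ 2 := by
  rw [HS.norm_sq]
  exact T.summable.sum_le_tsum s fun i _ => by positivity

/-- A Cauchy sequence has a limit in operator norm. The Cauchy estimate passes to this limit in
every finite partial sum of the squared norm, uniformly in the finite set. -/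
instance [CompleteSpace Y] : CompleteSpace (HS X Y) := by
  refine Metric.complete_of_cauchySeq_tendsto fun T hT => ?_
  obtain ⟨S, hS⟩ := cauchySeq_tendsto_of_complete ((HS.toCLML X Y).uniformContinuous.comp_cauchySeq
      hT)
  have key : ∀ ε > 0, ∃ N, ∀ n ≥ N, ∀ s : Finset (basisIndex X),
      ∑ i ∈ s, ‖((T n).toCLM - S) (basis X i)‖ ^ 2 ≤ ε ^ 2 := by
    intro ε hε
    obtain ⟨N, hN⟩ := Metric.cauchySeq_iff.1 hT ε hε
    refine ⟨N, fun n hn s => ?_⟩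
    have ht : Tendsto (fun m => ∑ i ∈ s, ‖((T n).toCLM - (T m).toCLM) (basis X i)‖ ^ 2) atTop
        (𝓝 (∑ i ∈ s, ‖((T n).toCLM - S) (basis X i)‖ ^ 2)) := by
      refine tendsto_finsetSum s fun i _ => ?_
      have h1 : Tendsto (fun m => (T m).toCLM (basis X i)) atTop (𝓝 (S (basis X i))) :=
        ((ContinuousLinearMap.apply ℝ Y (basis X i)).continuous.tendsto S).comp hS
      exact ((tendsto_const_nhds.sub h1).norm.pow 2)
    refine le_of_tendsto ht ?_
    filter_upwards [eventually_ge_atTop N] with m hm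
    refine ((T n - T m).sum_norm_sq_le s).trans ?_
    have := hN n hn m hm
    rw [dist_eq_norm] at this
    gcongr
  obtain ⟨N, hN⟩ := key 1 one_pos
  have hmem : S ∈ hsSubmodule X Y := by
    have h1 : (T N).toCLM - S ∈ hsSubmodule X Y :=
      summable_of_sum_le (fun i => by positivity) (hN N le_rfl)
    have h2 := (hsSubmodule X Y).sub_mem (T N).summable h1
    rwa [sub_sub_cancel] at h2
  refine ⟨HS.mk S hmem, ?_⟩
  rw [tendsto_iff_norm_sub_tendsto_zero]
  rw [Metric.tendsto_atTop]
  intro ε hε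
  obtain ⟨N, hN⟩ := key (ε / 2) (by positivity)
  refine ⟨N, fun n hn => ?_⟩
  have h1 : ‖T n - HS.mk S hmem‖ ^ 2 ≤ (ε / 2) ^ 2 := by
    rw [HS.norm_sq]
    exact (T n - HS.mk S hmem).summable.tsum_le_of_sum_le (hN n hn)
  have h2 := le_of_sq_le_sq h1 (by positivity)
  rw [Real.dist_eq, sub_zero, abs_norm]
  linarith

/-- An operator `T` orthogonal to these rank one operators has `⟪T x, y⟫ = 0` for `x`, `y` in dense
sets, hence `T = 0`. -/
theorem HS.dense_span_rankOne {D : Set X} {E : Set Y} (hD : Dense D) (hE : Dense E)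
    [CompleteSpace Y] :
    Dense (Submodule.span ℝ {T : HS X Y | ∃ x ∈ D, ∃ y ∈ E, T = HS.rankOne x y} : Set (HS X Y)) :=
        by
  rw [Submodule.dense_iff_topologicalClosure_eq_top,
    Submodule.topologicalClosure_eq_top_iff, Submodule.eq_bot_iff]
  intro T hT
  have h1 : ∀ x ∈ D, ∀ y ∈ E, inner ℝ (T.toCLM x) y = 0 := by
    intro x hx y hy
    rw [← HS.inner_rankOne]
    exact (Submodule.mem_orthogonal' _ _).1 hT _ (Submodule.subset_span ⟨x, hx, y, hy, rfl⟩)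
  have h2 : ∀ x ∈ D, T.toCLM x = 0 := by
    intro x hx
    refine hE.eq_zero_of_inner_left (𝕜 := ℝ) fun y hy => ?_
    exact h1 x hx y hy
  refine HS.ext ?_
  have := Continuous.ext_on hD T.toCLM.continuous continuous_const (g := fun _ => 0) h2
  ext x
  exact congrFun this x

instance [TopologicalSpace.SeparableSpace X] [TopologicalSpace.SeparableSpace Y] [CompleteSpace Y] :
    TopologicalSpace.SeparableSpace (HS X Y) := by
  obtain ⟨D, hDc, hD⟩ := TopologicalSpace.exists_countable_dense X
  obtain ⟨E, hEc, hE⟩ := TopologicalSpace.exists_countable_dense Y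
  rw [← TopologicalSpace.isSeparable_univ_iff, ← (HS.dense_span_rankOne hD hE).closure_eq]
  refine (TopologicalSpace.IsSeparable.span (Set.Countable.isSeparable ?_)).closure
  have : {T : HS X Y | ∃ x ∈ D, ∃ y ∈ E, T = HS.rankOne x y} =
      (fun q : X × Y => HS.rankOne q.1 q.2) '' (D ×ˢ E) := by
    ext T
    constructor
    · rintro ⟨x, hx, y, hy, rfl⟩
      exact ⟨(x, y), ⟨hx, hy⟩, rfl⟩
    · rintro ⟨⟨x, y⟩, ⟨hx, hy⟩, rfl⟩
      exact ⟨x, hx, y, hy, rfl⟩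
  rw [this]
  exact (hDc.prod hEc).image _

@[simp] theorem HS.toCLM_adj [CompleteSpace Y] (T : HS X Y) :
    T.adj.toCLM = ContinuousLinearMap.adjoint T.toCLM := rfl

@[simp] theorem HS.adj_adj [CompleteSpace Y] (T : HS X Y) : T.adj.adj = T :=
  HS.ext (by simp)

end HSBasic

/-! ### The square and the cone of operators bounded below -/

section Square

variable {H : Type*} [NormedAddCommGroup H] [InnerProductSpace ℝ H] [CompleteSpace H]

theorem HS.square_sub_square (P S : HS H H) :
    P.square - S.square = HS.compLeft P.toCLM (P - S) + HS.compRight (P - S) S.toCLM :=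
  HS.ext (by ext x; simp [HS.square])

theorem HS.lipschitzOnBalls_square : LipschitzOnBalls (HS.square (H := H)) := by
  intro M
  refine ⟨2 * |M|, by positivity, fun P S hP hS => ?_⟩
  have h1 := HS.norm_compLeft_le P.toCLM (P - S)
  have h2 := HS.norm_compRight_le (P - S) S.toCLM
  have h3 := P.norm_toCLM_le.trans (hP.trans (le_abs_self M))
  have h4 := S.norm_toCLM_le.trans (hS.trans (le_abs_self M))
  rw [HS.square_sub_square]
  refine (norm_add_le _ _).trans ?_
  have h5 := mul_le_mul_of_nonneg_right h3 (norm_nonneg (P - S))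
  have h6 := mul_le_mul_of_nonneg_right h4 (norm_nonneg (P - S))
  linarith

theorem HS.adj_eq_of_isSelfAdjoint {P : HS H H} (h : IsSelfAdjoint P.toCLM) : P.adj = P :=
  HS.ext (by rw [HS.toCLM_adj]; exact ContinuousLinearMap.isSelfAdjoint_iff'.1 h)

theorem HS.isSelfAdjoint_iff_adj_eq {P : HS H H} : IsSelfAdjoint P.toCLM ↔ P.adj = P :=
  ⟨HS.adj_eq_of_isSelfAdjoint, fun h => ContinuousLinearMap.isSelfAdjoint_iff'.2 (by
    rw [← HS.toCLM_adj, h])⟩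

/-- The lower bound of `P` is applied to each vector `D eᵢ` of the sum defining the inner product.
-/
theorem HS.inner_compLeft_self_ge {γ : ℝ} {P : HS H H} (hP : P ∈ lowerCone H γ) (D : HS H H) :
    -γ * ‖D‖ ^ 2 ≤ inner ℝ (HS.compLeft P.toCLM D) D := by
  rw [HS.norm_sq, HS.inner_def, ← tsum_mul_left]
  exact (D.summable.mul_left _).tsum_le_tsum (fun i => hP.2 _) (HS.summable_inner _ _)

/-- With `D = P - S` one has `P² - S² = P D + D S`. As `D` and `S` are self-adjoint, `⟪D S, D⟫ = ⟪S
D, D⟫`, so each of the two terms loses at most `γ ‖D‖²`. -/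
theorem HS.square_monotone {γ : ℝ} {P S : HS H H} (hP : P ∈ lowerCone H γ)
    (hS : S ∈ lowerCone H γ) :
    -(2 * γ) * ‖P - S‖ ^ 2 ≤ inner ℝ (P.square - S.square) (P - S) := by
  have hD : (P - S).adj = P - S := by
    refine HS.adj_eq_of_isSelfAdjoint ?_
    rw [HS.toCLM_sub]
    exact hP.1.sub hS.1
  have h1 := HS.inner_compLeft_self_ge hP (P - S)
  have h2 := HS.inner_compLeft_self_ge hS (P - S)
  have h3 : (HS.compRight (P - S) S.toCLM).adj = HS.compLeft S.toCLM (P - S) := by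
    refine HS.ext ?_
    rw [HS.toCLM_adj, HS.toCLM_compRight, ContinuousLinearMap.adjoint_comp, HS.toCLM_compLeft,
      ContinuousLinearMap.isSelfAdjoint_iff'.1 hS.1, ← HS.toCLM_adj, hD]
  have h4 : inner ℝ (HS.compRight (P - S) S.toCLM) (P - S) =
      inner ℝ (HS.compLeft S.toCLM (P - S)) (P - S) := by
    rw [← HS.inner_adj, h3, hD]
  rw [HS.square_sub_square, inner_add_left, h4]
  linarith

theorem continuous_HS_apply (x : H) : Continuous fun P : HS H H => P.toCLM x :=
  ((ContinuousLinearMap.apply ℝ H x).comp (HS.toCLML H H)).continuous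

theorem mem_lowerCone_iff {γ : ℝ} {P : HS H H} : P ∈ lowerCone H γ ↔
    (∀ x y, inner ℝ (P.toCLM x) y = inner ℝ x (P.toCLM y)) ∧
      ∀ x, -γ * ‖x‖ ^ 2 ≤ inner ℝ (P.toCLM x) x := by
  rw [lowerCone, Set.mem_ofPred_eq, ContinuousLinearMap.isSelfAdjoint_iff_isSymmetric]
  rfl

theorem isClosed_lowerCone (γ : ℝ) : IsClosed (lowerCone H γ) := by
  have : lowerCone H γ = (⋂ x, ⋂ y, {P : HS H H | inner ℝ (P.toCLM x) y = inner ℝ x (P.toCLM y)}) ∩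
      ⋂ x, {P : HS H H | -γ * ‖x‖ ^ 2 ≤ inner ℝ (P.toCLM x) x} := by
    ext P
    simp [mem_lowerCone_iff]
  rw [this]
  refine (isClosed_iInter fun x => isClosed_iInter fun y => ?_).inter (isClosed_iInter fun x => ?_)
  · exact isClosed_eq ((continuous_HS_apply x).inner continuous_const)
      (continuous_const.inner (continuous_HS_apply y))
  · exact isClosed_le continuous_const ((continuous_HS_apply x).inner continuous_const)

theorem convex_lowerCone (γ : ℝ) : Convex ℝ (lowerCone H γ) := by
  intro P hP S hS a b ha hb hab
  rw [mem_lowerCone_iff] at *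
  constructor
  · intro x y
    simp [inner_add_left, inner_add_right, inner_smul_left, inner_smul_right, hP.1 x y, hS.1 x y]
  · intro x
    have h1 := mul_le_mul_of_nonneg_left (hP.2 x) ha
    have h2 := mul_le_mul_of_nonneg_left (hS.2 x) hb
    simp only [HS.toCLM_add, HS.toCLM_smul, add_apply, smul_apply, inner_add_left, inner_smul_left,
      conj_trivial]
    have h3 : -γ * ‖x‖ ^ 2 = a * (-γ * ‖x‖ ^ 2) + b * (-γ * ‖x‖ ^ 2) := by
      rw [← add_mul, hab, one_mul]
    linarith

end Square

/-! ### Elements of 𝒱 as pairs `(P, P*)` of operators `H → V` -/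

section OpVStructure

variable {V H : Type*}
  [NormedAddCommGroup V] [InnerProductSpace ℝ V] [CompleteSpace V]
  [NormedAddCommGroup H] [InnerProductSpace ℝ H] [CompleteSpace H] {j : V →L[ℝ] H}

omit [CompleteSpace V] in
@[simp] theorem riesz_apply (v w : V) : riesz V v w = inner ℝ v w := rfl

/-- The inverse of the Riesz map. -/
def rieszInv (V : Type*) [NormedAddCommGroup V] [InnerProductSpace ℝ V] [CompleteSpace V] :
    StrongDual ℝ V →L[ℝ] V :=
  ContinuousLinearMap.adjoint (riesz V)

theorem inner_rieszInv (f : StrongDual ℝ V) (v : V) : inner ℝ (rieszInv V f) v = f v := by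
  rw [rieszInv, ContinuousLinearMap.adjoint_inner_left, inner_riesz]

@[simp] theorem riesz_rieszInv (f : StrongDual ℝ V) : riesz V (rieszInv V f) = f := by
  ext v
  rw [riesz_apply, inner_rieszInv]

@[simp] theorem rieszInv_riesz (v : V) : rieszInv V (riesz V v) = v := by
  refine ext_inner_right ℝ fun w => ?_
  rw [inner_rieszInv, riesz_apply]

@[simp] theorem adjoint_riesz : ContinuousLinearMap.adjoint (riesz V) = rieszInv V := rfl

@[simp] theorem adjoint_rieszInv : ContinuousLinearMap.adjoint (rieszInv V) = riesz V := by
  rw [rieszInv, ContinuousLinearMap.adjoint_adjoint]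

omit [CompleteSpace V] in
theorem norm_riesz_le : ‖riesz V‖ ≤ 1 := by
  refine ContinuousLinearMap.opNorm_le_bound _ zero_le_one fun v => ?_
  rw [one_mul]
  exact ContinuousLinearMap.opNorm_le_bound _ (norm_nonneg v) fun w => norm_inner_le_norm v w

theorem norm_rieszInv_le : ‖rieszInv V‖ ≤ 1 := by
  rw [rieszInv, LinearIsometryEquiv.norm_map]
  exact norm_riesz_le

theorem dualEmb_eq (j : V →L[ℝ] H) (h : H) :
    dualEmb j h = riesz V (ContinuousLinearMap.adjoint j h) := by
  ext v
  rw [dualEmb_apply, riesz_apply, ContinuousLinearMap.adjoint_inner_left]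

/-- The adjoint as a bounded linear map. -/
def HS.adjL (X Y : Type*) [NormedAddCommGroup X] [InnerProductSpace ℝ X] [CompleteSpace X]
    [NormedAddCommGroup Y] [InnerProductSpace ℝ Y] [CompleteSpace Y] : HS X Y →L[ℝ] HS Y X :=
  LinearMap.mkContinuous
    { toFun := HS.adj
      map_add' := fun T S => HS.ext (by simp)
      map_smul' := fun r T => HS.ext (by simp) } 1 (fun T => by
        rw [one_mul]
        exact T.norm_adj.le)

/-- The operator `P* : H → V` for `P ∈ HS(V*, H) ∩ HS(H, V)`. -/
def OpV.coV (j : V →L[ℝ] H) : OpV j →L[ℝ] HS H V :=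
  (HS.compLeftL (rieszInv V)).comp ((HS.adjL (StrongDual ℝ V) H).comp (OpV.onDual j))

theorem OpV.coV_apply (P : OpV j) :
    (OpV.coV j P).toCLM = (rieszInv V).comp (ContinuousLinearMap.adjoint (OpV.onDual j P).toCLM) :=
  rfl

theorem OpV.toHi_apply (P : OpV j) : (OpV.toHi j P).toCLM = j.comp (OpV.intoV j P).toCLM := rfl

theorem OpV.adjoint_coV (P : OpV j) :
    ContinuousLinearMap.adjoint (OpV.coV j P).toCLM = (OpV.onDual j P).toCLM.comp (riesz V) := by
  rw [OpV.coV_apply, ContinuousLinearMap.adjoint_comp, adjoint_rieszInv,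
    ContinuousLinearMap.adjoint_adjoint]

/-- The action on `V*` carries the same information as `P* : H → V`. Describing `P` by `intoV` and
`coV` makes both components live in `HS(H, V)`, and passing to the adjoint exchanges them. -/
theorem OpV.onDual_eq (P : OpV j) : OpV.onDual j P =
    HS.compRight (OpV.coV j P).adj (rieszInv V) := by
  refine HS.ext ?_
  rw [HS.toCLM_compRight, HS.toCLM_adj, OpV.adjoint_coV]
  ext f
  simp

theorem OpV.comp_coV (P : OpV j) :
    j.comp (OpV.coV j P).toCLM = ContinuousLinearMap.adjoint (OpV.toHi j P).toCLM := by
  have h : (OpV.toHi j P).toCLM = (OpV.onDual j P).toCLM.comp ((riesz V).comp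
      (ContinuousLinearMap.adjoint j)) := by
    ext h
    have h1 := P.2 h
    rw [dualEmb_eq] at h1
    exact h1.symm
  rw [h, ContinuousLinearMap.adjoint_comp, ContinuousLinearMap.adjoint_comp,
    ContinuousLinearMap.adjoint_adjoint, adjoint_riesz, OpV.coV_apply,
        ContinuousLinearMap.comp_assoc]

theorem OpV.norm_coV (P : OpV j) : ‖OpV.coV j P‖ = ‖OpV.onDual j P‖ := by
  refine le_antisymm ?_ ?_
  · refine (HS.norm_compLeft_le (rieszInv V) (OpV.onDual j P).adj).trans ?_
    rw [HS.norm_adj]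
    exact mul_le_of_le_one_left (norm_nonneg _) norm_rieszInv_le
  · rw [OpV.onDual_eq]
    refine (HS.norm_compRight_le _ _).trans ?_
    rw [HS.norm_adj]
    exact mul_le_of_le_one_left (norm_nonneg _) norm_rieszInv_le

theorem OpV.norm_sq (P : OpV j) : ‖P‖ ^ 2 = ‖OpV.intoV j P‖ ^ 2 + ‖OpV.coV j P‖ ^ 2 := by
  rw [OpV.norm_coV, add_comm]
  exact WithLp.prod_norm_sq_eq_of_L2 _

theorem OpV.ext_intoV {P R : OpV j} (h₁ : OpV.intoV j P = OpV.intoV j R)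
    (h₂ : OpV.coV j P = OpV.coV j R) : P = R := by
  rw [← sub_eq_zero, ← norm_eq_zero, ← sq_eq_zero_iff, OpV.norm_sq, map_sub, map_sub, h₁, h₂]
  simp

/-- The element of `HS(V*, H) ∩ HS(H, V)` with given restrictions `S` and `R* : H → V`. -/
def OpV.ofPair (S R : HS H V)
    (h : j.comp S.toCLM = ContinuousLinearMap.adjoint (j.comp R.toCLM)) : OpV j :=
  ⟨WithLp.toLp 2 (HS.compRight R.adj (rieszInv V), S), fun x => by
    have h1 := congrArg (fun A : H →L[ℝ] H => A x) h
    rw [ContinuousLinearMap.adjoint_comp] at h1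
    simpa [dualEmb_eq] using h1.symm⟩

@[simp] theorem OpV.coV_ofPair (S R : HS H V) (h) : OpV.coV j (OpV.ofPair S R h) = R := by
  refine HS.ext ?_
  have : OpV.onDual j (OpV.ofPair S R h) = HS.compRight R.adj (rieszInv V) := rfl
  rw [OpV.coV_apply, this, HS.toCLM_compRight, ContinuousLinearMap.adjoint_comp, HS.toCLM_adj,
    ContinuousLinearMap.adjoint_adjoint, adjoint_rieszInv]
  ext x
  simp

/-- The adjoint of an element of `HS(V*, H) ∩ HS(H, V)`. -/
def OpV.adj (P : OpV j) : OpV j :=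
  OpV.ofPair (OpV.coV j P) (OpV.intoV j P) (OpV.comp_coV P)

@[simp] theorem OpV.intoV_adj (P : OpV j) : OpV.intoV j P.adj = OpV.coV j P := rfl

@[simp] theorem OpV.coV_adj (P : OpV j) : OpV.coV j P.adj = OpV.intoV j P := OpV.coV_ofPair _ _ _

theorem OpV.toHi_adj (P : OpV j) : OpV.toHi j P.adj = (OpV.toHi j P).adj :=
  HS.ext (OpV.comp_coV P)

@[simp] theorem OpV.adj_adj (P : OpV j) : P.adj.adj = P :=
  OpV.ext_intoV (by simp) (by simp)

/-- The rank one operator `h ↦ ⟪j v, h⟫ w`. -/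
def OpV.rankOne (j : V →L[ℝ] H) (v w : V) : OpV j :=
  OpV.ofPair (HS.rankOne (j v) w) (HS.rankOne (j w) v) (by
    refine ContinuousLinearMap.ext fun x => ext_inner_right ℝ fun y => ?_
    rw [ContinuousLinearMap.adjoint_inner_left]
    simp only [ContinuousLinearMap.comp_apply, HS.rankOne_apply, map_smul, inner_smul_left,
      inner_smul_right, conj_trivial]
    rw [real_inner_comm x (j v)]
    ring)

@[simp] theorem OpV.intoV_rankOne (v w : V) :
    OpV.intoV j (OpV.rankOne j v w) = HS.rankOne (j v) w := rfl

@[simp] theorem OpV.coV_rankOne (v w : V) :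
    OpV.coV j (OpV.rankOne j v w) = HS.rankOne (j w) v := OpV.coV_ofPair _ _ _

theorem OpV.toHi_rankOne (v w : V) : OpV.toHi j (OpV.rankOne j v w) = HS.rankOne (j v) (j w) := by
  refine HS.ext (ContinuousLinearMap.ext fun x => ?_)
  rw [OpV.toHi_apply, OpV.intoV_rankOne]
  simp

/-- The operators `j v ⊗ j w` come from 𝒱, and their span is dense because the range of `j` is. -/
theorem OpV.denseRange_toHi (hj : DenseRange j) : DenseRange (OpV.toHi j) := by
  refine (HS.dense_span_rankOne hj hj).mono ?_
  have : (Submodule.span ℝ {T : HS H H | ∃ x ∈ range j, ∃ y ∈ range j, T = HS.rankOne x y}) ≤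
      (OpV.toHi j).range := by
    rw [Submodule.span_le]
    rintro _ ⟨_, ⟨v, rfl⟩, _, ⟨w, rfl⟩, rfl⟩
    exact ⟨OpV.rankOne j v w, OpV.toHi_rankOne v w⟩
  exact fun T hT => this hT

instance : CompleteSpace (OpV j) := by
  have : IsClosed (opSubmodule j : Set (WithLp 2 (HS (StrongDual ℝ V) H × HS H V))) := by
    have e : (opSubmodule j : Set (WithLp 2 (HS (StrongDual ℝ V) H × HS H V))) =
        ⋂ h : H, {S | S.fst.toCLM (dualEmb j h) = j (S.snd.toCLM h)} := by
      ext S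
      simp only [mem_iInter]
      rfl
    rw [e]
    refine isClosed_iInter fun h => isClosed_eq ?_ ?_
    · exact ((ContinuousLinearMap.apply ℝ H (dualEmb j h)).comp ((HS.toCLML _ _).comp
        (WithLp.fstL 2 ℝ (HS (StrongDual ℝ V) H) (HS H V)))).continuous
    · exact (j.comp ((ContinuousLinearMap.apply ℝ V h).comp ((HS.toCLML _ _).comp
        (WithLp.sndL 2 ℝ (HS (StrongDual ℝ V) H) (HS H V))))).continuous
  exact this.completeSpace_coe

instance [TopologicalSpace.SeparableSpace V] [TopologicalSpace.SeparableSpace H] :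
    TopologicalSpace.SeparableSpace (OpV j) := by
  have : TopologicalSpace.SeparableSpace (StrongDual ℝ V) :=
    Function.Surjective.denseRange (f := riesz V) (fun f => ⟨rieszInv V f, riesz_rieszInv f⟩)
      |>.separableSpace (riesz V).continuous
  have : TopologicalSpace.SeparableSpace (WithLp 2 (HS (StrongDual ℝ V) H × HS H V)) :=
    (WithLp.homeomorphProd 2 _ _).symm.surjective.denseRange.separableSpace
      (WithLp.homeomorphProd 2 _ _).symm.continuous
  have := UniformSpace.secondCountable_of_separable (WithLp 2 (HS (StrongDual ℝ V) H × HS H V))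
  infer_instance

/-- Each of the components `P` and `P*` alone controls the Hilbert–Schmidt norm on `H` with constant
`C`. The resulting factor 2 compensates the loss `2γ` of the square and makes `γ < μ / C²`
sufficient. -/
theorem OpV.norm_toHi_sq_le {C : ℝ} (hC : 0 ≤ C) (hjC : ∀ v, ‖j v‖ ≤ C * ‖v‖) (P : OpV j) :
    2 * ‖OpV.toHi j P‖ ^ 2 ≤ C ^ 2 * ‖P‖ ^ 2 := by
  have hj : ‖j‖ ≤ C := ContinuousLinearMap.opNorm_le_bound _ hC hjC
  have h1 : ‖OpV.toHi j P‖ ≤ C * ‖OpV.intoV j P‖ :=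
    (HS.norm_compLeft_le j (OpV.intoV j P)).trans (by gcongr)
  have h2 : ‖OpV.toHi j P‖ ≤ C * ‖OpV.coV j P‖ := by
    rw [← HS.norm_adj, ← OpV.toHi_adj]
    exact (HS.norm_compLeft_le j (OpV.intoV j P.adj)).trans (by rw [OpV.intoV_adj]; gcongr)
  have h3 := pow_le_pow_left₀ (norm_nonneg _) h1 2
  have h4 := pow_le_pow_left₀ (norm_nonneg _) h2 2
  rw [OpV.norm_sq]
  rw [mul_pow] at h3 h4
  linarith

end OpVStructure

/-! ### Cell averages of time-dependent forms -/

section FormAverage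

variable {X : Type*} [NormedAddCommGroup X] [InnerProductSpace ℝ X] [CompleteSpace X]
  [TopologicalSpace.SeparableSpace X] {T μ η : ℝ} {L : ℝ → X →L[ℝ] X →L[ℝ] ℝ}

theorem IsUniformForm.intervalIntegrable (hL : IsUniformForm T μ η L) (hT : 0 < T) {N n : ℕ}
    (hn : n < N) (x : X) : IntervalIntegrable (fun s => (L s x : StrongDual ℝ X)) volume
      (n * (T / N)) ((n + 1) * (T / N)) :=
  integrable_intervalIntegrable (memLp_two_integrable (hL.memLp (memLp_const x)))
    (cell_mem hT hn).1 (cell_mem hT hn).2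

theorem IsUniformForm.cellAvg_apply (hL : IsUniformForm T μ η L) (hT : 0 < T) {N n : ℕ}
    (hn : n < N) (x y : X) : (cellAvg (T / N) n fun s => (L s x : StrongDual ℝ X)) y =
      (T / N)⁻¹ * ∫ s in (n * (T / N))..((n + 1) * (T / N)), L s x y := by
  have e := (ContinuousLinearMap.apply ℝ ℝ y).cellAvg_comp (hL.intervalIntegrable hT hn x)
  simp only [ContinuousLinearMap.apply_apply] at e
  rw [← e, cellAvg, smul_eq_mul]

end FormAverage

/-! ### The form of `P ↦ A* P + P A` on 𝒱 -/

section OpForm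

variable {V H : Type*}
  [NormedAddCommGroup V] [InnerProductSpace ℝ V] [CompleteSpace V]
  [NormedAddCommGroup H] [InnerProductSpace ℝ H] [CompleteSpace H] {j : V →L[ℝ] H}

omit [CompleteSpace V] in
theorem norm_form_apply_le {A : V →L[ℝ] V →L[ℝ] ℝ} {η : ℝ}
    (hA : ∀ u v, |A u v| ≤ η * ‖u‖ * ‖v‖) (hη : 0 ≤ η) (S R : HS H V) (k : basisIndex H) :
    ‖A (R.toCLM (basis H k)) (S.toCLM (basis H k))‖ ≤
      η / 2 * (‖R.toCLM (basis H k)‖ ^ 2 + ‖S.toCLM (basis H k)‖ ^ 2) := by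
  refine (hA _ _).trans ?_
  nlinarith [mul_nonneg hη (sq_nonneg (‖R.toCLM (basis H k)‖ - ‖S.toCLM (basis H k)‖))]

omit [CompleteSpace V] in
theorem summable_form_bound (η : ℝ) (S R : HS H V) : Summable fun k : basisIndex H =>
    η / 2 * (‖R.toCLM (basis H k)‖ ^ 2 + ‖S.toCLM (basis H k)‖ ^ 2) :=
  (R.summable.add S.summable).mul_left _

omit [CompleteSpace V] in
theorem form_bound (A : V →L[ℝ] V →L[ℝ] ℝ) (u v : V) : |A u v| ≤ ‖A‖ * ‖u‖ * ‖v‖ :=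
  A.le_opNorm₂ u v

omit [CompleteSpace V] in
theorem summable_form (A : V →L[ℝ] V →L[ℝ] ℝ) (S R : HS H V) :
    Summable fun k : basisIndex H => A (R.toCLM (basis H k)) (S.toCLM (basis H k)) :=
  Summable.of_norm_bounded (summable_form_bound ‖A‖ S R)
    (norm_form_apply_le (form_bound A) (norm_nonneg A) S R)

/-- The form `∑ₖ A(R eₖ, S eₖ)` on Hilbert--Schmidt operators. -/
def hvForm (A : V →L[ℝ] V →L[ℝ] ℝ) (S R : HS H V) : ℝ :=
  ∑' k, A (R.toCLM (basis H k)) (S.toCLM (basis H k))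

/-- Written as a Hilbert–Schmidt inner product, the form is estimated by Cauchy–Schwarz; termwise
bounds would only give a sum of squares. -/
theorem abs_hvForm_le {A : V →L[ℝ] V →L[ℝ] ℝ} {η : ℝ}
    (hA : ∀ u v, |A u v| ≤ η * ‖u‖ * ‖v‖) (hη : 0 ≤ η) (S R : HS H V) :
    |hvForm A S R| ≤ η * (‖S‖ * ‖R‖) := by
  have e : hvForm A S R = inner ℝ (HS.compLeft (rieszInv V) (HS.compLeft A R)) S := by
    rw [HS.inner_def]
    refine tsum_congr fun k => ?_
    rw [HS.toCLM_compLeft, HS.toCLM_compLeft, ContinuousLinearMap.comp_apply, inner_rieszInv]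
    rfl
  have hAn : ‖A‖ ≤ η := A.opNorm_le_bound₂ hη hA
  rw [e]
  refine (abs_real_inner_le_norm _ _).trans ?_
  have h1 := HS.norm_compLeft_le (rieszInv V) (HS.compLeft A R)
  have h2 := HS.norm_compLeft_le A R
  have h3 := norm_rieszInv_le (V := V)
  have h4 : ‖HS.compLeft (rieszInv V) (HS.compLeft A R)‖ ≤ 1 * (η * ‖R‖) :=
    h1.trans (by gcongr; exact h2.trans (by gcongr))
  nlinarith [norm_nonneg S, mul_le_mul_of_nonneg_right h4 (norm_nonneg S)]

theorem le_hvForm_self {A : V →L[ℝ] V →L[ℝ] ℝ} {μ : ℝ} (hA : ∀ u, μ * ‖u‖ ^ 2 ≤ A u u)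
    (S : HS H V) : μ * ‖S‖ ^ 2 ≤ hvForm A S S := by
  rw [HS.norm_sq, ← tsum_mul_left]
  exact (S.summable.mul_left _).tsum_le_tsum (fun k => hA _) (summable_form A S S)

theorem hvForm_add_left (A : V →L[ℝ] V →L[ℝ] ℝ) (S S' R : HS H V) :
    hvForm A (S + S') R = hvForm A S R + hvForm A S' R := by
  rw [hvForm, hvForm, hvForm, ← (summable_form A S R).tsum_add (summable_form A S' R)]
  exact tsum_congr fun k => by simp

omit [CompleteSpace V] in
theorem hvForm_smul_left (A : V →L[ℝ] V →L[ℝ] ℝ) (c : ℝ) (S R : HS H V) :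
    hvForm A (c • S) R = c * hvForm A S R := by
  rw [hvForm, hvForm, ← tsum_mul_left]
  exact tsum_congr fun k => by simp

theorem pairHV_form (A : V →L[ℝ] V →L[ℝ] ℝ) (P R : OpV j) :
    pairHV j (HS.compLeft A.flip (OpV.intoV j P)) R = hvForm A (OpV.intoV j P) (OpV.intoV j R) := by
  rw [pairHV_apply]
  rfl

/-- Taking adjoints moves the sum from a basis of `V` to one of `H` and gives `P A` the same shape
as `A* P`, with `P*` and `R*` as arguments. -/
theorem pairVH_form (A : V →L[ℝ] V →L[ℝ] ℝ) (P R : OpV j) :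
    pairVH j (HS.compRight (OpV.onDual j P) A) R = hvForm A (OpV.coV j P) (OpV.coV j R) := by
  change inner ℝ (HS.compRight (OpV.onDual j P) A) (HS.compRight (OpV.onDual j R) (riesz V)) = _
  rw [← HS.inner_adj, HS.inner_def]
  refine tsum_congr fun k => ?_
  rw [HS.toCLM_adj, HS.toCLM_adj, HS.toCLM_compRight, HS.toCLM_compRight,
    ContinuousLinearMap.adjoint_comp, ContinuousLinearMap.adjoint_comp, adjoint_riesz,
    ContinuousLinearMap.comp_apply, ContinuousLinearMap.adjoint_inner_left,
    ← riesz_rieszInv (ContinuousLinearMap.adjoint (OpV.onDual j P).toCLM (basis H k)),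
    real_inner_comm, inner_riesz]
  rfl

/-- The form `⟨A* P + P A, R⟩` on `HS(V*, H) ∩ HS(H, V)`. -/
def opForm (j : V →L[ℝ] H) (A : V →L[ℝ] V →L[ℝ] ℝ) : OpV j →L[ℝ] OpV j →L[ℝ] ℝ :=
  LinearMap.mkContinuous
    { toFun := fun P => pairHV j (HS.compLeft A.flip (OpV.intoV j P))
        + pairVH j (HS.compRight (OpV.onDual j P) A)
      map_add' := fun P S => by
        ext R
        simp only [add_apply, pairHV_form, pairVH_form]
        rw [map_add, map_add, hvForm_add_left, hvForm_add_left]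
        ring
      map_smul' := fun c P => by
        ext R
        simp only [add_apply, smul_apply, pairHV_form, pairVH_form, smul_eq_mul,
          RingHom.id_apply]
        rw [map_smul, map_smul, hvForm_smul_left, hvForm_smul_left]
        ring } (2 * ‖A‖) (fun P => by
      refine ContinuousLinearMap.opNorm_le_bound _ (by positivity) fun R => ?_
      change |pairHV j (HS.compLeft A.flip (OpV.intoV j P)) R
        + pairVH j (HS.compRight (OpV.onDual j P) A) R| ≤ _
      rw [pairHV_form, pairVH_form]
      have h1 := abs_hvForm_le (form_bound A) (norm_nonneg A) (OpV.intoV j P) (OpV.intoV j R)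
      have h2 := abs_hvForm_le (form_bound A) (norm_nonneg A) (OpV.coV j P) (OpV.coV j R)
      have b : ∀ S : OpV j, ‖OpV.intoV j S‖ ≤ ‖S‖ ∧ ‖OpV.coV j S‖ ≤ ‖S‖ := fun S =>
        ⟨le_of_sq_le_sq (by rw [OpV.norm_sq]; linarith [sq_nonneg ‖OpV.coV j S‖]) (norm_nonneg _),
          le_of_sq_le_sq (by rw [OpV.norm_sq]; linarith [sq_nonneg ‖OpV.intoV j S‖])
            (norm_nonneg _)⟩
      have h3 : ‖OpV.intoV j P‖ * ‖OpV.intoV j R‖ ≤ ‖P‖ * ‖R‖ := by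
        gcongr
        exacts [(b P).1, (b R).1]
      have h4 : ‖OpV.coV j P‖ * ‖OpV.coV j R‖ ≤ ‖P‖ * ‖R‖ := by
        gcongr
        exacts [(b P).2, (b R).2]
      have h5 := mul_le_mul_of_nonneg_left h3 (norm_nonneg A)
      have h6 := mul_le_mul_of_nonneg_left h4 (norm_nonneg A)
      refine (abs_add_le _ _).trans ?_
      linarith)

theorem riccatiOp_eq (A : V →L[ℝ] StrongDual ℝ V) (P : OpV j) :
    riccatiOp j A P = opForm j A P + hiEmb j (OpV.toHi j P).square := rfl

theorem opForm_apply (A : V →L[ℝ] V →L[ℝ] ℝ) (P R : OpV j) : opForm j A P R =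
    hvForm A (OpV.intoV j P) (OpV.intoV j R) + hvForm A (OpV.coV j P) (OpV.coV j R) := by
  rw [← pairHV_form, ← pairVH_form]
  rfl

theorem opForm_adj (A : V →L[ℝ] V →L[ℝ] ℝ) (P R : OpV j) :
    opForm j A P.adj R.adj = opForm j A P R := by
  rw [opForm_apply, opForm_apply]
  simp only [OpV.intoV_adj, OpV.coV_adj]
  ring

theorem le_opForm_self {A : V →L[ℝ] V →L[ℝ] ℝ} {μ : ℝ} (hA : ∀ u, μ * ‖u‖ ^ 2 ≤ A u u)
    (P : OpV j) : μ * ‖P‖ ^ 2 ≤ opForm j A P P := by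
  rw [opForm_apply, OpV.norm_sq, mul_add]
  exact add_le_add (le_hvForm_self hA _) (le_hvForm_self hA _)

/-- The two halves are combined by Cauchy–Schwarz in `ℝ²`, so the constant remains `η`. -/
theorem abs_opForm_le {A : V →L[ℝ] V →L[ℝ] ℝ} {η : ℝ}
    (hA : ∀ u v, |A u v| ≤ η * ‖u‖ * ‖v‖) (hη : 0 ≤ η) (P R : OpV j) :
    |opForm j A P R| ≤ η * ‖P‖ * ‖R‖ := by
  have h1 := abs_hvForm_le hA hη (OpV.intoV j P) (OpV.intoV j R)
  have h2 := abs_hvForm_le hA hη (OpV.coV j P) (OpV.coV j R)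
  rw [opForm_apply]
  refine (abs_add_le _ _).trans ((add_le_add h1 h2).trans ?_)
  rw [← mul_add, mul_assoc]
  gcongr
  refine le_of_sq_le_sq ?_ (by positivity)
  rw [mul_pow ‖P‖, OpV.norm_sq, OpV.norm_sq]
  nlinarith [sq_nonneg (‖OpV.intoV j P‖ * ‖OpV.coV j R‖ - ‖OpV.coV j P‖ * ‖OpV.intoV j R‖)]

variable [TopologicalSpace.SeparableSpace H] {T μ η : ℝ} {a : ℝ → V →L[ℝ] V →L[ℝ] ℝ}

omit [TopologicalSpace.SeparableSpace H] in
theorem hasSum_hvForm (A : V →L[ℝ] V →L[ℝ] ℝ) (S R : HS H V) :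
    HasSum (fun k => A (R.toCLM (basis H k)) (S.toCLM (basis H k))) (hvForm A S R) :=
  (summable_form A S R).hasSum

theorem aemeasurable_hvForm (ha : IsUniformForm T μ η a) (S R : HS H V) :
    AEMeasurable (fun t => hvForm (a t) S R) (volume.restrict (Icc 0 T)) := by
  have : Countable (basisIndex H) := countable_basisIndex H
  refine aemeasurable_of_tendsto_metrizable_ae (atTop : Filter (Finset (basisIndex H)))
    (f := fun s t => ∑ k ∈ s, a t (R.toCLM (basis H k)) (S.toCLM (basis H k))) (fun s => ?_)
    (Eventually.of_forall fun t => hasSum_hvForm (a t) S R)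
  exact Finset.aemeasurable_fun_sum s fun k _ => ha.aemeasurable _ _

theorem isUniformForm_opForm (ha : IsUniformForm T μ η a) (hη : 0 ≤ η) :
    IsUniformForm T μ η fun t => opForm j (a t) where
  pos t ht := le_opForm_self (ha.pos t ht)
  bound t ht := abs_opForm_le (ha.bound t ht) hη
  aemeasurable P R := by
    simp only [opForm_apply]
    exact (aemeasurable_hvForm ha _ _).add (aemeasurable_hvForm ha _ _)

/-- Dominated convergence exchanges the time integral with the sum over the basis of `H`, which is
countable by separability. -/
theorem integral_hvForm (ha : IsUniformForm T μ η a) (hη : 0 ≤ η) {s t : ℝ} (hs : s ∈ Icc 0 T)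
    (ht : t ∈ Icc 0 T) (hst : s ≤ t) (S R : HS H V) :
    (t - s)⁻¹ * ∫ r in s..t, hvForm (a r) S R = hvForm (avgForm a s t) S R := by
  have : Countable (basisIndex H) := countable_basisIndex H
  have hsub : uIoc s t ⊆ Icc 0 T := by
    rw [uIoc_of_le hst]
    exact fun r hr => ⟨hs.1.trans hr.1.le, hr.2.trans ht.2⟩
  have h := intervalIntegral.hasSum_integral_of_dominated_convergence
    (μ := volume) (a := s) (b := t) (f := fun r => hvForm (a r) S R)
    (F := fun k r => a r (R.toCLM (basis H k)) (S.toCLM (basis H k)))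
    (fun k _ => η / 2 * (‖R.toCLM (basis H k)‖ ^ 2 + ‖S.toCLM (basis H k)‖ ^ 2))
    (fun k => ((ha.aemeasurable _ _).aestronglyMeasurable.mono_measure
      (Measure.restrict_mono hsub le_rfl)))
    (fun k => Eventually.of_forall fun r hr =>
      norm_form_apply_le (ha.bound r (hsub hr)) hη S R k)
    (Eventually.of_forall fun r _ => summable_form_bound η S R) intervalIntegrable_const
    (Eventually.of_forall fun r _ => hasSum_hvForm (a r) S R)
  rw [← (h.mul_left (t - s)⁻¹).tsum_eq, hvForm]
  exact tsum_congr fun k => (avgForm_apply ha hs.1 hst ht.2 _ _).symm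

theorem opForm_avgForm (ha : IsUniformForm T μ η a) (hη : 0 ≤ η) {s t : ℝ} (hs : s ∈ Icc 0 T)
    (ht : t ∈ Icc 0 T) (hst : s ≤ t) (P R : OpV j) :
    opForm j (avgForm a s t) P R = (t - s)⁻¹ * ∫ r in s..t, opForm j (a r) P R := by
  have hi : ∀ S R : HS H V, IntervalIntegrable (fun r => hvForm (a r) S R) volume s t := by
    intro S R
    refine integrable_intervalIntegrable ?_ hs ht
    refine Integrable.mono' (integrable_const (η * (‖S‖ * ‖R‖)))
      (aemeasurable_hvForm ha S R).aestronglyMeasurable ?_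
    filter_upwards [ae_timeMeasure_mem T] with r hr
    exact abs_hvForm_le (ha.bound r hr) hη S R
  simp only [opForm_apply]
  rw [intervalIntegral.integral_add (hi _ _) (hi _ _), mul_add, integral_hvForm ha hη hs ht hst,
    integral_hvForm ha hη hs ht hst]

/-- Averaging in time commutes with passing from `V` to 𝒱. This connects the averaged operators
`A_n` with the abstract scheme, which averages forms on 𝒱. -/
theorem opForm_avgForm_eq_cellAvg [TopologicalSpace.SeparableSpace V] (hT : 0 < T)
    (ha : IsUniformForm T μ η a)
    (hη : 0 ≤ η) {N n : ℕ} (hn : n < N) (P : OpV j) :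
    opForm j (avgForm a (n * (T / N)) ((n + 1) * (T / N))) P =
      cellAvg (T / N) n fun s => (opForm j (a s) P : StrongDual ℝ (OpV j)) := by
  have hcm := cell_mem hT hn
  have hN : (0 : ℝ) < N := by exact_mod_cast (by omega : 0 < N)
  have hτ : 0 < T / N := by positivity
  ext R
  rw [(isUniformForm_opForm ha hη).cellAvg_apply hT hn,
    opForm_avgForm ha hη hcm.1 hcm.2 (by nlinarith)]
  congr 2
  ring

end OpForm

/-! ### Lower bounds under linear Euler steps -/

section LowerBound

/-- If all eigenvalues were at least `β`, orthogonality of the eigenspaces would give the quadratic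
lower bound on their span. The span is dense by the spectral theorem for compact operators, so the
bound would hold everywhere. -/
theorem exists_eigenvector_lt {E : Type*} [NormedAddCommGroup E] [InnerProductSpace ℝ E]
    [CompleteSpace E] {A : E →L[ℝ] E} (hA : IsCompactOperator A) (hA' : A.IsSymmetric) {β : ℝ}
    (h : ∃ x, inner ℝ (A x) x < β * ‖x‖ ^ 2) : ∃ l < β, ∃ x, x ≠ 0 ∧ A x = l • x := by
  by_contra! hc
  have hdense : Dense ((⨆ l, Module.End.eigenspace (A : Module.End ℝ E) l : Submodule ℝ E) :
      Set E) := by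
    rw [Submodule.dense_iff_topologicalClosure_eq_top, Submodule.topologicalClosure_eq_top_iff]
    exact ContinuousLinearMap.orthogonalComplement_iSup_eigenspaces_eq_bot hA hA'
  have hclosed : IsClosed {x | β * ‖x‖ ^ 2 ≤ inner ℝ (A x) x} :=
    isClosed_le (by fun_prop) (A.continuous.inner continuous_id)
  obtain ⟨x, hx⟩ := h
  refine absurd (hclosed.closure_subset_iff.2 ?_ (hdense x)) (not_le.2 hx)
  intro y hy
  obtain ⟨f, hf, rfl⟩ := (Submodule.mem_iSup_iff_exists_finsupp _ _).1 hy
  have hfl : ∀ l, A (f l) = l • f l := fun l => Module.End.mem_eigenspace_iff.1 (hf l)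
  have ho : ∀ l l', l ≠ l' → inner ℝ (f l) (f l') = 0 := fun l l' hl =>
    hA'.orthogonalFamily_eigenspaces hl ⟨f l, hf l⟩ ⟨f l', hf l'⟩
  have hsum : ∀ g : ℝ → E, (∀ l, ∃ c : ℝ, g l = c • f l) →
      inner ℝ (∑ l ∈ f.support, g l) (∑ l ∈ f.support, f l) =
        ∑ l ∈ f.support, inner ℝ (g l) (f l) := by
    intro g hg
    rw [sum_inner]
    refine Finset.sum_congr rfl fun l hl => ?_
    rw [inner_sum]
    refine Finset.sum_eq_single l (fun l' _ hl' => ?_) (fun h => absurd hl h)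
    obtain ⟨c, hc⟩ := hg l
    rw [hc, inner_smul_left, ho l l' hl'.symm, mul_zero]
  change β * ‖∑ l ∈ f.support, f l‖ ^ 2 ≤ inner ℝ (A (∑ l ∈ f.support, f l)) (∑ l ∈ f.support, f l)
  rw [← real_inner_self_eq_norm_sq, map_sum, hsum _ fun l => ⟨1, (one_smul _ _).symm⟩,
    hsum _ fun l => ⟨l, hfl l⟩, Finset.mul_sum]
  refine Finset.sum_le_sum fun l hl => ?_
  rw [hfl, inner_smul_left, conj_trivial]
  refine mul_le_mul_of_nonneg_right ?_ real_inner_self_nonneg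
  by_contra! hlt
  exact hc l hlt (f l) (Finsupp.mem_support_iff.1 hl) (hfl l)

variable {V H : Type*}
  [NormedAddCommGroup V] [InnerProductSpace ℝ V] [CompleteSpace V]
  [NormedAddCommGroup H] [InnerProductSpace ℝ H] [CompleteSpace H] {j : V →L[ℝ] H}

/-- Symmetric functionals on `HS(V*, H) ∩ HS(H, V)` that are bounded below by `-β` on the
operators `v ⊗ v`. -/
def dualCone (j : V →L[ℝ] H) (β : ℝ) : Set (StrongDual ℝ (OpV j)) :=
  {F | (∀ R : OpV j, F R.adj = F R) ∧ ∀ v, -β * ‖j v‖ ^ 2 ≤ F (OpV.rankOne j v v)}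

theorem continuous_eval_dual {X : Type*} [NormedAddCommGroup X] [NormedSpace ℝ X] (R : X) :
    Continuous fun F : StrongDual ℝ X => F R :=
  (ContinuousLinearMap.apply ℝ ℝ R).continuous

theorem isClosed_dualCone (β : ℝ) : IsClosed (dualCone j β) := by
  have : dualCone j β = (⋂ R : OpV j, {F | F R.adj = F R}) ∩
      ⋂ v, {F | -β * ‖j v‖ ^ 2 ≤ F (OpV.rankOne j v v)} := by
    ext F
    simp only [mem_inter_iff, mem_iInter]
    rfl
  rw [this]
  exact (isClosed_iInter fun R => isClosed_eq (continuous_eval_dual _) (continuous_eval_dual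
      _)).inter
    (isClosed_iInter fun v => isClosed_le continuous_const (continuous_eval_dual _))

theorem add_mem_dualCone {β β' : ℝ} {F F' : StrongDual ℝ (OpV j)} (hF : F ∈ dualCone j β)
    (hF' : F' ∈ dualCone j β') : F + F' ∈ dualCone j (β + β') := by
  constructor
  · intro R
    rw [add_apply, add_apply, hF.1, hF'.1]
  · intro v
    rw [add_apply]
    linarith [hF.2 v, hF'.2 v]

theorem convex_dualCone (β : ℝ) : Convex ℝ (dualCone j β) := by
  intro F hF F' hF' s t hs ht hst
  constructor
  · intro R
    simp only [add_apply, smul_apply, hF.1 R, hF'.1 R]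
  · intro v
    simp only [add_apply, smul_apply, smul_eq_mul]
    have h1 := mul_le_mul_of_nonneg_left (hF.2 v) hs
    have h2 := mul_le_mul_of_nonneg_left (hF'.2 v) ht
    have h3 : -β * ‖j v‖ ^ 2 = s * (-β * ‖j v‖ ^ 2) + t * (-β * ‖j v‖ ^ 2) := by
      rw [← add_mul, hst, one_mul]
    linarith

theorem hiEmb_apply (Q : HS H H) (R : OpV j) : hiEmb j Q R = inner ℝ Q (OpV.toHi j R) := rfl

theorem hiEmb_mem_dualCone {β : ℝ} {Q : HS H H} (hQ : Q ∈ lowerCone H β) :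
    hiEmb j Q ∈ dualCone j β := by
  constructor
  · intro R
    rw [hiEmb_apply, hiEmb_apply, OpV.toHi_adj, ← HS.inner_adj, HS.adj_adj,
      HS.adj_eq_of_isSelfAdjoint hQ.1]
  · intro v
    rw [hiEmb_apply, OpV.toHi_rankOne, HS.inner_rankOne]
    exact hQ.2 _

omit [CompleteSpace V] in
theorem hvForm_rankOne_right (A : V →L[ℝ] V →L[ℝ] ℝ) (S : HS H V) (h : H) (v : V) :
    hvForm A S (HS.rankOne h v) = A v (S.toCLM h) := by
  have h1 := ((A v).comp S.toCLM).hasSum ((basis H).hasSum_repr h)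
  rw [hvForm]
  have h2 := h1.tsum_eq
  simp only [ContinuousLinearMap.comp_apply, map_smul, HilbertBasis.repr_apply_apply] at h2
  rw [← h2]
  refine tsum_congr fun k => ?_
  rw [HS.rankOne_apply, map_smul, smul_apply, real_inner_comm]

/-- A step of the linear implicit Euler scheme preserves self-adjointness and lower bounds. -/
theorem mem_lowerCone_of_linear_step (hjc : IsCompactOperator j)
    {C μ γ κ s : ℝ} (hC : 0 < C) (hjC : ∀ v, ‖j v‖ ≤ C * ‖v‖) (hμ : 0 < μ) (hγ : 0 ≤ γ)
    (hγμ : γ ≤ μ / C ^ 2) (hκ : 0 ≤ κ) (hs : 0 < s)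
    {A : V →L[ℝ] V →L[ℝ] ℝ} (hA : ∀ u, μ * ‖u‖ ^ 2 ≤ A u u) {Y : HS H H}
    (hY : Y ∈ lowerCone H γ) {F : StrongDual ℝ (OpV j)} (hF : F ∈ dualCone j (2 * γ ^ 2 + κ * γ))
    {y : OpV j} (h : s • hiEmb j (OpV.toHi j y - Y) + opForm j A y + κ • hiEmb j (OpV.toHi j y) =
        F) :
    OpV.toHi j y ∈ lowerCone H γ := by
  have heq : ∀ R, s * inner ℝ (OpV.toHi j y - Y) (OpV.toHi j R) + opForm j A y R
      + κ * inner ℝ (OpV.toHi j y) (OpV.toHi j R) = F R := fun R =>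
    congrArg (fun F : StrongDual ℝ (OpV j) => F R) h
  -- symmetry
  have hsym : y.adj = y := by
    have hYa := HS.adj_eq_of_isSelfAdjoint hY.1
    -- The equation is invariant under adjoints because `Y`, `F` and the form are, so `y.adj` solves
    -- it as well; coercivity applied to the difference gives uniqueness.
    have heq' : ∀ R, s * inner ℝ (OpV.toHi j y.adj - Y) (OpV.toHi j R) + opForm j A y.adj R
        + κ * inner ℝ (OpV.toHi j y.adj) (OpV.toHi j R) = F R := by
      intro R
      have e1 := heq R.adj
      rw [hF.1, OpV.toHi_adj] at e1
      rw [← e1, ← opForm_adj A y.adj R, OpV.adj_adj, OpV.toHi_adj, ← HS.inner_adj _ (OpV.toHi j R),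
        ← HS.inner_adj (OpV.toHi j y).adj, HS.adj_adj]
      congr 3
      have : ((OpV.toHi j y).adj - Y).adj = (OpV.toHi j y).adj.adj - Y.adj :=
        map_sub (HS.adjL H H) _ _
      rw [this, hYa, HS.adj_adj]
    have h1 := heq (y.adj - y)
    have h2 := heq' (y.adj - y)
    rw [← sub_eq_zero, ← norm_eq_zero, ← sq_eq_zero_iff]
    have h3 := le_opForm_self hA (y.adj - y)
    have h4 : s * ‖OpV.toHi j (y.adj - y)‖ ^ 2 + opForm j A (y.adj - y) (y.adj - y)
        + κ * ‖OpV.toHi j (y.adj - y)‖ ^ 2 = 0 := by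
      rw [← real_inner_self_eq_norm_sq]
      have e : inner ℝ (OpV.toHi j (y.adj - y)) (OpV.toHi j (y.adj - y)) =
          inner ℝ (OpV.toHi j y.adj) (OpV.toHi j (y.adj - y))
            - inner ℝ (OpV.toHi j y) (OpV.toHi j (y.adj - y)) := by
        rw [← inner_sub_left, ← map_sub]
      have e2 : opForm j A (y.adj - y) (y.adj - y) =
          opForm j A y.adj (y.adj - y) - opForm j A y (y.adj - y) := by
        exact congrArg (fun F : StrongDual ℝ (OpV j) => F (y.adj - y)) (map_sub (opForm j A) y.adj
            y)
      rw [e, e2]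
      rw [inner_sub_left] at h1 h2
      linarith
    have h5 : 0 ≤ s * ‖OpV.toHi j (y.adj - y)‖ ^ 2 := by positivity
    have h6 : 0 ≤ κ * ‖OpV.toHi j (y.adj - y)‖ ^ 2 := by positivity
    have h7 : μ * ‖y.adj - y‖ ^ 2 ≤ 0 := by linarith
    exact le_antisymm (nonpos_of_mul_nonpos_right h7 hμ) (by positivity)
  have hsa : IsSelfAdjoint (OpV.toHi j y).toCLM := by
    rw [HS.isSelfAdjoint_iff_adj_eq, ← OpV.toHi_adj, hsym]
  refine ⟨hsa, ?_⟩
  by_contra! hneg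
  -- The operator factors through the compact embedding `j`.
  have hcomp : IsCompactOperator (OpV.toHi j y).toCLM := by
    rw [OpV.toHi_apply]
    exact hjc.comp_clm _
  obtain ⟨l, hl, x, hx0, hx⟩ := exists_eigenvector_lt hcomp
    ((ContinuousLinearMap.isSelfAdjoint_iff_isSymmetric).1 hsa) hneg
  have hl0 : l < 0 := by linarith
  -- Since `l ≠ 0`, the eigenvector `x = l⁻¹ P x` lies in the image of `V`, which makes `v ⊗ v` an
  -- admissible test operator.
  set v := l⁻¹ • (OpV.intoV j y).toCLM x with hv
  have hjv : j v = x := by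
    have : j ((OpV.intoV j y).toCLM x) = l • x := hx
    rw [hv, map_smul, this, smul_smul, inv_mul_cancel₀ hl0.ne, one_smul]
  have hlv : (OpV.intoV j y).toCLM x = l • v := by
    rw [hv, smul_smul, mul_inv_cancel₀ hl0.ne, one_smul]
  have hco : OpV.coV j y = OpV.intoV j y := by
    rw [← OpV.intoV_adj, hsym]
  have e1 : opForm j A y (OpV.rankOne j v v) = 2 * (l * A v v) := by
    rw [opForm_apply, hco, OpV.intoV_rankOne, OpV.coV_rankOne, hvForm_rankOne_right, hjv, hlv,
      map_smul, smul_eq_mul]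
    ring
  have e2 := heq (OpV.rankOne j v v)
  have hxn : 0 < ‖x‖ := norm_pos_iff.2 hx0
  rw [e1, OpV.toHi_rankOne, HS.inner_rankOne, HS.inner_rankOne, hjv, HS.toCLM_sub, sub_apply,
    inner_sub_left, hx, inner_smul_left, conj_trivial, real_inner_self_eq_norm_sq] at e2
  have e3 := hF.2 v
  rw [hjv] at e3
  have e4 := hY.2 x
  have e5 : μ / C ^ 2 * ‖x‖ ^ 2 ≤ A v v := by
    refine le_trans ?_ (hA v)
    have := hjC v
    rw [hjv] at this
    have h2 := pow_le_pow_left₀ (norm_nonneg _) this 2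
    rw [mul_pow] at h2
    calc μ / C ^ 2 * ‖x‖ ^ 2 ≤ μ / C ^ 2 * (C ^ 2 * ‖v‖ ^ 2) := by gcongr
      _ = _ := by field_simp
  have hx2 : 0 < ‖x‖ ^ 2 := by positivity
  -- The tested equation has a term `2 l A(v, v)`. With `l < -γ` and `A(v, v) ≥ γ ‖x‖²` it is at
  -- most `-2γ² ‖x‖²`, which matches the lower bound of `F` together with `e8`; the strict
  -- inequality `e7` then gives the contradiction.
  have e6 : l * A v v ≤ -γ * (γ * ‖x‖ ^ 2) := by
    have a1 : γ * ‖x‖ ^ 2 ≤ A v v := le_trans (by gcongr) e5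
    have a2 : 0 ≤ γ * ‖x‖ ^ 2 := by positivity
    have a3 : 0 ≤ A v v := a2.trans a1
    calc l * A v v ≤ -γ * A v v := mul_le_mul_of_nonneg_right hl.le a3
      _ ≤ -γ * (γ * ‖x‖ ^ 2) := mul_le_mul_of_nonpos_left a1 (neg_nonpos.2 hγ)
  have e7 : s * (l * ‖x‖ ^ 2 - inner ℝ (Y.toCLM x) x) < 0 := by
    refine mul_neg_of_pos_of_neg hs ?_
    have := mul_lt_mul_of_pos_right hl hx2
    linarith
  have e8 : κ * (l * ‖x‖ ^ 2) ≤ κ * (-γ * ‖x‖ ^ 2) := by gcongr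
  linarith

/-- For `κ` large, `κ P - P²` is bounded below on the cone. -/
theorem smul_sub_square_mem_lowerCone {γ κ : ℝ} {P : HS H H} (hP : P ∈ lowerCone H γ)
    (hκ0 : 0 < κ) (hκ : ‖P‖ + 2 * γ ≤ κ) (hγ : 0 ≤ γ) :
    κ • P - P.square ∈ lowerCone H (κ * γ + γ ^ 2) := by
  have hsym := mem_lowerCone_iff.1 hP
  rw [mem_lowerCone_iff]
  constructor
  · intro x y
    simp only [HS.toCLM_sub, HS.toCLM_smul, HS.square, HS.toCLM_compLeft, sub_apply, smul_apply,
      ContinuousLinearMap.comp_apply, inner_sub_left, inner_sub_right, inner_smul_left,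
      inner_smul_right, conj_trivial, hsym.1]
  · intro x
    simp only [HS.toCLM_sub, HS.toCLM_smul, HS.square, HS.toCLM_compLeft, sub_apply, smul_apply,
      ContinuousLinearMap.comp_apply, inner_sub_left, inner_smul_left, conj_trivial]
    -- In terms of `b = (P + γ) x` the claim reads `‖b‖² ≤ (κ + 2γ) ⟪b, x⟫`; it follows from `(P +
    -- γ)² ≤ κ (P + γ)`.
    set b := P.toCLM x + γ • x with hb
    have hPx : P.toCLM x = b - γ • x := by rw [hb]; abel
    have hPb : inner ℝ (P.toCLM b) b ≤ ‖P‖ * ‖b‖ ^ 2 := by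
      have h1 := real_inner_le_norm (P.toCLM b) b
      have h2 := P.norm_apply_le b
      nlinarith [norm_nonneg b]
    -- Nonnegativity of `P + γ` at `κ x - b` reads `κ² ⟪b, x⟫ - 2κ ‖b‖² + ⟪(P + γ) b, b⟫ ≥ 0`, and
    -- the last term is at most `(κ - γ) ‖b‖²`.
    have h1 := hsym.2 (κ • x - b)
    have h2 : inner ℝ (P.toCLM b) x = inner ℝ b b - γ * inner ℝ b x := by
      rw [hsym.1, hPx, inner_sub_right, inner_smul_right]
    have h3 : inner ℝ (P.toCLM (P.toCLM x)) x = inner ℝ b b - 2 * γ * inner ℝ b x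
        + γ ^ 2 * inner ℝ x x := by
      rw [hsym.1, hPx]
      simp only [inner_sub_left, inner_sub_right, inner_smul_left, inner_smul_right, conj_trivial]
      rw [real_inner_comm b x]
      ring
    have h4 : inner ℝ (P.toCLM x) x = inner ℝ b x - γ * inner ℝ x x := by
      rw [hPx, inner_sub_left, inner_smul_left, conj_trivial]
    have h5 : inner ℝ (P.toCLM x) b = inner ℝ (P.toCLM b) x := by
      rw [hsym.1, real_inner_comm]
    have h6 : ‖κ • x - b‖ ^ 2 = κ ^ 2 * inner ℝ x x - 2 * κ * inner ℝ b x + inner ℝ b b := by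
      rw [← real_inner_self_eq_norm_sq]
      simp only [inner_sub_left, inner_sub_right, inner_smul_left, inner_smul_right, conj_trivial]
      rw [real_inner_comm b x]
      ring
    have h7 : inner ℝ (P.toCLM (κ • x - b)) (κ • x - b) = κ ^ 2 * inner ℝ (P.toCLM x) x
        - 2 * κ * inner ℝ (P.toCLM b) x + inner ℝ (P.toCLM b) b := by
      rw [map_sub, map_smul]
      simp only [inner_sub_left, inner_sub_right, inner_smul_left, inner_smul_right, conj_trivial]
      rw [h5]
      ring
    rw [h6, h7, h2, h4] at h1
    rw [h3, h4, ← real_inner_self_eq_norm_sq]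
    rw [← real_inner_self_eq_norm_sq b] at hPb
    have hb0 : 0 ≤ inner ℝ b b := real_inner_self_nonneg
    -- `κ² ⟪b, x⟫ ≥ κ |b|²`
    have h8 : κ * inner ℝ b b ≤ κ * (κ * inner ℝ b x) := by
      have h9 : ‖P‖ * inner ℝ b b ≤ (κ - 2 * γ) * inner ℝ b b :=
        mul_le_mul_of_nonneg_right (by linarith) hb0
      nlinarith [mul_nonneg hγ hb0]
    have h10 := le_of_mul_le_mul_left h8 hκ0
    have h11 : 0 ≤ inner ℝ b x := by
      by_contra! hneg
      nlinarith
    nlinarith [mul_nonneg hγ h11]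

/-- For `κ` large, `P ↦ κ P - P²` is Lipschitz continuous on bounded subsets of the cone, with a
constant close to `κ + 2γ`. -/
theorem norm_smul_sub_square_sub_le {γ κ ε M : ℝ} {P S : HS H H} (hγ : 0 ≤ γ) (hε : 0 < ε)
    (hκ : 0 ≤ κ)
    (hκM : 2 * M ^ 2 ≤ κ * ε) (hP : P ∈ lowerCone H γ) (hS : S ∈ lowerCone H γ) (hPM : ‖P‖ ≤ M)
    (hSM : ‖S‖ ≤ M) :
    ‖(κ • P - P.square) - (κ • S - S.square)‖ ≤ (κ + 2 * γ + ε) * ‖P - S‖ := by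
  have e : (κ • P - P.square) - (κ • S - S.square) = κ • (P - S) - (P.square - S.square) := by
    rw [smul_sub]
    abel
  have hM : 0 ≤ M := (norm_nonneg P).trans hPM
  have h1 := HS.square_monotone hP hS
  have h2 : ‖P.square - S.square‖ ≤ 2 * M * ‖P - S‖ := by
    have a1 := HS.norm_compLeft_le P.toCLM (P - S)
    have a2 := HS.norm_compRight_le (P - S) S.toCLM
    have a3 := mul_le_mul_of_nonneg_right (P.norm_toCLM_le.trans hPM) (norm_nonneg (P - S))
    have a4 := mul_le_mul_of_nonneg_right (S.norm_toCLM_le.trans hSM) (norm_nonneg (P - S))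
    rw [HS.square_sub_square]
    refine (norm_add_le _ _).trans ?_
    linarith
  have h3 := pow_le_pow_left₀ (norm_nonneg _) h2 2
  have h3' : 0 ≤ κ + 2 * γ + ε := by positivity
  -- For `D = P - S`, monotonicity bounds the cross term in `‖κ D - (P² - S²)‖²` by `4κγ ‖D‖²`, and
  -- the last square is at most `4M² ‖D‖² ≤ 2κε ‖D‖²`. The total `κ² + 4κγ + 2κε` is below `(κ + 2γ
  -- + ε)²`.
  refine le_of_sq_le_sq ?_ (by positivity)
  rw [e, norm_sub_sq_real, norm_smul, inner_smul_left, real_inner_comm, conj_trivial,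
    Real.norm_of_nonneg hκ, mul_pow, mul_pow]
  have h4 : 0 ≤ ‖P - S‖ ^ 2 := by positivity
  have h5 := mul_le_mul_of_nonneg_left h1 hκ
  have h6 := mul_le_mul_of_nonneg_right hκM h4
  have h7 : 0 ≤ (2 * γ + ε) ^ 2 * ‖P - S‖ ^ 2 := by positivity
  rw [mul_pow] at h3
  nlinarith

end LowerBound

/-! ### The linear Euler scheme with damping -/

section LinearEuler

variable {X Y : Type*} [NormedAddCommGroup X] [InnerProductSpace ℝ X] [CompleteSpace X]
  [NormedAddCommGroup Y] [InnerProductSpace ℝ Y] [CompleteSpace Y]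
  {i : X →L[ℝ] Y} {T μ η : ℝ} {L : ℝ → X →L[ℝ] X →L[ℝ] ℝ}
  {G : Y → Y} {f₁ : ℝ → Y} {f₂ : ℝ → StrongDual ℝ X} {y₀ : Y} {K : Set Y}

theorem exists_eq_of_coercive {B : X →L[ℝ] X →L[ℝ] ℝ} {μ : ℝ} (hμ : 0 < μ)
    (hB : ∀ x, μ * ‖x‖ ^ 2 ≤ B x x) (F : StrongDual ℝ X) : ∃ x, B x = F := by
  have hc : IsCoercive B := ⟨μ, hμ, fun x => by simpa [sq, mul_assoc] using hB x⟩
  refine ⟨hc.continuousLinearEquivOfBilin.symm (rieszInv X F), ?_⟩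
  ext y
  rw [← hc.continuousLinearEquivOfBilin_apply, ContinuousLinearEquiv.apply_symm_apply,
    inner_rieszInv]

-- The scheme is solved node by node, as membership in `K` is passed on from each step to the next.
omit [CompleteSpace X] [CompleteSpace Y] in
theorem exists_isEuler_of_step {N : ℕ} (hy₀ : y₀ ∈ K)
    (hstep : ∀ n < N, ∀ y ∈ K, ∃ x, i x ∈ K ∧
      (T / N)⁻¹ • dualEmb i (i x - y) + cellAvg (T / N) n (fun s => (L s x : StrongDual ℝ X))
        + dualEmb i (G (i x)) = cellAvg (T / N) n fun s => dualEmb i (f₁ s) + f₂ s) :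
    ∃ p, IsEuler i T L G f₁ f₂ y₀ K N p := by
  have hstep' : ∀ (n : ℕ) (y : Y), ∃ x, n < N → y ∈ K → i x ∈ K ∧
      (T / N)⁻¹ • dualEmb i (i x - y) + cellAvg (T / N) n (fun s => (L s x : StrongDual ℝ X))
        + dualEmb i (G (i x)) = cellAvg (T / N) n fun s => dualEmb i (f₁ s) + f₂ s := by
    intro n y
    by_cases h : n < N ∧ y ∈ K
    · obtain ⟨x, hx⟩ := hstep n h.1 y h.2
      exact ⟨x, fun _ _ => hx⟩
    -- The default `0` makes the step a total function; it is never reached along the recursion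
    -- started in `K`.
    · exact ⟨0, fun h1 h2 => absurd ⟨h1, h2⟩ h⟩
  choose next hnext using hstep'
  let q : ℕ → Y := fun n => Nat.rec y₀ (fun n y => i (next n y)) n
  have hq : ∀ n ≤ N, q n ∈ K := by
    intro n hn
    induction n with
    | zero => exact hy₀
    | succ n ih => exact (hnext n (q n) (by omega) (ih (by omega))).1
  have hnodes : ∀ n, nodes i y₀ (fun n => next n (q n)) n = q n := by
    intro n
    cases n <;> rfl
  refine ⟨fun n => next n (q n), fun n hn => (hnext n (q n) hn (hq n hn.le)).1, fun n hn => ?_⟩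
  rw [hnodes n]
  exact (hnext n (q n) hn (hq n hn.le)).2

variable [TopologicalSpace.SeparableSpace X]

theorem avgForm_eq_cellAvg (hL : IsUniformForm T μ η L) (hT : 0 < T) {N n : ℕ} (hn : n < N)
    (x : X) : avgForm L (n * (T / N)) ((n + 1) * (T / N)) x =
      cellAvg (T / N) n fun s => (L s x : StrongDual ℝ X) := by
  have hcm := cell_mem hT hn
  have hN : (0 : ℝ) < N := by exact_mod_cast (by omega : 0 < N)
  have hτ : 0 < T / N := by positivity
  ext y
  rw [hL.cellAvg_apply hT hn, avgForm_apply hL hcm.1.1 (by nlinarith) hcm.2.2]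
  congr 2
  ring

theorem le_avgForm_self (hL : IsUniformForm T μ η L) (hT : 0 < T) {N n : ℕ} (hn : n < N)
    (x : X) : μ * ‖x‖ ^ 2 ≤ avgForm L (n * (T / N)) ((n + 1) * (T / N)) x x := by
  have hcm := cell_mem hT hn
  have hN : (0 : ℝ) < N := by exact_mod_cast (by omega : 0 < N)
  have hτ : 0 < T / N := by positivity
  have hint := hL.intervalIntegrable hT hn x
  have e1 := (ContinuousLinearMap.apply ℝ ℝ x).cellAvg_comp hint
  simp only [ContinuousLinearMap.apply_apply] at e1
  rw [avgForm_eq_cellAvg hL hT hn, ← e1]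
  refine le_cellAvg hτ ⟨?_, ?_⟩ fun t ht => hL.pos t (cell_subset hT hn ht) x
  exacts [(ContinuousLinearMap.apply ℝ ℝ x).integrable_comp hint.1,
    (ContinuousLinearMap.apply ℝ ℝ x).integrable_comp hint.2]

-- Lax–Milgram: the difference quotient and the damping add nonnegative multiples of `i* i` to the
-- averaged coercive form.
omit [CompleteSpace Y] in
theorem exists_linear_step (hT : 0 < T) (hμ : 0 < μ) (hL : IsUniformForm T μ η L) {N n : ℕ}
    (hn : n < N) {κ : ℝ} (hκ : 0 ≤ κ) (y : Y) (F : StrongDual ℝ X) :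
    ∃ x, (T / N)⁻¹ • dualEmb i (i x - y) + cellAvg (T / N) n (fun s => (L s x : StrongDual ℝ X))
        + dualEmb i (κ • i x) = F := by
  have hN : (0 : ℝ) < N := by exact_mod_cast (by omega : 0 < N)
  have hτ : 0 < T / N := by positivity
  obtain ⟨x, hx⟩ := exists_eq_of_coercive (B := ((T / N)⁻¹ + κ) • (dualEmb i).comp i
    + avgForm L (n * (T / N)) ((n + 1) * (T / N))) hμ (fun x => by
      refine (le_avgForm_self hL hT hn x).trans ?_
      simp only [add_apply, smul_apply, ContinuousLinearMap.comp_apply, dualEmb_apply, smul_eq_mul,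
        real_inner_self_eq_norm_sq]
      have : 0 ≤ ((T / N)⁻¹ + κ) * ‖i x‖ ^ 2 := by positivity
      linarith) (F + (T / N)⁻¹ • dualEmb i y)
  refine ⟨x, ?_⟩
  rw [add_apply, smul_apply, ContinuousLinearMap.comp_apply, avgForm_eq_cellAvg hL hT hn] at hx
  rw [map_sub, map_smul, smul_sub, ← sub_eq_iff_eq_add.2 hx, add_smul]
  abel

-- The step is tested with `x`; through `m`, coercivity in `X` acts as extra damping in `Y`.
omit [CompleteSpace Y] in
theorem linear_step_norm_le (hT : 0 < T) (hL : IsUniformForm T μ η L) {N n : ℕ} (hn : n < N)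
    {κ m : ℝ} (hm : ∀ x, m * ‖i x‖ ^ 2 ≤ μ * ‖x‖ ^ 2) {x : X} {y g : Y}
    (h : (T / N)⁻¹ • dualEmb i (i x - y) + cellAvg (T / N) n (fun s => (L s x : StrongDual ℝ X))
        + dualEmb i (κ • i x) = dualEmb i g) :
    ((T / N)⁻¹ + κ + m) * ‖i x‖ ≤ (T / N)⁻¹ * ‖y‖ + ‖g‖ := by
  have hN : (0 : ℝ) < N := by exact_mod_cast (by omega : 0 < N)
  have hτ : 0 < T / N := by positivity
  have h1 := congrArg (fun F : StrongDual ℝ X => F x) h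
  have h2 := le_avgForm_self hL hT hn x
  rw [avgForm_eq_cellAvg hL hT hn] at h2
  simp only [add_apply, smul_apply, dualEmb_apply, smul_eq_mul, inner_sub_left, inner_smul_left,
    conj_trivial, real_inner_self_eq_norm_sq] at h1
  have h3 := real_inner_le_norm y (i x)
  have h4 := real_inner_le_norm g (i x)
  have h5 := hm x
  have h6 : (T / N)⁻¹ * inner ℝ y (i x) ≤ (T / N)⁻¹ * (‖y‖ * ‖i x‖) := by gcongr
  have h7 : ((T / N)⁻¹ + κ + m) * ‖i x‖ * ‖i x‖ ≤ ((T / N)⁻¹ * ‖y‖ + ‖g‖) * ‖i x‖ := by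
    linarith
  rcases (norm_nonneg (i x)).eq_or_lt with h0 | h0
  · rw [← h0, mul_zero]
    positivity
  · exact le_of_mul_le_mul_right h7 h0

omit [CompleteSpace Y] in
theorem exists_linear_isEuler (hT : 0 < T) (hμ : 0 < μ) (hL : IsUniformForm T μ η L) {κ : ℝ}
    (hκ : 0 ≤ κ) (N : ℕ) : ∃ p, IsEuler i T L (fun y => κ • y) f₁ f₂ y₀ univ N p :=
  exists_isEuler_of_step (mem_univ _) fun _ hn y _ => by
    obtain ⟨x, hx⟩ := exists_linear_step hT hμ hL hn hκ y _
    exact ⟨x, mem_univ _, hx⟩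

omit [InnerProductSpace ℝ Y] [CompleteSpace Y] in
theorem lipschitzOnBalls_smul [NormedSpace ℝ Y] (κ : ℝ) : LipschitzOnBalls fun y : Y => κ • y :=
  fun _ => ⟨|κ|, abs_nonneg κ, fun y z _ _ => by
    rw [← smul_sub, norm_smul, Real.norm_eq_abs]⟩

theorem exists_cell {T : ℝ} (hT : 0 < T) {N : ℕ} (hN : 0 < N) {t : ℝ} (ht : t ∈ Icc 0 T) :
    ∃ n < N, t ∈ Icc (n * (T / N)) ((n + 1) * (T / N)) := by
  have hN' : (0 : ℝ) < N := by exact_mod_cast hN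
  have hτ : 0 < T / N := by positivity
  rcases ht.2.eq_or_lt with h | h
  -- At `t = T` the floor of `t / τ` would be `N`, which is not the index of a cell.
  · refine ⟨N - 1, by omega, ?_⟩
    rw [h, Nat.cast_sub hN, Nat.cast_one, sub_add_cancel, mul_div_cancel₀ _ hN'.ne']
    exact ⟨by rw [sub_mul, mul_div_cancel₀ _ hN'.ne']; linarith, le_rfl⟩
  · refine ⟨⌊t / (T / N)⌋₊, ?_, ?_, ?_⟩
    · rw [Nat.floor_lt (by have := ht.1; positivity), div_lt_iff₀ hτ, mul_div_cancel₀ _ hN'.ne']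
      exact h
    · rw [← le_div_iff₀ hτ]
      exact Nat.floor_le (by have := ht.1; positivity)
    · rw [← div_le_iff₀ hτ]
      exact (Nat.lt_floor_add_one _).le

theorem exists_small_step {T : ℝ} {δ : ℝ} (hδ : 0 < δ) :
    ∃ N : ℕ, 0 < N ∧ T / N < δ := by
  have h := (tendsto_const_div_atTop_nhds_zero_nat T).eventually_lt_const hδ
  obtain ⟨N, h1, h2⟩ := (h.and (eventually_gt_atTop 0)).exists
  exact ⟨N, h2, h1⟩

/-- A solution of the linear problem with damping lies in every closed set that contains the
values of the implicit Euler scheme. -/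
theorem IsSol.mem_of_euler {κ : ℝ} {P : ℝ → Y} {u : ℝ → X} (hT : 0 < T) (hμ : 0 < μ)
    (hL : IsUniformForm T μ η L)
    (hf₁ : MemLp f₁ 1 (timeMeasure T)) (hf₂ : MemLp f₂ 2 (timeMeasure T)) (hκ : 0 ≤ κ)
    (hs : IsSol i T L (fun s => f₁ s - κ • P s) f₂ y₀ P u) (hK : IsClosed K)
    (hE : ∀ N p, IsEuler i T L (fun y => κ • y) f₁ f₂ y₀ univ N p → ∀ n < N, i (p n) ∈ K) :
    ∀ t ∈ Icc 0 T, P t ∈ K := by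
  intro t ht
  rw [← hK.closure_eq, Metric.mem_closure_iff]
  intro ε hε
  -- For `κ ≥ 0` the damping is monotone on the whole space, so convergence holds with constants
  -- zero and without a constraint set.
  obtain ⟨δ, hδ, h⟩ := euler_close (c := 0) (c' := 0) hT hL hf₁ hf₂ (lipschitzOnBalls_smul κ)
    (fun x => by simp) hμ (fun y _ z _ => by
      rw [← smul_sub, inner_smul_left, real_inner_self_eq_norm_sq, neg_zero, zero_mul,
        conj_trivial]
      positivity) convex_univ isClosed_univ (fun t _ => mem_univ _) hs hε
  obtain ⟨N, hN, hNδ⟩ := exists_small_step (T := T) hδ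
  obtain ⟨p, hp⟩ := exists_linear_isEuler (i := i) (f₁ := f₁) (f₂ := f₂) (y₀ := y₀) hT hμ hL hκ N
  obtain ⟨n, hn, htn⟩ := exists_cell hT hN ht
  refine ⟨i (p n), hE N p hp n hn, ?_⟩
  rw [dist_comm, dist_eq_norm]
  exact (h N hN hNδ p hp).2 n hn t htn

/-- The ball of radius `ρ / (κ + m)` is invariant under each Euler step, because `(τ⁻¹ + κ + m) ‖x‖
≤ τ⁻¹ ‖y‖ + ρ`; the evolution inherits this. The full constant `κ + m` is what the contraction
argument relies on. -/
theorem IsSol.norm_le {κ m ρ : ℝ} {g P : ℝ → Y} {u : ℝ → X} (hT : 0 < T) (hμ : 0 < μ)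
    (hL : IsUniformForm T μ η L) (hg : MemLp g 1 (timeMeasure T))
    (hκ : 0 ≤ κ) (hm0 : 0 < m) (hm : ∀ x, m * ‖i x‖ ^ 2 ≤ μ * ‖x‖ ^ 2)
    (hgρ : ∀ t ∈ Icc 0 T, ‖g t‖ ≤ ρ) (hρ : 0 ≤ ρ)
    (hs : IsSol i T L (fun s => g s - κ • P s) (fun _ => 0) 0 P u) :
    ∀ t ∈ Icc 0 T, ‖P t‖ ≤ ρ / (κ + m) := by
  have hkm : 0 < κ + m := by positivity
  have h := hs.mem_of_euler (K := Metric.closedBall 0 (ρ / (κ + m))) hT hμ hL hg (memLp_const 0)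
    hκ Metric.isClosed_closedBall fun N p hp => ?_
  · intro t ht
    simpa using h t ht
  have key : ∀ n ≤ N, ‖nodes i 0 p n‖ ≤ ρ / (κ + m) := by
    intro n hn
    induction n with
    | zero =>
      rw [nodes, norm_zero]
      positivity
    | succ n ih =>
      have hcm := cell_mem hT hn
      have hN : (0 : ℝ) < N := by exact_mod_cast (by omega : 0 < N)
      have hτ : 0 < T / N := by positivity
      have ih := ih (by omega)
      have e := hp.equation n hn
      simp only [add_zero] at e
      rw [(dualEmb i).cellAvg_comp (integrable_intervalIntegrable
        (memLp_one_iff_integrable.1 hg) hcm.1 hcm.2)] at e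
      have h1 := linear_step_norm_le hT hL hn hm e
      have h2 : ‖cellAvg (T / N) n g‖ ≤ ρ := norm_cellAvg_le_of_le hτ n fun t ht =>
        hgρ t (cell_subset hT hn (Ioc_subset_Icc_self ht))
      have h3 : (T / N)⁻¹ * ‖nodes i 0 p n‖ ≤ (T / N)⁻¹ * (ρ / (κ + m)) := by gcongr
      have h4 : ((T / N)⁻¹ + κ + m) * (ρ / (κ + m)) = (T / N)⁻¹ * (ρ / (κ + m)) + ρ := by
        field_simp
        ring
      have h5 : 0 < (T / N)⁻¹ + κ + m := by positivity
      refine le_of_mul_le_mul_left ?_ h5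
      rw [h4]
      exact h1.trans (by linarith)
  intro n hn
  simpa [nodes] using key (n + 1) hn

end LinearEuler

/-! ### The fixed point argument for the quadratic term -/

section FixedPoint

variable {H : Type*} [NormedAddCommGroup H] [InnerProductSpace ℝ H] [CompleteSpace H]
  {α : Type*} [TopologicalSpace α] [CompactSpace α]

theorem HS.norm_square_le (P : HS H H) : ‖P.square‖ ≤ ‖P‖ ^ 2 := by
  refine (HS.norm_compLeft_le _ _).trans ?_
  rw [sq]
  gcongr
  exact P.norm_toCLM_le

/-- The pointwise square of a continuous operator valued function. -/
def squareMap (v : C(α, HS H H)) : C(α, HS H H) :=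
  ⟨fun t => (v t).square, HS.lipschitzOnBalls_square.continuous.comp v.continuous⟩

omit [CompactSpace α] in
@[simp] theorem squareMap_apply (v : C(α, HS H H)) (t : α) : squareMap v t = (v t).square := rfl

theorem zero_mem_lowerCone {γ : ℝ} (hγ : 0 ≤ γ) : (0 : HS H H) ∈ lowerCone H γ :=
  mem_lowerCone_iff.2 ⟨by simp, fun x => by
    simp only [HS.toCLM_zero, zero_apply, inner_zero_left]
    have : 0 ≤ γ * ‖x‖ ^ 2 := by positivity
    linarith⟩

/-- A fixed point of `v ↦ Sol κ (κ v - v²)` for `κ` large. The relation `Sol κ G v` stands for a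
linear problem with damping `κ` and right-hand side `G`. -/
theorem exists_sol_neg_square {γ m : ℝ} (hγ : 0 ≤ γ) (hm : 2 * γ < m)
    (Sol : ℝ → C(α, HS H H) → C(α, HS H H) → Prop)
    (hex : ∀ κ, 0 ≤ κ → ∀ G, ∃ v, Sol κ G v)
    (hlip : ∀ κ, 0 ≤ κ → ∀ G v G' v', Sol κ G v → Sol κ G' v' → ‖v - v'‖ ≤ ‖G - G'‖ / (κ + m))
    (hcone : ∀ κ, 0 ≤ κ → ∀ G v, Sol κ G v → (∀ t, G t ∈ lowerCone H (κ * γ + γ ^ 2)) →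
      ∀ t, v t ∈ lowerCone H γ)
    (hshift : ∀ κ, 0 ≤ κ → ∀ G v, Sol κ (κ • v + G) v ↔ Sol 0 G v) :
    ∃ v, Sol 0 (-squareMap v) v ∧ ∀ t, v t ∈ lowerCone H γ := by
  -- The solution without quadratic term is the centre of the invariant ball.
  obtain ⟨x₀, hx₀⟩ := hex 0 le_rfl 0
  have hx₀c : ∀ t, x₀ t ∈ lowerCone H γ := hcone 0 le_rfl 0 x₀ hx₀ fun t =>
    zero_mem_lowerCone (by positivity)
  -- Half of the gap between `m` and `2γ`: one half makes the map a contraction, the other absorbs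
  -- the quadratic term at `x₀`.
  set ε := (m - 2 * γ) / 2 with hε
  have hε0 : 0 < ε := by linarith
  set R := ‖x₀‖ ^ 2 / ε with hR
  have hR0 : 0 ≤ R := by positivity
  set M := ‖x₀‖ + R with hM
  have hM0 : 0 ≤ M := by positivity
  -- Large enough for both requirements on the ball of radius `M`: `2M² ≤ κε` for the Lipschitz
  -- estimate and `M + 2γ ≤ κ` for the cone.
  set κ := 2 * M ^ 2 / ε + M + 2 * γ + 1 with hκ
  have hκ0 : 0 < κ := by positivity
  have hκm : 0 < κ + m := by linarith
  have hκM : 2 * M ^ 2 ≤ κ * ε := by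
    rw [← div_le_iff₀ hε0]
    linarith
  have hκM' : M + 2 * γ ≤ κ := by
    have : 0 ≤ 2 * M ^ 2 / ε := by positivity
    linarith
  choose Φ hΦ using fun v : C(α, HS H H) => hex κ hκ0.le (κ • v - squareMap v)
  set S : Set C(α, HS H H) := {v | ∀ t, v t ∈ lowerCone H γ} ∩ Metric.closedBall x₀ R with hS
  have hSM : ∀ v ∈ S, ∀ t, ‖v t‖ ≤ M := by
    intro v hv t
    have h1 := hv.2
    rw [Metric.mem_closedBall, dist_eq_norm] at h1
    have h2 := norm_le_insert' v x₀
    exact (v.norm_coe_le_norm t).trans (by linarith)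
  have hx₀S : x₀ ∈ S := ⟨hx₀c, Metric.mem_closedBall_self hR0⟩
  have hG : ∀ v ∈ S, ∀ w ∈ S, ‖(κ • v - squareMap v) - (κ • w - squareMap w)‖ ≤
      (κ + 2 * γ + ε) * ‖v - w‖ := by
    intro v hv w hw
    rw [ContinuousMap.norm_le _ (by positivity)]
    intro t
    refine (norm_smul_sub_square_sub_le hγ hε0 hκ0.le hκM (hv.1 t) (hw.1 t) (hSM v hv t)
      (hSM w hw t)).trans ?_
    gcongr
    exact (v - w).norm_coe_le_norm t
  have hmaps : MapsTo Φ S S := by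
    intro v hv
    refine ⟨hcone κ hκ0.le _ _ (hΦ v) fun t => ?_, ?_⟩
    · exact smul_sub_square_mem_lowerCone (hv.1 t) hκ0
        (by linarith [hSM v hv t]) hγ
    · rw [Metric.mem_closedBall, dist_eq_norm]
      -- By `hshift`, `x₀` also solves the damped problem, with right-hand side `κ x₀`. The distance
      -- to it is at most `((κ + 2γ + ε) R + ‖x₀‖²) / (κ + m)`, which equals `R` by the choice of
      -- `R`.
      refine (hlip κ hκ0.le _ _ _ _ (hΦ v) ((hshift κ hκ0.le 0 x₀).2 hx₀)).trans ?_
      rw [div_le_iff₀ hκm]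
      have e : (κ • v - squareMap v) - (κ • x₀ + 0) =
          ((κ • v - squareMap v) - (κ • x₀ - squareMap x₀)) - squareMap x₀ := by abel
      have h1 := hG v hv x₀ hx₀S
      have h2 : ‖squareMap x₀‖ ≤ ‖x₀‖ ^ 2 := by
        rw [ContinuousMap.norm_le _ (by positivity)]
        intro t
        refine (HS.norm_square_le _).trans ?_
        gcongr
        exact x₀.norm_coe_le_norm t
      have h3 : ‖x₀‖ ^ 2 = ε * R := by rw [hR]; field_simp
      have h4 : ‖v - x₀‖ ≤ R := by
        have := hv.2
        rwa [Metric.mem_closedBall, dist_eq_norm] at this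
      have h5 : (κ + 2 * γ + ε) * ‖v - x₀‖ ≤ (κ + 2 * γ + ε) * R := by gcongr
      rw [e]
      refine (norm_sub_le _ _).trans ?_
      have h6 : R * (κ + m) = (κ + 2 * γ + ε) * R + ε * R := by rw [hε]; ring
      linarith
  have hSc : IsComplete S := by
    refine IsClosed.isComplete (IsClosed.inter ?_ Metric.isClosed_closedBall)
    have : {v : C(α, HS H H) | ∀ t, v t ∈ lowerCone H γ} = ⋂ t, {v | v t ∈ lowerCone H γ} := by
      ext v
      simp
    rw [this]
    exact isClosed_iInter fun t => (isClosed_lowerCone γ).preimage (continuous_eval_const t)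
  set q : ℝ≥0 := ⟨(κ + 2 * γ + ε) / (κ + m), by positivity⟩ with hq
  have hcontr : ContractingWith q (hmaps.restrict Φ S S) := by
    refine ⟨?_, LipschitzWith.of_dist_le_mul fun v w => ?_⟩
    · rw [← NNReal.coe_lt_coe]
      change (κ + 2 * γ + ε) / (κ + m) < 1
      rw [div_lt_one hκm]
      linarith
    · rw [Subtype.dist_eq, Subtype.dist_eq, dist_eq_norm, dist_eq_norm]
      change ‖Φ v - Φ w‖ ≤ (κ + 2 * γ + ε) / (κ + m) * ‖(v : C(α, HS H H)) - w‖
      refine (hlip κ hκ0.le _ _ _ _ (hΦ v) (hΦ w)).trans ?_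
      rw [div_mul_eq_mul_div]
      gcongr
      exact hG v v.2 w w.2
  obtain ⟨v, hvS, hv, -⟩ := hcontr.exists_fixedPoint' hSc hmaps hx₀S (edist_ne_top _ _)
  refine ⟨v, ?_, hvS.1⟩
  have h := hΦ v
  rw [hv.eq, sub_eq_add_neg] at h
  exact (hshift κ hκ0.le _ _).1 h

end FixedPoint

/-! ### One backward Euler step for the Riccati equation -/

section EulerExistence

variable {V H : Type*}
  [NormedAddCommGroup V] [InnerProductSpace ℝ V] [CompleteSpace V]
  [TopologicalSpace.SeparableSpace V]
  [NormedAddCommGroup H] [InnerProductSpace ℝ H] [CompleteSpace H]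
  [TopologicalSpace.SeparableSpace H] {j : V →L[ℝ] H}
  {C T μ η γ : ℝ} {a : ℝ → V →L[ℝ] V →L[ℝ] ℝ}

omit [TopologicalSpace.SeparableSpace V] [TopologicalSpace.SeparableSpace H] in
theorem norm_toHi_sq_le_of_coercive (hC : 0 < C) (hjC : ∀ v, ‖j v‖ ≤ C * ‖v‖) (hμ : 0 < μ)
    (P : OpV j) : 2 * (μ / C ^ 2) * ‖OpV.toHi j P‖ ^ 2 ≤ μ * ‖P‖ ^ 2 := by
  have h := OpV.norm_toHi_sq_le hC.le hjC P
  calc 2 * (μ / C ^ 2) * ‖OpV.toHi j P‖ ^ 2 = μ / C ^ 2 * (2 * ‖OpV.toHi j P‖ ^ 2) := by ring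
    _ ≤ μ / C ^ 2 * (C ^ 2 * ‖P‖ ^ 2) := by gcongr
    _ = _ := by field_simp

theorem mem_lowerCone_of_cell_step (hjc : IsCompactOperator j)
    (hC : 0 < C) (hjC : ∀ v, ‖j v‖ ≤ C * ‖v‖) (hT : 0 < T) (hμ : 0 < μ) (hη : 0 ≤ η)
    (ha : IsUniformForm T μ η a) (hγ : 0 ≤ γ) (hγμ : γ ≤ μ / C ^ 2) {κ : ℝ} (hκ : 0 ≤ κ)
    {N n : ℕ} (hn : n < N) {Y : HS H H} (hY : Y ∈ lowerCone H γ) {F : StrongDual ℝ (OpV j)}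
    (hF : F ∈ dualCone j (2 * γ ^ 2 + κ * γ)) {y : OpV j}
    (h : (T / N)⁻¹ • dualEmb (OpV.toHi j) (OpV.toHi j y - Y)
      + cellAvg (T / N) n (fun s => (opForm j (a s) y : StrongDual ℝ (OpV j)))
      + dualEmb (OpV.toHi j) (κ • OpV.toHi j y) = F) :
    OpV.toHi j y ∈ lowerCone H γ := by
  have hN : (0 : ℝ) < N := by exact_mod_cast (by omega : 0 < N)
  have hτ : 0 < T / N := by positivity
  rw [← opForm_avgForm_eq_cellAvg hT ha hη hn, map_smul] at h
  exact mem_lowerCone_of_linear_step hjc hC hjC hμ hγ hγμ hκ (inv_pos.2 hτ)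
    (le_avgForm_self ha hT hn) hY hF h

-- The fixed point argument on a one-point space, where continuous functions are just operators and
-- the linear problem is a single damped step. The bound `γ²` of `F` and the bound `κγ + γ²` of `κ v
-- - v²` add up to what a linear step tolerates.
set_option maxHeartbeats 1000000 in
theorem exists_riccati_step (hjc : IsCompactOperator j)
    (hC : 0 < C) (hjC : ∀ v, ‖j v‖ ≤ C * ‖v‖) (hT : 0 < T) (hμ : 0 < μ) (hη : 0 ≤ η)
    (ha : IsUniformForm T μ η a) (hγ : 0 ≤ γ) (hγμ : γ < μ / C ^ 2)
    {N n : ℕ} (hn : n < N) {Y : HS H H} (hY : Y ∈ lowerCone H γ) {F : StrongDual ℝ (OpV j)}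
    (hF : F ∈ dualCone j (γ ^ 2)) :
    ∃ y : OpV j, OpV.toHi j y ∈ lowerCone H γ ∧
      (T / N)⁻¹ • dualEmb (OpV.toHi j) (OpV.toHi j y - Y)
      + cellAvg (T / N) n (fun s => (opForm j (a s) y : StrongDual ℝ (OpV j)))
      + dualEmb (OpV.toHi j) (OpV.toHi j y).square = F := by
  have hN : (0 : ℝ) < N := by exact_mod_cast (by omega : 0 < N)
  have hτ : 0 < T / N := by positivity
  have hL := isUniformForm_opForm (j := j) ha hη
  obtain ⟨v, ⟨y, hyv, hy⟩, hvc⟩ := exists_sol_neg_square (α := Unit) hγ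
    (m := 2 * (μ / C ^ 2)) (by linarith)
    (fun κ G v => ∃ y : OpV j, OpV.toHi j y = v () ∧
      (T / N)⁻¹ • dualEmb (OpV.toHi j) (OpV.toHi j y - Y)
      + cellAvg (T / N) n (fun s => (opForm j (a s) y : StrongDual ℝ (OpV j)))
      + dualEmb (OpV.toHi j) (κ • OpV.toHi j y) = F + dualEmb (OpV.toHi j) (G ()))
    (fun κ hκ G => by
      obtain ⟨y, hy⟩ := exists_linear_step (i := OpV.toHi j) hT hμ hL hn hκ Y
        (F + dualEmb (OpV.toHi j) (G ()))
      exact ⟨ContinuousMap.const _ (OpV.toHi j y), y, rfl, hy⟩)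
    (fun κ hκ G v G' v' ⟨y, hyv, hy⟩ ⟨y', hyv', hy'⟩ => by
      have hkm : 0 < κ + 2 * (μ / C ^ 2) := by positivity
      -- The difference of two solutions is itself a step, starting from `0` with data `G - G'`.
      have e : (T / N)⁻¹ • dualEmb (OpV.toHi j) (OpV.toHi j (y - y') - 0)
          + cellAvg (T / N) n (fun s => (opForm j (a s) (y - y') : StrongDual ℝ (OpV j)))
          + dualEmb (OpV.toHi j) (κ • OpV.toHi j (y - y')) =
          dualEmb (OpV.toHi j) (G () - G' ()) := by
        have e1 : cellAvg (T / N) n (fun s => (opForm j (a s) (y - y') : StrongDual ℝ (OpV j))) =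
            cellAvg (T / N) n (fun s => (opForm j (a s) y : StrongDual ℝ (OpV j)))
            - cellAvg (T / N) n (fun s => (opForm j (a s) y' : StrongDual ℝ (OpV j))) := by
          rw [← opForm_avgForm_eq_cellAvg hT ha hη hn, ← opForm_avgForm_eq_cellAvg hT ha hη hn,
            ← opForm_avgForm_eq_cellAvg hT ha hη hn, map_sub]
        have e2 : dualEmb (OpV.toHi j) (G () - G' ()) =
            (F + dualEmb (OpV.toHi j) (G ())) - (F + dualEmb (OpV.toHi j) (G' ())) := by
          rw [map_sub]
          abel
        rw [e1, e2, ← hy, ← hy']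
        simp only [map_sub, map_smul, sub_zero, smul_sub]
        abel
      have h1 := linear_step_norm_le hT hL hn (norm_toHi_sq_le_of_coercive hC hjC hμ) e
      rw [norm_zero, mul_zero, zero_add, map_sub, hyv, hyv'] at h1
      rw [ContinuousMap.norm_le _ (by positivity)]
      intro t
      have h2 : ‖G () - G' ()‖ ≤ ‖G - G'‖ := (G - G').norm_coe_le_norm ()
      rw [le_div_iff₀ hkm]
      change ‖v () - v' ()‖ * _ ≤ _
      have h3 : 0 ≤ (T / N)⁻¹ * ‖v () - v' ()‖ := by positivity
      linarith)
    (fun κ hκ G v ⟨y, hyv, hy⟩ hG t => by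
      change v () ∈ _
      rw [← hyv]
      refine mem_lowerCone_of_cell_step hjc hC hjC hT hμ hη ha hγ hγμ.le hκ hn hY ?_ hy
      have := add_mem_dualCone hF (hiEmb_mem_dualCone (j := j) (hG ()))
      rw [show γ ^ 2 + (κ * γ + γ ^ 2) = 2 * γ ^ 2 + κ * γ by ring] at this
      exact this)
    (fun κ hκ G v => by
      refine exists_congr fun y => and_congr_right fun hyv => ?_
      have e1 : (κ • v + G) () = κ • OpV.toHi j y + G () := by
        rw [hyv]
        rfl
      rw [e1, zero_smul, map_zero (dualEmb (OpV.toHi j)), add_zero,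
          map_add (dualEmb (OpV.toHi j)), add_comm (dualEmb (OpV.toHi j) (κ • _)),
        ← add_assoc, add_left_inj])
  refine ⟨y, hyv ▸ hvc (), ?_⟩
  rw [zero_smul, map_zero (dualEmb (OpV.toHi j)), add_zero] at hy
  rw [hy]
  change F + dualEmb (OpV.toHi j) (-(v ()).square) + _ = F
  rw [hyv, map_neg]
  abel

end EulerExistence

/-! ### Linear evolution with damping -/

section DampedEvolution

variable {X Y : Type*} [NormedAddCommGroup X] [InnerProductSpace ℝ X] [CompleteSpace X]
  [NormedAddCommGroup Y] [InnerProductSpace ℝ Y] [CompleteSpace Y]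
  [TopologicalSpace.SeparableSpace X]
  {i : X →L[ℝ] Y} {T μ η : ℝ} {L : ℝ → X →L[ℝ] X →L[ℝ] ℝ}
  {f₁ g₁ : ℝ → Y} {f₂ g₂ : ℝ → StrongDual ℝ X} {y₀ z₀ : Y} {P S : ℝ → Y} {u w : ℝ → X}

omit [CompleteSpace X] [CompleteSpace Y] [TopologicalSpace.SeparableSpace X] in
theorem IsSol.congr (hT : 0 ≤ T) (h : IsSol i T L f₁ f₂ y₀ P u) (hPS : EqOn P S (Icc 0 T))
    (hfg : ∀ᵐ t ∂timeMeasure T, f₁ t = g₁ t) : IsSol i T L g₁ f₂ y₀ S u where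
  memLp := h.memLp
  continuousOn := h.continuousOn.congr hPS.symm
  ae_eq := by
    filter_upwards [h.ae_eq, ae_timeMeasure_mem T] with t ht htm
    rw [ht, hPS htm]
  initial := by rw [← hPS ⟨le_rfl, hT⟩, h.initial]
  equation t ht := by
    rw [← hPS ht, h.equation t ht]
    congr 1
    refine integral_congr_of_ae_timeMeasure ?_ ⟨le_rfl, hT⟩ ht
    filter_upwards [hfg] with s hs
    rw [hs]

-- With the damping absorbed into the form, the existence theorem for linear equations applies
-- unchanged; coercivity is kept and only the upper bound grows.
omit [CompleteSpace X] [CompleteSpace Y] [TopologicalSpace.SeparableSpace X] in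
theorem IsUniformForm.add_smul (hL : IsUniformForm T μ η L) {κ : ℝ} (hκ : 0 ≤ κ) :
    IsUniformForm T μ (η + κ * ‖i‖ ^ 2) fun t => L t + κ • (dualEmb i).comp i where
  pos t ht x := by
    have := hL.pos t ht x
    simp only [add_apply, smul_apply, ContinuousLinearMap.comp_apply, dualEmb_apply, smul_eq_mul,
      real_inner_self_eq_norm_sq]
    have : 0 ≤ κ * ‖i x‖ ^ 2 := by positivity
    linarith
  bound t ht x y := by
    have h1 := hL.bound t ht x y
    simp only [add_apply, smul_apply, ContinuousLinearMap.comp_apply, dualEmb_apply, smul_eq_mul]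
    have h2 : |κ * inner ℝ (i x) (i y)| ≤ κ * ((‖i‖ * ‖x‖) * (‖i‖ * ‖y‖)) := by
      rw [abs_mul, abs_of_nonneg hκ]
      gcongr
      refine (abs_real_inner_le_norm _ _).trans ?_
      gcongr
      exacts [i.le_opNorm x, i.le_opNorm y]
    refine (abs_add_le _ _).trans ((add_le_add h1 h2).trans_eq ?_)
    ring
  aemeasurable x y := by
    simp only [add_apply, smul_apply]
    exact (hL.aemeasurable x y).add_const _

/-- Existence for the linear problem with damping. -/
theorem exists_damped_isSol (hi : DenseRange i) (hT : 0 < T) (hμ : 0 < μ)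
    (hL : IsUniformForm T μ η L) (h₁ : MemLp f₁ 1 (timeMeasure T))
    (h₂ : MemLp f₂ 2 (timeMeasure T)) (y₀ : Y) {κ : ℝ} (hκ : 0 ≤ κ) :
    ∃ P u, IsSol i T L (fun s => f₁ s - κ • P s) f₂ y₀ P u := by
  obtain ⟨P, u, h⟩ := exists_isSol hi hT hμ (hL.add_smul (i := i) hκ) h₁ h₂ y₀
  refine ⟨P, u, h.memLp, h.continuousOn, h.ae_eq, h.initial, fun t ht => ?_⟩
  rw [h.equation t ht]
  congr 1
  refine integral_congr_of_ae_timeMeasure ?_ ⟨le_rfl, hT.le⟩ ht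
  filter_upwards [h.ae_eq] with s hs
  rw [add_apply, smul_apply, ContinuousLinearMap.comp_apply, hs, map_sub, map_smul]
  abel

omit [CompleteSpace Y] in
theorem IsSol.sub (hL : IsUniformForm T μ η L) (h : IsSol i T L f₁ f₂ y₀ P u)
    (h' : IsSol i T L g₁ g₂ z₀ S w) (hT : 0 ≤ T) (hf₁ : MemLp f₁ 1 (timeMeasure T))
    (hg₁ : MemLp g₁ 1 (timeMeasure T)) (hf₂ : MemLp f₂ 2 (timeMeasure T))
    (hg₂ : MemLp g₂ 2 (timeMeasure T)) :
    IsSol i T L (fun s => f₁ s - g₁ s) (fun s => f₂ s - g₂ s) (y₀ - z₀) (fun s => P s - S s)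
      (fun s => u s - w s) where
  memLp := MemLp.sub h.memLp h'.memLp
  continuousOn := h.continuousOn.sub h'.continuousOn
  ae_eq := by
    filter_upwards [h.ae_eq, h'.ae_eq] with t ht ht'
    rw [map_sub, ht, ht']
  initial := by rw [h.initial, h'.initial]
  equation t ht := by
    have key : ∀ {f₁ : ℝ → Y} {f₂ : ℝ → StrongDual ℝ X} {u : ℝ → X}, MemLp f₁ 1 (timeMeasure T) →
        MemLp f₂ 2 (timeMeasure T) → MemLp u 2 (timeMeasure T) →
        IntervalIntegrable (fun s => dualEmb i (f₁ s) + f₂ s - (L s (u s) : StrongDual ℝ X))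
          volume 0 t := by
      intro f₁ f₂ u h₁ h₂ hu
      refine integrable_intervalIntegrable (Z := StrongDual ℝ X) ?_ ⟨le_rfl, hT⟩ ht
      have i1 : Integrable (fun s => dualEmb i (f₁ s)) (timeMeasure T) :=
        (dualEmb i).integrable_comp (memLp_one_iff_integrable.1 h₁)
      have i2 : Integrable f₂ (timeMeasure T) := memLp_two_integrable h₂
      have i3 : Integrable (fun s => (L s (u s) : StrongDual ℝ X)) (timeMeasure T) :=
        memLp_two_integrable (hL.memLp hu)
      have i4 : Integrable (fun s => dualEmb i (f₁ s) + f₂ s) (timeMeasure T) := by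
        exact Integrable.add (f := fun s => dualEmb i (f₁ s)) (g := f₂) i1 i2
      exact Integrable.sub (f := fun s => dualEmb i (f₁ s) + f₂ s)
        (g := fun s => (L s (u s) : StrongDual ℝ X)) i4 i3
    rw [map_sub, h.equation t ht, h'.equation t ht, map_sub, add_sub_add_comm,
      ← intervalIntegral.integral_sub (key hf₁ hf₂ h.memLp) (key hg₁ hg₂ h'.memLp)]
    congr 1
    refine intervalIntegral.integral_congr fun s _ => ?_
    simp only [map_sub]
    abel

omit [CompleteSpace X] [CompleteSpace Y] [TopologicalSpace.SeparableSpace X] in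
theorem integrable_sum (h₁ : MemLp f₁ 1 (timeMeasure T))
    (h₂ : MemLp f₂ 2 (timeMeasure T)) :
    Integrable (fun s => dualEmb i (f₁ s) + f₂ s) (timeMeasure T) := by
  have i1 : Integrable (fun s => dualEmb i (f₁ s)) (timeMeasure T) :=
    (dualEmb i).integrable_comp (memLp_one_iff_integrable.1 h₁)
  have i2 : Integrable f₂ (timeMeasure T) := memLp_two_integrable h₂
  exact Integrable.add (f := fun s => dualEmb i (f₁ s)) (g := f₂) i1 i2

omit [CompleteSpace Y] [TopologicalSpace.SeparableSpace X] in
theorem exists_isEuler_of_dual_step {G : Y → Y} {K : Set Y} {D : Set (StrongDual ℝ X)} {N : ℕ}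
    (hT : 0 < T) (h₁ : MemLp f₁ 1 (timeMeasure T)) (h₂ : MemLp f₂ 2 (timeMeasure T))
    (hD : Convex ℝ D) (hDc : IsClosed D)
    (hf : ∀ᵐ t ∂timeMeasure T, dualEmb i (f₁ t) + f₂ t ∈ D) (hy₀ : y₀ ∈ K)
    (hstep : ∀ n < N, ∀ y ∈ K, ∀ F ∈ D, ∃ x, i x ∈ K ∧
      (T / N)⁻¹ • dualEmb i (i x - y) + cellAvg (T / N) n (fun s => (L s x : StrongDual ℝ X))
        + dualEmb i (G (i x)) = F) : ∃ p, IsEuler i T L G f₁ f₂ y₀ K N p :=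
  exists_isEuler_of_step hy₀ fun n hn y hy =>
    hstep n hn y hy _ (cellAvg_mem_of_ae hT hn hD hDc (integrable_sum h₁ h₂) hf)

/-- Invariance of a closed set under the linear evolution, from its invariance under the steps of
the implicit Euler scheme. -/
theorem IsSol.mem_of_step {κ : ℝ} {K : Set Y} {D : Set (StrongDual ℝ X)} (hT : 0 < T)
    (hμ : 0 < μ) (hL : IsUniformForm T μ η L) (h₁ : MemLp f₁ 1 (timeMeasure T))
    (h₂ : MemLp f₂ 2 (timeMeasure T)) (hκ : 0 ≤ κ)
    (hs : IsSol i T L (fun s => f₁ s - κ • P s) f₂ y₀ P u) (hK : IsClosed K)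
    (hD : Convex ℝ D) (hDc : IsClosed D)
    (hf : ∀ᵐ t ∂timeMeasure T, dualEmb i (f₁ t) + f₂ t ∈ D) (hy₀ : y₀ ∈ K)
    (hstep : ∀ N n : ℕ, n < N → ∀ y ∈ K, ∀ F ∈ D, ∀ x,
      (T / N)⁻¹ • dualEmb i (i x - y) + cellAvg (T / N) n (fun s => (L s x : StrongDual ℝ X))
        + dualEmb i (κ • i x) = F → i x ∈ K) : ∀ t ∈ Icc 0 T, P t ∈ K := by
  refine hs.mem_of_euler hT hμ hL h₁ h₂ hκ hK fun N p hp => ?_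
  have key : ∀ n ≤ N, nodes i y₀ p n ∈ K := by
    intro n hn
    induction n with
    | zero => exact hy₀
    | succ n ih =>
      exact hstep N n hn _ (ih (by omega)) _
        (cellAvg_mem_of_ae hT hn hD hDc (integrable_sum h₁ h₂) hf) _ (hp.equation n hn)
  exact fun n hn => key (n + 1) hn

end DampedEvolution

/-! ### Existence for the Riccati evolution in the cone -/

section RiccatiExistence

variable {V H : Type*}
  [NormedAddCommGroup V] [InnerProductSpace ℝ V] [CompleteSpace V]
  [TopologicalSpace.SeparableSpace V]
  [NormedAddCommGroup H] [InnerProductSpace ℝ H] [CompleteSpace H]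
  [TopologicalSpace.SeparableSpace H] {j : V →L[ℝ] H}
  {C T μ η γ : ℝ} {a : ℝ → V →L[ℝ] V →L[ℝ] ℝ} {Q₁ : ℝ → HS H H}
  {Q₂ : ℝ → StrongDual ℝ (OpV j)} {P₀ : HS H H}

/-- Solvability of the backward Euler scheme for the Riccati equation. -/
theorem exists_riccati_isEuler (hjc : IsCompactOperator j)
    (hC : 0 < C) (hjC : ∀ v, ‖j v‖ ≤ C * ‖v‖) (hT : 0 < T) (hμ : 0 < μ) (hη : 0 ≤ η)
    (ha : IsUniformForm T μ η a) (hγ : 0 ≤ γ) (hγμ : γ < μ / C ^ 2)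
    (hQ₁ : MemLp Q₁ 1 (timeMeasure T)) (hQ₂ : MemLp Q₂ 2 (timeMeasure T))
    (hQ : ∀ᵐ t ∂timeMeasure T, dualEmb (OpV.toHi j) (Q₁ t) + Q₂ t ∈ dualCone j (γ ^ 2))
    (hP₀ : P₀ ∈ lowerCone H γ) (N : ℕ) :
    ∃ p, IsEuler (OpV.toHi j) T (fun t => opForm j (a t)) HS.square Q₁ Q₂ P₀ (lowerCone H γ) N p :=
  exists_isEuler_of_dual_step hT hQ₁ hQ₂ (convex_dualCone _) (isClosed_dualCone _) hQ hP₀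
    fun _ hn _ hY _ hF => exists_riccati_step hjc hC hjC hT hμ hη ha hγ hγμ hn hY hF

theorem IsSol.mem_lowerCone (hjc : IsCompactOperator j)
    (hC : 0 < C) (hjC : ∀ v, ‖j v‖ ≤ C * ‖v‖) (hT : 0 < T) (hμ : 0 < μ) (hη : 0 ≤ η)
    (ha : IsUniformForm T μ η a) (hγ : 0 ≤ γ) (hγμ : γ ≤ μ / C ^ 2)
    (hQ₁ : MemLp Q₁ 1 (timeMeasure T)) (hQ₂ : MemLp Q₂ 2 (timeMeasure T)) {κ : ℝ} (hκ : 0 ≤ κ)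
    (hQ : ∀ᵐ t ∂timeMeasure T,
      dualEmb (OpV.toHi j) (Q₁ t) + Q₂ t ∈ dualCone j (2 * γ ^ 2 + κ * γ))
    (hP₀ : P₀ ∈ lowerCone H γ) {P : ℝ → HS H H} {u : ℝ → OpV j}
    (hs : IsSol (OpV.toHi j) T (fun t => opForm j (a t)) (fun s => Q₁ s - κ • P s) Q₂ P₀ P u) :
    ∀ t ∈ Icc 0 T, P t ∈ lowerCone H γ :=
  hs.mem_of_step hT hμ (isUniformForm_opForm ha hη) hQ₁ hQ₂ hκ (isClosed_lowerCone γ)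
    (convex_dualCone _) (isClosed_dualCone _) hQ hP₀ fun _ _ hn _ hY _ hF _ h =>
      mem_lowerCone_of_cell_step hjc hC hjC hT hμ hη ha hγ hγμ hκ hn hY hF h

theorem memLp_comp_projIcc {Z : Type*} [NormedAddCommGroup Z] (hT : 0 ≤ T)
    (v : C(Icc 0 T, Z)) (p : ℝ≥0∞) :
    MemLp (fun s => v (projIcc 0 T hT s)) p (timeMeasure T) :=
  memLp_timeMeasure_of_continuousOn (v.continuous.comp continuous_projIcc).continuousOn p

/-- The relation between right-hand sides and solutions of the linear problem with damping. -/
def DampedSol (j : V →L[ℝ] H) {T : ℝ} (hT : 0 ≤ T) (a : ℝ → V →L[ℝ] V →L[ℝ] ℝ) (Q₁ : ℝ → HS H H)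
    (Q₂ : ℝ → StrongDual ℝ (OpV j)) (P₀ : HS H H) (κ : ℝ) (G v : C(Icc 0 T, HS H H)) : Prop :=
  ∃ u, IsSol (OpV.toHi j) T (fun t => opForm j (a t))
    (fun s => (Q₁ s + G (projIcc 0 T hT s)) - κ • v (projIcc 0 T hT s)) Q₂ P₀
    (fun s => v (projIcc 0 T hT s)) u

theorem exists_dampedSol (hj : DenseRange j) (hT : 0 < T) (hμ : 0 < μ) (hη : 0 ≤ η)
    (ha : IsUniformForm T μ η a)
    (hQ₁ : MemLp Q₁ 1 (timeMeasure T)) (hQ₂ : MemLp Q₂ 2 (timeMeasure T)) {κ : ℝ} (hκ : 0 ≤ κ)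
    (G : C(Icc 0 T, HS H H)) : ∃ v, DampedSol j hT.le a Q₁ Q₂ P₀ κ G v := by
  obtain ⟨P, u, h⟩ := exists_damped_isSol (OpV.denseRange_toHi hj) hT hμ
    (isUniformForm_opForm (j := j) ha hη)
    (f₁ := fun s => Q₁ s + G (projIcc 0 T hT.le s))
    (MemLp.add hQ₁ (memLp_comp_projIcc hT.le G 1)) hQ₂ P₀ hκ
  have e : ∀ t ∈ Icc 0 T, P t = (Icc 0 T).domRestrict P (projIcc 0 T hT.le t) := fun t ht => by
    rw [projIcc_of_mem hT.le ht]
    rfl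
  refine ⟨⟨(Icc 0 T).domRestrict P, continuousOn_iff_continuous_domRestrict.1 h.continuousOn⟩, u,
      ?_⟩
  refine h.congr hT.le e ?_
  filter_upwards [ae_timeMeasure_mem T] with t ht
  rw [e t ht]
  rfl

/-- By linearity the difference has zero initial value and bounded data `G - G'`, so `IsSol.norm_le`
applies with `m = 2μ / C²`. -/
theorem DampedSol.norm_sub_le (hC : 0 < C) (hjC : ∀ v, ‖j v‖ ≤ C * ‖v‖) (hT : 0 < T) (hμ : 0 < μ)
    (hη : 0 ≤ η) (ha : IsUniformForm T μ η a)
    (hQ₁ : MemLp Q₁ 1 (timeMeasure T)) (hQ₂ : MemLp Q₂ 2 (timeMeasure T)) {κ : ℝ} (hκ : 0 ≤ κ)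
    {G v G' v' : C(Icc 0 T, HS H H)} (h : DampedSol j hT.le a Q₁ Q₂ P₀ κ G v)
    (h' : DampedSol j hT.le a Q₁ Q₂ P₀ κ G' v') :
    ‖v - v'‖ ≤ ‖G - G'‖ / (κ + 2 * (μ / C ^ 2)) := by
  obtain ⟨u, h⟩ := h
  obtain ⟨u', h'⟩ := h'
  have hL := isUniformForm_opForm (j := j) ha hη
  have m₁ : ∀ G v : C(Icc 0 T, HS H H), MemLp (fun s => (Q₁ s + G (projIcc 0 T hT.le s))
      - κ • v (projIcc 0 T hT.le s)) 1 (timeMeasure T) := fun G v =>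
    MemLp.sub (MemLp.add hQ₁ (memLp_comp_projIcc hT.le G 1))
      (MemLp.const_smul (memLp_comp_projIcc hT.le v 1) κ)
  have hd := h.sub hL h' hT.le (m₁ G v) (m₁ G' v') hQ₂ hQ₂
  have hd' : IsSol (OpV.toHi j) T (fun t => opForm j (a t))
      (fun s => (G - G') (projIcc 0 T hT.le s) - κ • (v - v') (projIcc 0 T hT.le s))
      (fun _ => 0) 0 (fun s => (v - v') (projIcc 0 T hT.le s)) (fun s => u s - u' s) := by
    have e₂ : (fun s => Q₂ s - Q₂ s) = fun _ => 0 := funext fun s => sub_self _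
    rw [e₂, sub_self] at hd
    refine hd.congr hT.le (fun t _ => rfl) (Eventually.of_forall fun t => ?_)
    simp only [ContinuousMap.sub_apply, smul_sub]
    abel
  rw [ContinuousMap.norm_le _ (by positivity)]
  intro t
  have := hd'.norm_le hT hμ hL (memLp_comp_projIcc hT.le (G - G') 1) hκ (by positivity)
    (norm_toHi_sq_le_of_coercive hC hjC hμ) (fun t _ => (G - G').norm_coe_le_norm _)
    (norm_nonneg _) t t.2
  rwa [projIcc_val] at this

omit [TopologicalSpace.SeparableSpace V] [TopologicalSpace.SeparableSpace H] in
theorem dampedSol_shift (hT : 0 ≤ T) (κ : ℝ) (G v : C(Icc 0 T, HS H H)) :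
    DampedSol j hT a Q₁ Q₂ P₀ κ (κ • v + G) v ↔ DampedSol j hT a Q₁ Q₂ P₀ 0 G v := by
  have e : (fun s => (Q₁ s + (κ • v + G) (projIcc 0 T hT s)) - κ • v (projIcc 0 T hT s)) =
      fun s => (Q₁ s + G (projIcc 0 T hT s)) - (0 : ℝ) • v (projIcc 0 T hT s) := by
    funext s
    simp only [ContinuousMap.add_apply, ContinuousMap.smul_apply, zero_smul]
    abel
  rw [DampedSol, DampedSol, e]

/-- Existence of a solution of the Riccati equation in the cone. -/
theorem exists_riccati_isSol (hj : DenseRange j) (hjc : IsCompactOperator j)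
    (hC : 0 < C) (hjC : ∀ v, ‖j v‖ ≤ C * ‖v‖) (hT : 0 < T) (hμ : 0 < μ) (hη : 0 ≤ η)
    (ha : IsUniformForm T μ η a) (hγ : 0 ≤ γ) (hγμ : γ < μ / C ^ 2)
    (hQ₁ : MemLp Q₁ 1 (timeMeasure T)) (hQ₂ : MemLp Q₂ 2 (timeMeasure T))
    (hQ : ∀ᵐ t ∂timeMeasure T, dualEmb (OpV.toHi j) (Q₁ t) + Q₂ t ∈ dualCone j (γ ^ 2))
    (hP₀ : P₀ ∈ lowerCone H γ) :
    ∃ P u, IsSol (OpV.toHi j) T (fun t => opForm j (a t)) (fun s => Q₁ s - (P s).square) Q₂ P₀ P u ∧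
      ∀ t ∈ Icc 0 T, P t ∈ lowerCone H γ := by
  -- The same fixed point argument as for a single step, now in the continuous functions on `[0,
  -- T]`.
  obtain ⟨v, ⟨u, hu⟩, hv⟩ := exists_sol_neg_square hγ (m := 2 * (μ / C ^ 2)) (by linarith)
    (DampedSol j hT.le a Q₁ Q₂ P₀) (fun κ hκ G => exists_dampedSol hj hT hμ hη ha hQ₁ hQ₂ hκ G)
    (fun κ hκ G v G' v' h h' => h.norm_sub_le hC hjC hT hμ hη ha hQ₁ hQ₂ hκ h')
    (fun κ hκ G v ⟨u, h⟩ hG t => by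
      have := h.mem_lowerCone hjc hC hjC hT hμ hη ha hγ hγμ.le
        (MemLp.add hQ₁ (memLp_comp_projIcc hT.le G 1)) hQ₂ hκ ?_ hP₀ t t.2
      · rwa [projIcc_val] at this
      · filter_upwards [hQ] with s hs
        have h1 := add_mem_dualCone hs
          (hiEmb_mem_dualCone (j := j) (hG (projIcc 0 T hT.le s)))
        rw [show γ ^ 2 + (κ * γ + γ ^ 2) = 2 * γ ^ 2 + κ * γ by ring] at h1
        have e : dualEmb (OpV.toHi j) (Q₁ s + G (projIcc 0 T hT.le s)) + Q₂ s =
            dualEmb (OpV.toHi j) (Q₁ s) + Q₂ s + hiEmb j (G (projIcc 0 T hT.le s)) := by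
          rw [map_add, add_right_comm]
          rfl
        change dualEmb (OpV.toHi j) (Q₁ s + G (projIcc 0 T hT.le s)) + Q₂ s ∈ _
        rw [e]
        exact h1)
    (fun κ _ G v => dampedSol_shift hT.le κ G v)
  refine ⟨fun s => v (projIcc 0 T hT.le s), u, hu.congr hT.le (fun _ _ => rfl)
    (Eventually.of_forall fun s => ?_), fun t _ => hv _⟩
  simp only [ContinuousMap.neg_apply, squareMap_apply, zero_smul, sub_zero]
  abel

end RiccatiExistence

/-! ### Test functions and weak derivatives -/

section TestFunctions

variable {T : ℝ}

theorem IsTestFunction.eq_zero {φ : ℝ → ℝ} (h : IsTestFunction T φ) {t : ℝ} (ht : t ∉ Ioo 0 T) :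
    φ t = 0 :=
  image_eq_zero_of_notMem_tsupport fun hm => ht (h.2.2 hm)

theorem IsTestFunction.sub_smul {φ ψ : ℝ → ℝ} (h : IsTestFunction T φ) (h' : IsTestFunction T ψ)
    (c : ℝ) : IsTestFunction T fun t => φ t - c * ψ t := by
  refine ⟨h.1.sub (contDiff_const.mul h'.1), h.2.1.sub (h'.2.1.mul_left), ?_⟩
  have h1 : tsupport (fun t => φ t - c * ψ t) ⊆ tsupport φ ∪ tsupport ψ := by
    refine closure_minimal (fun t ht => ?_) ((isClosed_tsupport _).union (isClosed_tsupport _))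
    by_contra hn
    rw [mem_union, not_or] at hn
    refine ht ?_
    change φ t - c * ψ t = 0
    rw [image_eq_zero_of_notMem_tsupport hn.1, image_eq_zero_of_notMem_tsupport hn.2]
    simp
  exact h1.trans (union_subset h.2.2 h'.2.2)

/-- To the left of the support the primitive vanishes trivially, to the right because `χ` has
integral zero. -/
theorem IsTestFunction.primitive {χ : ℝ → ℝ} (hT : 0 < T) (h : IsTestFunction T χ)
    (h0 : ∫ t in (0 : ℝ)..T, χ t = 0) :
    IsTestFunction T (fun t => ∫ s in (0 : ℝ)..t, χ s) ∧
      deriv (fun t => ∫ s in (0 : ℝ)..t, χ s) = χ := by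
  have hc : Continuous χ := h.1.continuous
  have hd : deriv (fun t => ∫ s in (0 : ℝ)..t, χ s) = χ := by
    funext t
    exact (hc.deriv_integral χ 0 t)
  have hsm : ContDiff ℝ (⊤ : ℕ∞) fun t => ∫ s in (0 : ℝ)..t, χ s := by
    rw [contDiff_infty_iff_deriv, hd]
    exact ⟨fun t => (hc.integral_hasStrictDerivAt 0 t).hasDerivAt.differentiableAt, h.1⟩
  obtain ⟨a, b, ha, hb, hab⟩ : ∃ a b, 0 < a ∧ b < T ∧ tsupport χ ⊆ Icc a b := by
    have hcomp : IsCompact (tsupport χ) := h.2.1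
    rcases (tsupport χ).eq_empty_or_nonempty with he | hne
    -- For `χ = 0` any endpoints with `0 < a` and `b < T` will do.
    · exact ⟨T, 0, hT, hT, by rw [he]; exact empty_subset _⟩
    · obtain ⟨a, ha, hal⟩ := hcomp.exists_isLeast hne
      obtain ⟨b, hb, hbl⟩ := hcomp.exists_isGreatest hne
      exact ⟨a, b, (h.2.2 ha).1, (h.2.2 hb).2, fun t ht => ⟨hal ht, hbl ht⟩⟩
  have hχ : ∀ t, t ∉ Icc a b → χ t = 0 := fun t ht =>
    image_eq_zero_of_notMem_tsupport fun hm => ht (hab hm)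
  have hz : ∀ c d, (∀ t ∈ uIcc c d, χ t = 0) → ∫ t in c..d, χ t = 0 := fun c d hcd => by
    rw [intervalIntegral.integral_congr (g := fun _ => 0) hcd]
    simp
  have hsupp : tsupport (fun t => ∫ s in (0 : ℝ)..t, χ s) ⊆ Icc (min a T) (max b 0) := by
    refine closure_minimal (fun t ht => ?_) isClosed_Icc
    by_contra hn
    refine ht ?_
    rw [mem_Icc, not_and_or, not_le, not_le] at hn
    rcases hn with hn | hn
    · refine hz 0 t fun s hs => hχ s fun hm => ?_
      have h1 : s ≤ max 0 t := hs.2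
      have h2 : max 0 t < a := max_lt ha (hn.trans_le (min_le_left _ _))
      linarith [hm.1]
    · have e := intervalIntegral.integral_add_adjacent_intervals (hc.intervalIntegrable 0 t)
        (hc.intervalIntegrable t T) (μ := volume)
      rw [h0] at e
      have e2 : ∫ s in t..T, χ s = 0 := by
        refine hz t T fun s hs => hχ s fun hm => ?_
        have h1 : min t T ≤ s := hs.1
        have h2 : b < min t T := lt_min ((le_max_left _ _).trans_lt hn) hb
        linarith [hm.2]
      rw [e2, add_zero] at e
      exact e
  refine ⟨⟨hsm, ?_, ?_⟩, hd⟩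
  · exact HasCompactSupport.of_support_subset_isCompact isCompact_Icc
      (subset_closure.trans hsupp)
  · exact hsupp.trans fun t ht => ⟨(lt_min ha hT).trans_le ht.1, ht.2.trans_lt (max_lt hb hT)⟩

theorem exists_isTestFunction (hT : 0 < T) :
    ∃ ρ, IsTestFunction T ρ ∧ ∫ t in (0 : ℝ)..T, ρ t = 1 := by
  let f : ContDiffBump (T / 2) := ⟨T / 8, T / 4, by positivity, by linarith⟩
  have hts : tsupport (f.normed volume) ⊆ Ioo 0 T := by
    rw [f.tsupport_normed_eq, Real.closedBall_eq_Icc]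
    intro t ht
    have h1 : f.rOut = T / 4 := rfl
    rw [h1] at ht
    exact ⟨by linarith [ht.1], by linarith [ht.2]⟩
  refine ⟨f.normed volume, ⟨f.contDiff_normed, f.hasCompactSupport_normed, hts⟩, ?_⟩
  rw [intervalIntegral.integral_of_le hT.le, ← f.integral_normed (μ := volume)]
  refine setIntegral_eq_integral_of_forall_compl_eq_zero fun t ht => ?_
  exact image_eq_zero_of_notMem_tsupport fun hm => ht (Ioo_subset_Ioc_self (hts hm))

/-- Integration by parts against test functions. -/
theorem integral_primitive_mul_deriv (hT : 0 ≤ T) {p g φ : ℝ → ℝ} {c : ℝ}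
    (hg : IntervalIntegrable g volume 0 T) (hp : ∀ t ∈ Icc 0 T, p t = c + ∫ s in (0 : ℝ)..t, g s)
    (hφ : IsTestFunction T φ) :
    -(∫ t in (0 : ℝ)..T, p t * deriv φ t) = ∫ t in (0 : ℝ)..T, g t * φ t := by
  have hφd : Continuous (deriv φ) := (contDiff_infty_iff_deriv.1 hφ.1).2.continuous
  have hφ0 : φ 0 = 0 := hφ.eq_zero (by simp)
  have hφT : φ T = 0 := hφ.eq_zero (by simp)
  have hprim : ∀ t, ∫ s in (0 : ℝ)..t, deriv φ s = φ t := fun t => by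
    rw [intervalIntegral.integral_deriv_eq_sub (fun s _ => (contDiff_infty_iff_deriv.1 hφ.1).1 s)
      (hφd.intervalIntegrable _ _), hφ0, sub_zero]
  have h := integral_inner_primitive hT hg (hφd.intervalIntegrable 0 T)
  simp only [hprim, hφT, inner_zero_right] at h
  have hG : ContinuousOn (fun t => ∫ s in (0 : ℝ)..t, g s) (uIcc 0 T) :=
    intervalIntegral.continuousOn_primitive_interval' hg left_mem_uIcc
  have i1 : IntervalIntegrable (fun t => (∫ s in (0 : ℝ)..t, g s) * deriv φ t) volume 0 T :=
    (hG.mul hφd.continuousOn).intervalIntegrable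
  have i2 : IntervalIntegrable (fun t => g t * φ t) volume 0 T :=
    hg.mul_continuousOn hφ.1.continuous.continuousOn
  have e1 : ∫ t in (0 : ℝ)..T, (inner ℝ (∫ s in (0 : ℝ)..t, g s) (deriv φ t) + inner ℝ (g t) (φ t))
      =
      ∫ t in (0 : ℝ)..T, ((∫ s in (0 : ℝ)..t, g s) * deriv φ t + g t * φ t) := by
    refine intervalIntegral.integral_congr fun t _ => ?_
    simp [mul_comm]
  rw [e1, intervalIntegral.integral_add i1 i2] at h
  have e2 : ∫ t in (0 : ℝ)..T, p t * deriv φ t =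
      ∫ t in (0 : ℝ)..T, (c * deriv φ t + (∫ s in (0 : ℝ)..t, g s) * deriv φ t) := by
    refine intervalIntegral.integral_congr fun t ht => ?_
    rw [uIcc_of_le hT] at ht
    simp only [hp t ht]
    ring
  rw [e2, intervalIntegral.integral_add ((hφd.intervalIntegrable _ _).const_mul c) i1,
    intervalIntegral.integral_const_mul, hprim, hφT]
  linarith

/-- A continuous function with integrable weak derivative is the primitive of it. -/
theorem eq_primitive_of_weak_deriv (hT : 0 < T) {p g : ℝ → ℝ} (hp : ContinuousOn p (Icc 0 T))
    (hg : IntervalIntegrable g volume 0 T)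
    (h : ∀ φ, IsTestFunction T φ →
      -(∫ t in (0 : ℝ)..T, p t * deriv φ t) = ∫ t in (0 : ℝ)..T, g t * φ t) :
    ∀ t ∈ Icc 0 T, p t = p 0 + ∫ s in (0 : ℝ)..t, g s := by
  set q := fun t => p t - ∫ s in (0 : ℝ)..t, g s with hq
  have hG : ContinuousOn (fun t => ∫ s in (0 : ℝ)..t, g s) (Icc 0 T) := by
    rw [← uIcc_of_le hT.le]
    exact intervalIntegral.continuousOn_primitive_interval' hg left_mem_uIcc
  have hqc : ContinuousOn q (Icc 0 T) := hp.sub hG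
  have ic : ∀ {f ψ : ℝ → ℝ}, ContinuousOn f (Icc 0 T) → Continuous ψ →
      IntervalIntegrable (fun t => f t * ψ t) volume 0 T := fun hf hψ => by
    refine ContinuousOn.intervalIntegrable ?_
    rw [uIcc_of_le hT.le]
    exact hf.mul hψ.continuousOn
  have hq0 : ∀ φ, IsTestFunction T φ → ∫ t in (0 : ℝ)..T, q t * deriv φ t = 0 := by
    intro φ hφ
    have hφd : Continuous (deriv φ) := (contDiff_infty_iff_deriv.1 hφ.1).2.continuous
    have h1 := h φ hφ
    have h2 := integral_primitive_mul_deriv (c := 0) hT.le hg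
      (p := fun t => ∫ s in (0 : ℝ)..t, g s) (fun t _ => (zero_add _).symm) hφ
    have e : ∫ t in (0 : ℝ)..T, q t * deriv φ t = ∫ t in (0 : ℝ)..T,
        (p t * deriv φ t - (∫ s in (0 : ℝ)..t, g s) * deriv φ t) :=
      intervalIntegral.integral_congr fun t _ => by simp only [hq]; ring
    rw [e, intervalIntegral.integral_sub (ic hp hφd) (ic hG hφd)]
    linarith
  obtain ⟨ρ, hρ, hρ1⟩ := exists_isTestFunction hT
  -- The argument of du Bois-Reymond: `q` has zero weak derivative and `ρ` has integral one. Every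
  -- `ψ - (∫ψ) ρ` is the derivative of a test function, so `∫ q ψ = k ∫ ψ` and `q` is the constant
  -- `k`.
  set k := ∫ t in (0 : ℝ)..T, q t * ρ t with hk
  have hae : ∀ᵐ t, t ∈ Ioo 0 T → q t - k = 0 := by
    refine IsOpen.ae_eq_zero_of_integral_contDiff_smul_eq_zero isOpen_Ioo ?_ ?_
    · exact ((hqc.sub continuousOn_const).mono Ioo_subset_Icc_self).locallyIntegrableOn
        measurableSet_Ioo
    · intro ψ hψ1 hψ2 hψ3
      have hψ : IsTestFunction T ψ := ⟨hψ1, hψ2, hψ3⟩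
      set c := ∫ t in (0 : ℝ)..T, ψ t with hc
      have hχ0 : ∫ t in (0 : ℝ)..T, (ψ t - c * ρ t) = 0 := by
        rw [intervalIntegral.integral_sub (hψ.1.continuous.intervalIntegrable _ _)
          ((hρ.1.continuous.intervalIntegrable _ _).const_mul c),
          intervalIntegral.integral_const_mul, hρ1, mul_one, ← hc, sub_self]
      obtain ⟨h1, h2⟩ := (hψ.sub_smul hρ c).primitive hT hχ0
      have h3 := hq0 _ h1
      rw [h2] at h3
      have e1 : ∫ t in (0 : ℝ)..T, q t * (ψ t - c * ρ t) =
          ∫ t in (0 : ℝ)..T, (q t * ψ t - c * (q t * ρ t)) :=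
        intervalIntegral.integral_congr fun t _ => by ring
      rw [e1, intervalIntegral.integral_sub (ic hqc hψ.1.continuous)
        ((ic hqc hρ.1.continuous).const_mul c), intervalIntegral.integral_const_mul, ← hk] at h3
      have e2 : ∫ t, ψ t • (q t - k) = ∫ t in (0 : ℝ)..T, (q t * ψ t - k * ψ t) := by
        rw [intervalIntegral.integral_of_le hT.le]
        rw [← setIntegral_eq_integral_of_forall_compl_eq_zero (s := Ioc 0 T)]
        · refine integral_congr_ae (Eventually.of_forall fun t => ?_)
          simp only [smul_eq_mul]
          ring
        · intro t ht
          rw [hψ.eq_zero fun hm => ht (Ioo_subset_Ioc_self hm), zero_smul]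
      rw [e2, intervalIntegral.integral_sub (ic hqc hψ.1.continuous)
        ((hψ.1.continuous.intervalIntegrable _ _).const_mul k),
        intervalIntegral.integral_const_mul, ← hc]
      linarith
  have hEq : EqOn q (fun _ => k) (Icc 0 T) := by
    refine Measure.eqOn_Icc_of_ae_eq volume hT.ne ?_ hqc continuousOn_const
    rw [← restrict_Ioo_eq_restrict_Icc, Filter.EventuallyEq, ae_restrict_iff' measurableSet_Ioo]
    filter_upwards [hae] with t ht htm
    linarith [ht htm]
  intro t ht
  have h1 := hEq ht
  have h2 := hEq (⟨le_rfl, hT.le⟩ : (0 : ℝ) ∈ Icc 0 T)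
  simp only [hq, intervalIntegral.integral_same, sub_zero] at h1 h2
  linarith

end TestFunctions

/-! ### Integrated and weak form of the evolution equation -/

section WeakFormulation

variable {X Y : Type*} [NormedAddCommGroup X] [InnerProductSpace ℝ X] [CompleteSpace X]
  [NormedAddCommGroup Y] [InnerProductSpace ℝ Y] [CompleteSpace Y]
  [TopologicalSpace.SeparableSpace X]
  {i : X →L[ℝ] Y} {T μ η : ℝ} {L : ℝ → X →L[ℝ] X →L[ℝ] ℝ}
  {f₁ : ℝ → Y} {f₂ : ℝ → StrongDual ℝ X} {y₀ : Y} {P S : ℝ → Y} {u : ℝ → X}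

omit [CompleteSpace X] [TopologicalSpace.SeparableSpace X] in
theorem integral_dual_apply {F : ℝ → StrongDual ℝ X} {t : ℝ}
    (hF : Integrable F (timeMeasure T)) (ht : t ∈ Icc 0 T) (R : X) :
    (∫ s in (0 : ℝ)..t, F s) R = ∫ s in (0 : ℝ)..t, F s R :=
  ContinuousLinearMap.intervalIntegral_apply
    (integrable_intervalIntegrable hF ⟨le_rfl, ht.1.trans ht.2⟩ ht) R

omit [CompleteSpace X] [TopologicalSpace.SeparableSpace X] in
theorem integrable_dual_apply {F : ℝ → StrongDual ℝ X} (hF : Integrable F (timeMeasure T)) (R : X) :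
    Integrable (fun s => F s R) (timeMeasure T) :=
  (ContinuousLinearMap.apply ℝ ℝ R).integrable_comp hF

omit [CompleteSpace Y] in
theorem integrable_residual (hL : IsUniformForm T μ η L) (h₁ : MemLp f₁ 1 (timeMeasure T))
    (h₂ : MemLp f₂ 2 (timeMeasure T)) (hu : MemLp u 2 (timeMeasure T)) :
    Integrable (fun s => dualEmb i (f₁ s) + f₂ s - (L s (u s) : StrongDual ℝ X))
      (timeMeasure T) := by
  have i3 : Integrable (fun s => (L s (u s) : StrongDual ℝ X)) (timeMeasure T) :=
    memLp_two_integrable (hL.memLp hu)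
  exact Integrable.sub (f := fun s => dualEmb i (f₁ s) + f₂ s)
    (g := fun s => (L s (u s) : StrongDual ℝ X)) (integrable_sum h₁ h₂) i3

theorem memLp_residual (hL : IsUniformForm T μ η L) (h₂ : MemLp f₂ 2 (timeMeasure T))
    (hu : MemLp u 2 (timeMeasure T)) :
    MemLp (fun s => f₂ s - (L s (u s) : StrongDual ℝ X)) 2 (timeMeasure T) :=
  MemLp.sub h₂ (hL.memLp hu)

omit [CompleteSpace Y] in
/-- The integrated form of the evolution equation is equivalent to the weak form. -/
theorem isSol_iff_weak (hT : 0 < T) (hL : IsUniformForm T μ η L)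
    (h₁ : MemLp f₁ 1 (timeMeasure T)) (h₂ : MemLp f₂ 2 (timeMeasure T))
    (hu : MemLp u 2 (timeMeasure T)) (hP : ContinuousOn P (Icc 0 T))
    (hae : ∀ᵐ t ∂timeMeasure T, i (u t) = P t) :
    IsSol i T L f₁ f₂ y₀ P u ↔ P 0 = y₀ ∧ ∀ (R : X) (φ : ℝ → ℝ), IsTestFunction T φ →
      -(∫ t in (0 : ℝ)..T, dualEmb i (P t) R * deriv φ t) =
        ∫ t in (0 : ℝ)..T, (dualEmb i (f₁ t) + f₂ t - (L t (u t) : StrongDual ℝ X)) R * φ t := by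
  have hF := integrable_residual (i := i) hL h₁ h₂ hu
  have hFR : ∀ R : X, IntervalIntegrable (fun t =>
      (dualEmb i (f₁ t) + f₂ t - (L t (u t) : StrongDual ℝ X)) R) volume 0 T := fun R =>
    (integrable_timeMeasure_iff hT.le).1 (integrable_dual_apply hF R)
  constructor
  · intro h
    refine ⟨h.initial, fun R φ hφ => integral_primitive_mul_deriv (c := dualEmb i y₀ R) hT.le
      (hFR R) (fun t ht => ?_) hφ⟩
    rw [h.equation t ht, add_apply, integral_dual_apply hF ht]
  · rintro ⟨h0, h⟩
    refine ⟨hu, hP, hae, h0, fun t ht => ?_⟩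
    ext R
    have hc : ContinuousOn (fun t => dualEmb i (P t) R) (Icc 0 T) := hP.inner continuousOn_const
    rw [add_apply, integral_dual_apply hF ht, ← h0]
    exact eq_primitive_of_weak_deriv hT hc (hFR R) (h R) t ht

-- Splits the tested residual of `IsSol` into the source `q` and the operator term `r`, the form in
-- which they enter the definition of a weak solution.
omit [CompleteSpace Y] in
theorem weak_iff_weak (hT : 0 < T) (hL : IsUniformForm T μ η L)
    (h₁ : MemLp f₁ 1 (timeMeasure T)) (h₂ : MemLp f₂ 2 (timeMeasure T))
    (hu : MemLp u 2 (timeMeasure T)) (hS : MemLp S 1 (timeMeasure T)) {q r : ℝ → StrongDual ℝ X}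
    (hq : ∀ᵐ t ∂timeMeasure T, q t = dualEmb i (f₁ t) + f₂ t)
    (hr : ∀ᵐ t ∂timeMeasure T, r t = L t (u t) + dualEmb i (S t)) (R : X) {φ : ℝ → ℝ}
    (hφ : IsTestFunction T φ) :
    ∫ t in (0 : ℝ)..T, (dualEmb i (f₁ t - S t) + f₂ t - (L t (u t) : StrongDual ℝ X)) R * φ t =
      (∫ t in (0 : ℝ)..T, q t R * φ t) - ∫ t in (0 : ℝ)..T, r t R * φ t := by
  have h0T : (0 : ℝ) ∈ Icc 0 T := ⟨le_rfl, hT.le⟩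
  have hTT : T ∈ Icc 0 T := ⟨hT.le, le_rfl⟩
  have iq : Integrable q (timeMeasure T) :=
    (integrable_congr hq).2 (integrable_sum h₁ h₂)
  have ir : Integrable r (timeMeasure T) := by
    refine (integrable_congr hr).2 ?_
    have i1 : Integrable (fun s => (L s (u s) : StrongDual ℝ X)) (timeMeasure T) :=
      memLp_two_integrable (hL.memLp hu)
    have i2 : Integrable (fun s => dualEmb i (S s)) (timeMeasure T) :=
      (dualEmb i).integrable_comp (memLp_one_iff_integrable.1 hS)
    exact Integrable.add (f := fun s => (L s (u s) : StrongDual ℝ X))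
      (g := fun s => dualEmb i (S s)) i1 i2
  have hc : ∀ {F : ℝ → StrongDual ℝ X}, Integrable F (timeMeasure T) →
      IntervalIntegrable (fun t => F t R * φ t) volume 0 T := fun hF =>
    ((integrable_timeMeasure_iff hT.le).1 (integrable_dual_apply hF R)).mul_continuousOn
      hφ.1.continuous.continuousOn
  rw [← intervalIntegral.integral_sub (hc iq) (hc ir)]
  refine integral_congr_of_ae_timeMeasure ?_ h0T hTT
  filter_upwards [hq, hr] with t hqt hrt
  rw [hqt, hrt, map_sub]
  simp only [add_apply, sub_apply]
  ring

end WeakFormulation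

/-! ### Weak solutions of the Riccati equation -/

section WeakSolution

variable {V H : Type*}
  [NormedAddCommGroup V] [InnerProductSpace ℝ V] [CompleteSpace V]
  [TopologicalSpace.SeparableSpace V]
  [NormedAddCommGroup H] [InnerProductSpace ℝ H] [CompleteSpace H]
  [TopologicalSpace.SeparableSpace H] {j : V →L[ℝ] H}
  {C T μ η γ : ℝ} {a : ℝ → V →L[ℝ] V →L[ℝ] ℝ} {Q : ℝ → StrongDual ℝ (OpV j)} {Q₁ : ℝ → HS H H}
  {Q₂ : ℝ → StrongDual ℝ (OpV j)} {P₀ : HS H H} {P : ℝ → HS H H} {u : ℝ → OpV j}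

omit [TopologicalSpace.SeparableSpace V] [TopologicalSpace.SeparableSpace H] in
theorem riccatiOp_ae_eq (h : ∀ᵐ t ∂timeMeasure T, OpV.toHi j (u t) = P t) :
    ∀ᵐ t ∂timeMeasure T, riccatiOp j (a t) (u t) =
      opForm j (a t) (u t) + dualEmb (OpV.toHi j) (P t).square := by
  filter_upwards [h] with t ht
  rw [riccatiOp_eq, ht]
  rfl

omit [TopologicalSpace.SeparableSpace H] in
theorem memLp_square (hP : ContinuousOn P (Icc 0 T)) :
    MemLp (fun t => (P t).square) 1 (timeMeasure T) :=
  memLp_timeMeasure_of_continuousOn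
    (HS.lipschitzOnBalls_square.continuous.comp_continuousOn hP) 1

/-- The continuous function `P²` counts as part of the integrable data, so the equation is linear as
far as its weak formulation is concerned. -/
theorem IsWeakSolution.isSol (hT : 0 < T) (hη : 0 ≤ η) (ha : IsUniformForm T μ η a)
    (hQ₁ : MemLp Q₁ 1 (timeMeasure T)) (hQ₂ : MemLp Q₂ 2 (timeMeasure T))
    (hQ : ∀ᵐ t ∂timeMeasure T, Q t = dualEmb (OpV.toHi j) (Q₁ t) + Q₂ t)
    (h : IsWeakSolution j T a Q P₀ P u) :
    IsSol (OpV.toHi j) T (fun t => opForm j (a t)) (fun s => Q₁ s - (P s).square) Q₂ P₀ P u := by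
  have hL := isUniformForm_opForm (j := j) ha hη
  have hS := memLp_square h.memW.continuousOn
  have hf₁ : MemLp (fun s => Q₁ s - (P s).square) 1 (timeMeasure T) := MemLp.sub hQ₁ hS
  refine (isSol_iff_weak hT hL hf₁ hQ₂ h.memW.memLp h.memW.continuousOn
    h.memW.ae_eq).2 ⟨h.initial, fun R φ hφ => ?_⟩
  rw [weak_iff_weak hT hL hQ₁ hQ₂ h.memW.memLp hS hQ (riccatiOp_ae_eq h.memW.ae_eq) R hφ]
  exact eq_sub_of_add_eq (h.equation R φ hφ)

theorem IsSol.isWeakSolution (hT : 0 < T) (hη : 0 ≤ η) (ha : IsUniformForm T μ η a)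
    (hQ₁ : MemLp Q₁ 1 (timeMeasure T)) (hQ₂ : MemLp Q₂ 2 (timeMeasure T))
    (hQ : ∀ᵐ t ∂timeMeasure T, Q t = dualEmb (OpV.toHi j) (Q₁ t) + Q₂ t)
    (h : IsSol (OpV.toHi j) T (fun t => opForm j (a t)) (fun s => Q₁ s - (P s).square) Q₂ P₀ P u) :
    IsWeakSolution j T a Q P₀ P u := by
  have hL := isUniformForm_opForm (j := j) ha hη
  have hS := memLp_square h.continuousOn
  have hf₁ : MemLp (fun s => Q₁ s - (P s).square) 1 (timeMeasure T) := MemLp.sub hQ₁ hS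
  have hw := ((isSol_iff_weak hT hL hf₁ hQ₂ h.memLp h.continuousOn h.ae_eq).1 h).2
  refine ⟨⟨h.memLp, h.continuousOn, h.ae_eq, _, ⟨fun s => Q₁ s - (P s).square,
    fun s => Q₂ s - opForm j (a s) (u s), hf₁, memLp_residual hL hQ₂ h.memLp,
    Eventually.of_forall fun s => ?_⟩, hw⟩, h.initial, fun R φ hφ => ?_⟩
  · exact add_sub_assoc _ _ _
  · have h1 := hw R φ hφ
    have h2 := weak_iff_weak hT hL hQ₁ hQ₂ h.memLp hS hQ (riccatiOp_ae_eq h.ae_eq) R hφ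
    exact eq_sub_iff_add_eq.1 (h1.trans h2)

end WeakSolution

/-! ### The scheme in its original form and its piecewise constant interpolation -/

section Interpolation

variable {V H : Type*}
  [NormedAddCommGroup V] [InnerProductSpace ℝ V] [CompleteSpace V]
  [NormedAddCommGroup H] [InnerProductSpace ℝ H] [CompleteSpace H] {j : V →L[ℝ] H}
  {C T μ η γ : ℝ} {a : ℝ → V →L[ℝ] V →L[ℝ] ℝ} {Q : ℝ → StrongDual ℝ (OpV j)} {Q₁ : ℝ → HS H H}
  {Q₂ : ℝ → StrongDual ℝ (OpV j)} {P₀ : HS H H} {u : ℝ → OpV j}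

theorem eulerNodes_succ (P₀ : HS H H) (p : ℕ → OpV j) {N : ℕ} (n : Fin N) :
    eulerNodes j P₀ (fun n : Fin N => p n) n.succ = nodes (OpV.toHi j) P₀ p (n + 1) := rfl

theorem eulerNodes_castSucc (P₀ : HS H H) (p : ℕ → OpV j) {N : ℕ} (n : Fin N) :
    eulerNodes j P₀ (fun n : Fin N => p n) n.castSucc = nodes (OpV.toHi j) P₀ p n := by
  obtain ⟨n, hn⟩ := n
  cases n <;> rfl

/-- The time averages of `a` and `Q` become cell means on 𝒱 and its dual, which makes the abstract
convergence theory applicable. -/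
theorem isEulerSolution_iff [TopologicalSpace.SeparableSpace V] [TopologicalSpace.SeparableSpace H]
    (hT : 0 < T) (hη : 0 ≤ η) (ha : IsUniformForm T μ η a)
    (hQ : ∀ᵐ t ∂timeMeasure T, Q t = dualEmb (OpV.toHi j) (Q₁ t) + Q₂ t) {N : ℕ} {p : ℕ → OpV j} :
    IsEulerSolution j T γ a Q P₀ N (fun n : Fin N => p n) ↔
      IsEuler (OpV.toHi j) T (fun t => opForm j (a t)) HS.square Q₁ Q₂ P₀ (lowerCone H γ) N p := by
  have key : ∀ n : Fin N, ((T / N)⁻¹ • hiEmb j (eulerNodes j P₀ (fun n : Fin N => p n) n.succ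
        - eulerNodes j P₀ (fun n : Fin N => p n) n.castSucc)
      + riccatiOp j (avgForm a (n * (T / N)) ((n + 1) * (T / N))) (p n)
      = (T / N)⁻¹ • ∫ t in (n * (T / N))..((n + 1) * (T / N)), Q t) ↔
      ((T / N)⁻¹ • dualEmb (OpV.toHi j) (nodes (OpV.toHi j) P₀ p (n + 1)
          - nodes (OpV.toHi j) P₀ p n)
        + cellAvg (T / N) n (fun s => (opForm j (a s) (p n) : StrongDual ℝ (OpV j)))
        + dualEmb (OpV.toHi j) (OpV.toHi j (p n)).square
        = cellAvg (T / N) n fun s => dualEmb (OpV.toHi j) (Q₁ s) + Q₂ s) := by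
    intro n
    have hcm := cell_mem hT n.2
    rw [eulerNodes_succ, eulerNodes_castSucc, riccatiOp_eq, opForm_avgForm_eq_cellAvg hT ha hη n.2,
      integral_congr_of_ae_timeMeasure hQ hcm.1 hcm.2, ← add_assoc]
    rfl
  exact ⟨fun h => ⟨fun n hn => h.lower ⟨n, hn⟩, fun n hn => (key ⟨n, hn⟩).1 (h.equation ⟨n, hn⟩)⟩,
    fun h => ⟨fun n => h.mem n n.2, fun n => (key n).2 (h.equation n n.2)⟩⟩

theorem pwConst_apply {N : ℕ} (hT : 0 < T) (p : ℕ → OpV j) {n : ℕ} (hn : n < N) {t : ℝ}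
    (ht : t ∈ Ioc (n * (T / N)) ((n + 1) * (T / N))) :
    pwConst j T (fun n : Fin N => p n) t = p n := by
  have hN : (0 : ℝ) < N := by exact_mod_cast (by omega : 0 < N)
  have hτ : 0 < T / N := by positivity
  rw [pwConst, Finset.sum_eq_single ⟨n, hn⟩]
  · rw [indicator_of_mem ht]
  · intro m _ hmn
    refine indicator_of_notMem (fun hm => hmn (Fin.ext ?_)) _
    have h1 : ((m : ℕ) : ℝ) < n + 1 := lt_of_mul_lt_mul_right (hm.1.trans_le ht.2) hτ.le
    have h2 : (n : ℝ) < (m : ℕ) + 1 := lt_of_mul_lt_mul_right (ht.1.trans_le hm.2) hτ.le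
    have h3 : (m : ℕ) < n + 1 := by exact_mod_cast h1
    have h4 : n < (m : ℕ) + 1 := by exact_mod_cast h2
    change (m : ℕ) = n
    omega
  · exact fun h => absurd (Finset.mem_univ _) h

theorem memLp_pwConst {N : ℕ} (p : Fin N → OpV j) :
    MemLp (pwConst j T p) 2 (timeMeasure T) := by
  have e : pwConst j T p = fun t => ∑ n : Fin N,
    (Ioc (n * (T / N)) ((n + 1) * (T / N))).indicator (fun _ => p n) t := rfl
  rw [e]
  exact memLp_finsetSum _ fun n _ => (memLp_const (p n)).indicator measurableSet_Ioc

theorem integral_pwConst_sub {N : ℕ} (hN : 0 < N) (hT : 0 < T) (p : ℕ → OpV j)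
    (hu : MemLp u 2 (timeMeasure T)) :
    ∫ t in (0 : ℝ)..T, ‖pwConst j T (fun n : Fin N => p n) t - u t‖ ^ 2 =
      ∑ n ∈ Finset.range N, ∫ t in (n * (T / N))..((n + 1) * (T / N)), ‖p n - u t‖ ^ 2 := by
  have hN' : (0 : ℝ) < N := by exact_mod_cast hN
  have hτ : 0 < T / N := by positivity
  have hi := memLp_two_integrable_sq (MemLp.sub (memLp_pwConst fun n : Fin N => p n) hu)
  have h := intervalIntegral.sum_integral_adjacent_intervals (μ := volume)
    (f := fun t => ‖pwConst j T (fun n : Fin N => p n) t - u t‖ ^ 2)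
    (a := fun n : ℕ => (n : ℝ) * (T / N)) (n := N) fun n hn => by
      have hcm := cell_mem hT hn
      rw [Nat.cast_add, Nat.cast_one]
      exact integrable_intervalIntegrable hi hcm.1 hcm.2
  rw [Nat.cast_zero, zero_mul, mul_div_cancel₀ _ hN'.ne'] at h
  rw [← h]
  refine Finset.sum_congr rfl fun n hn => ?_
  rw [Finset.mem_range] at hn
  rw [Nat.cast_add, Nat.cast_one]
  refine intervalIntegral.integral_congr_ae (Eventually.of_forall fun t ht => ?_)
  rw [uIoc_of_le (by nlinarith)] at ht
  rw [pwConst_apply hT p hn ht]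

theorem eLpNorm_eq_sqrt {Z : Type*} [NormedAddCommGroup Z] [InnerProductSpace ℝ Z] (hT : 0 ≤ T)
    {f : ℝ → Z} (hf : MemLp f 2 (timeMeasure T)) :
    eLpNorm f 2 (timeMeasure T) = ENNReal.ofReal √(∫ t in (0 : ℝ)..T, ‖f t‖ ^ 2) := by
  rw [← norm_toLp_sq hT hf, Real.sqrt_sq (norm_nonneg _), Lp.norm_toLp,
    ENNReal.ofReal_toReal hf.eLpNorm_ne_top]

/-- Values from index `N` on are irrelevant to the scheme and are set to zero. -/
theorem exists_nat_extension {Z : Type*} [Zero Z] {N : ℕ} (p : Fin N → Z) :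
    ∃ p' : ℕ → Z, p = fun n : Fin N => p' n :=
  ⟨fun n => if h : n < N then p ⟨n, h⟩ else 0, by funext n; simp⟩

end Interpolation

end Riccati

end

open Riccati

theorem mainTheorem3 {V H : Type*}
    [NormedAddCommGroup V] [InnerProductSpace ℝ V] [CompleteSpace V]
    [TopologicalSpace.SeparableSpace V]
    [NormedAddCommGroup H] [InnerProductSpace ℝ H] [CompleteSpace H]
    [TopologicalSpace.SeparableSpace H]
    (j : V →L[ℝ] H) (hj_inj : Function.Injective j) (hj_dense : DenseRange j)
    (hj_compact : IsCompactOperator j)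
    (C : ℝ) (hC : 0 < C) (hjC : ∀ v, ‖j v‖ ≤ C * ‖v‖)
    (T : ℝ) (hT : 0 < T)
    (μ η : ℝ) (hμ : 0 < μ) (hη : 0 < η)
    (a : ℝ → V →L[ℝ] V →L[ℝ] ℝ) (ha : Riccati.IsUniformForm T μ η a)
    (γ : ℝ) (hγ : 0 ≤ γ) (hγμ : γ < μ / C ^ 2)
    (Q : ℝ → StrongDual ℝ (Riccati.OpV j)) (hQ : Riccati.MemSum j T Q)
    (hQ_lower : ∀ᵐ t ∂(Riccati.timeMeasure T),
      ∃ q ∈ Riccati.lowerCone H (γ ^ 2), Q t = Riccati.hiEmb j q)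
    (P₀ : Riccati.HS H H) (hP₀ : P₀ ∈ Riccati.lowerCone H γ) :
    ∃ (P : ℝ → Riccati.HS H H) (u : ℝ → Riccati.OpV j),
      -- `P` is a weak solution with `P ≥ -γ` on `[0, T]`
      Riccati.IsWeakSolution j T a Q P₀ P u ∧
      (∀ t ∈ Icc 0 T, P t ∈ Riccati.lowerCone H γ) ∧
      -- it is the only one
      (∀ (P' : ℝ → Riccati.HS H H) (u' : ℝ → Riccati.OpV j),
        Riccati.IsWeakSolution j T a Q P₀ P' u' →
        (∀ t ∈ Icc 0 T, P' t ∈ Riccati.lowerCone H γ) → EqOn P' P (Icc 0 T)) ∧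
      -- the schemes are solvable, and their interpolations converge to it
      ∀ N : ℕ → ℕ, (∀ k, 0 < N k) → Tendsto N atTop atTop →
        (⨆ k, T / (N k : ℝ)) < μ / (2 * C ^ 2) →
        (∀ k, ∃ p : Fin (N k) → Riccati.OpV j,
          Riccati.IsEulerSolution j T γ a Q P₀ (N k) p) ∧
        ∀ p : (k : ℕ) → Fin (N k) → Riccati.OpV j,
          (∀ k, Riccati.IsEulerSolution j T γ a Q P₀ (N k) (p k)) →
          Tendsto (fun k => eLpNorm (fun t => Riccati.pwConst j T (p k) t - u t) 2
            (Riccati.timeMeasure T)) atTop (𝓝 0) := by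
  obtain ⟨Q₁, Q₂, hQ₁, hQ₂, hQs⟩ := hQ
  have hQ' : ∀ᵐ t ∂timeMeasure T, Q t = dualEmb (OpV.toHi j) (Q₁ t) + Q₂ t := hQs
  -- The lower bound concerns the sum only; neither `Q₁` nor `Q₂` need be bounded below. It is
  -- therefore expressed in the dual of 𝒱.
  have hQd : ∀ᵐ t ∂timeMeasure T, dualEmb (OpV.toHi j) (Q₁ t) + Q₂ t ∈ dualCone j (γ ^ 2) := by
    filter_upwards [hQ_lower, hQ'] with t ⟨q, hq, hqt⟩ ht
    rw [← ht, hqt]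
    exact hiEmb_mem_dualCone hq
  have hL := isUniformForm_opForm (j := j) ha hη.le
  obtain ⟨P, u, hs, hPc⟩ := exists_riccati_isSol hj_dense hj_compact hC hjC hT hμ hη.le ha hγ hγμ
    hQ₁ hQ₂ hQd hP₀
  have hγC : γ * C ^ 2 < μ := (lt_div_iff₀ (by positivity)).1 hγμ
  -- The loss `2γ` of the square in 𝓗 costs `γ C²` in 𝒱, and this is less than `μ`.
  have hcoer : ∀ x : OpV j, 2 * γ * ‖OpV.toHi j x‖ ^ 2 ≤ γ * C ^ 2 * ‖x‖ ^ 2 := fun x => by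
    have := mul_le_mul_of_nonneg_left (OpV.norm_toHi_sq_le hC.le hjC x) hγ
    linarith
  have hclose : ∀ (P : ℝ → HS H H) (u : ℝ → OpV j), (∀ t ∈ Icc 0 T, P t ∈ lowerCone H γ) →
      IsSol (OpV.toHi j) T (fun t => opForm j (a t)) (fun s => Q₁ s - (P s).square) Q₂ P₀ P u →
      ∀ ε : ℝ, 0 < ε → ∃ δ > 0, ∀ N : ℕ, 0 < N → T / N < δ → ∀ p : ℕ → OpV j,
        IsEuler (OpV.toHi j) T (fun t => opForm j (a t)) HS.square Q₁ Q₂ P₀ (lowerCone H γ) N p →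
        (∑ n ∈ Finset.range N, ∫ t in (n * (T / N))..((n + 1) * (T / N)), ‖p n - u t‖ ^ 2) < ε ∧
        ∀ n < N, ∀ t ∈ Icc (n * (T / N)) ((n + 1) * (T / N)), ‖OpV.toHi j (p n) - P t‖ < ε :=
    fun P u hPc hs ε hε => euler_close hT hL hQ₁ hQ₂ HS.lipschitzOnBalls_square hcoer hγC
      (fun y hy z hz => HS.square_monotone hy hz) (convex_lowerCone γ) (isClosed_lowerCone γ) hPc
      hs hε
  have hexists := exists_riccati_isEuler hj_compact hC hjC hT hμ hη.le ha hγ hγμ hQ₁ hQ₂ hQd hP₀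
  refine ⟨P, u, hs.isWeakSolution hT hη.le ha hQ₁ hQ₂ hQ', hPc, ?_, ?_⟩
  · intro P' u' hw' hPc' t ht
    have hs' := hw'.isSol hT hη.le ha hQ₁ hQ₂ hQ'
    refine eq_of_forall_dist_le fun ε hε => ?_
    obtain ⟨δ, hδ, h⟩ := hclose _ _ hPc hs _ (half_pos hε)
    obtain ⟨δ', hδ', h'⟩ := hclose _ _ hPc' hs' _ (half_pos hε)
    obtain ⟨N, hN, hNδ⟩ := exists_small_step (T := T) (lt_min hδ hδ')
    -- Uniqueness: on a fine grid one Euler solution is within `ε / 2` of both weak solutions,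
    -- uniformly in time.
    obtain ⟨p, hp⟩ := hexists N
    obtain ⟨n, hn, htn⟩ := exists_cell hT hN ht
    have h1 := (h N hN (hNδ.trans_le (min_le_left _ _)) p hp).2 n hn t htn
    have h2 := (h' N hN (hNδ.trans_le (min_le_right _ _)) p hp).2 n hn t htn
    rw [← dist_eq_norm] at h1 h2
    have h3 := dist_triangle_left (P' t) (P t) (OpV.toHi j (p n))
    linarith
  · intro N hN hNt _
    refine ⟨fun k => ?_, fun p hp => ?_⟩
    · obtain ⟨p, hp⟩ := hexists (N k)
      exact ⟨fun n => p n, (isEulerSolution_iff hT hη.le ha hQ').2 hp⟩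
    · choose q hq using fun k => exists_nat_extension (p k)
      have hE : ∀ k, IsEuler (OpV.toHi j) T (fun t => opForm j (a t)) HS.square Q₁ Q₂ P₀
          (lowerCone H γ) (N k) (q k) := fun k => by
        have := hp k
        rw [hq k] at this
        exact (isEulerSolution_iff hT hη.le ha hQ').1 this
      have hnorm : ∀ k, eLpNorm (fun t => pwConst j T (p k) t - u t) 2 (timeMeasure T) =
          ENNReal.ofReal √(∑ n ∈ Finset.range (N k),
            ∫ t in (n * (T / N k))..((n + 1) * (T / N k)), ‖q k n - u t‖ ^ 2) := fun k => by
        rw [hq k, ← integral_pwConst_sub (hN k) hT (q k) hs.memLp]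
        exact eLpNorm_eq_sqrt hT.le (MemLp.sub (memLp_pwConst _) hs.memLp)
      simp only [hnorm]
      rw [← ENNReal.ofReal_zero, ← Real.sqrt_zero]
      -- The squared `L²` distance is the sum over the cells that `hclose` controls for every Euler
      -- solution, whichever one is chosen.
      refine ENNReal.tendsto_ofReal ((Real.continuous_sqrt.tendsto 0).comp ?_)
      rw [Metric.tendsto_nhds]
      intro ε hε
      obtain ⟨δ, hδ, h⟩ := hclose _ _ hPc hs _ hε
      have hτ : Tendsto (fun k => T / (N k : ℝ)) atTop (𝓝 0) :=
        (tendsto_const_div_atTop_nhds_zero_nat T).comp hNt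
      filter_upwards [hτ.eventually_lt_const hδ] with k hk
      rw [Real.dist_eq, sub_zero, abs_of_nonneg]
      · exact (h (N k) (hN k) hk (q k) (hE k)).1
      · refine Finset.sum_nonneg fun n _ => intervalIntegral.integral_nonneg ?_ fun t _ => by
          positivity
        have : 0 < T / (N k : ℝ) := by
          have := hN k
          positivity
        nlinarith
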